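/- **Proposition (finiteness of the Dyson series).** Fix an integer $n\ge 1$ and a mass $m>0$, put $\omega(\boldsymbol k)=\sqrt{|\boldsymbol k|^2+m^2}$, and use Planck units. Let $\mathcal F$ be the symmetric Fock space over $L^2(\mathbb R^3)$, with operators $a(\boldsymbol k),a^\dagger(\boldsymbol k)$ at sharp momentum (quadratic forms, $[a(\boldsymbol k),a^\dagger(\boldsymbol k')]=\delta^{(3)}(\boldsymbol k-\boldsymbol k')$), and let $D_{\mathcal S}\subset\mathcal F$ be the subspace of vectors with finitely many particles and with Schwartz components. Let $$\phi(t,\boldsymbol x)=\frac1{(2\pi)^{3/2}}\int_{\mathbb R^3}\frac{d\boldsymbol k}{\sqrt{2\omega(\boldsymbol k)}}\Big\{e^{i(\omega(\boldsymbol k)t-\boldsymbol k\cdot\boldsymbol x)}a^\dagger(\boldsymbol k)+e^{-i(\omega(\boldsymbol k)t-\boldsymbol k\cdot\boldsymbol x)}a(\boldsymbol k)\Big\}$$ be the free field, $\phi(x)=\int d^4k\,\check\phi(k)e^{ikx}$, and let $$\mathcal L_{\rm eff}(x)=\int d^4k_1\cdots d^4k_n\; r_n(k_1,\dots,k_n)\,{:}\check\phi(k_1)\cdots\check\phi(k_n){:}\;e^{i(k_1+\dots+k_n)x},$$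 $$r_n(k_1,\dots,k_n)=\exp\Big\{-\tfrac12\sum_{\mu=0}^3\Big(\sum_{j}k_{j\mu}^2-\tfrac1n\sum_{j,l}k_{j\mu}k_{l\mu}\Big)\Big\},$$ be the effective nonlocal interaction given by the $n$-th quantum Wick power, as a quadratic form on $D_{\mathcal S}\times D_{\mathcal S}$. Let $\lambda(t,\boldsymbol x)=\lambda'(t)\lambda''(\boldsymbol x)$ with complex-valued $\lambda'\in\mathcal S(\mathbb R)$, $\lambda''\in\mathcal S(\mathbb R^3)$. (1) For every $t$ there is a unique linear operator $H(t):D_{\mathcal S}\to D_{\mathcal S}$ with quadratic form $\int d\boldsymbol x\,\lambda(t,\boldsymbol x)\mathcal L_{\rm eff}(t,\boldsymbol x)$. (2) The Dyson series $S[\lambda]=T\exp\{-i\int d^4x\,\lambda(x)\mathcal L_{\rm eff}(x)\}=I+\sum_{N\ge1}(-i)^NS^{(N)}[\lambda]$ is finite at all orders: for every $N\ge 0$ the integral $$S^{(N)}[\lambda]=\int_{t_1>\dots>t_N}H(t_1)\cdots H(t_N)\,dt_1\cdots dt_N$$ converges absolutely in the sense of quadratic forms on $D_{\mathcal S}\times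 D_{\mathcal S}$ and defines a linear operator $D_{\mathcal S}\to D_{\mathcal S}$, closable with core $D_{\mathcal S}$ (and $S^{(0)}=I$). (3) For $J_\bullet=(J_1,\dots,J_N)$ with $J_M\subseteq\{1,\dots,n\}$, put $\epsilon_{Mj}=1$ if $j\in J_M$ and $\epsilon_{Mj}=-1$ otherwise, and for $\underline{\boldsymbol k}=(\boldsymbol k_{Mj})\in\mathbb R^{3nN}$ put $\kappa_{Mj}=\epsilon_{Mj}(\omega(\boldsymbol k_{Mj}),\boldsymbol k_{Mj})$, and $$K^{J_\bullet}(\underline{\boldsymbol k})=\Big(\frac{1}{(2\pi)^{3/2}\sqrt2}\Big)^{nN}\int_{t_1>\dots>t_N}dt\int_{\mathbb R^{3N}}d\boldsymbol x\prod_{M=1}^N\lambda'(t_M)\lambda''(\boldsymbol x_M)\,r_n(\kappa_{M1},\dots,\kappa_{Mn})\,e^{i\sum_j(\kappa_{Mj}^0t_M-\boldsymbol\kappa_{Mj}\cdot\boldsymbol x_M)}.$$ Then $S^{(N)}[\lambda]$ is, on $D_{\mathcal S}$, a finite sum of operators $D_{\mathcal S}\to D_{\mathcal S}$, each closable with common core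 $D_{\mathcal S}$, each being a term of the Wick reduction, that is, with quadratic form $$\int W(\boldsymbol p,\boldsymbol q)\,a^\dagger(\boldsymbol p_1)\cdots a^\dagger(\boldsymbol p_r)a(\boldsymbol q_1)\cdots a(\boldsymbol q_s)\,d\boldsymbol p\,d\boldsymbol q .$$ Here a term is given by a choice of $J_\bullet$ and of a set of disjoint pairs (contractions), each consisting of a destruction leg $(M,j)$, $j\notin J_M$, and a creation leg $(M',j')$, $j'\in J_{M'}$, with $M<M'$. The $\boldsymbol p_i$ and $\boldsymbol q_i$ are the momenta of the unpaired creation and destruction legs, and $W$ is $K^{J_\bullet}(\underline{\boldsymbol k})/\sqrt{\prod_{M,j}\omega(\boldsymbol k_{Mj})}$ with equal momenta for the two legs of each pair, integrated over the momenta of the pairs. Each of these kernels $W$ is a Schwartz function. (4) Each $K^{J_\bullet}$ is a Schwartz function on $\mathbb R^{3nN}$ with Gaussian decay: for every $d\in\mathbb N$ there is $C$ with $$|K^{J_\bullet}(\underline{\boldsymbol k})|\prod_{M}\Big(1+\Big|\sum_j\epsilon_{Mj}\boldsymbol k_{Mj}\Big|\Big)^{d}\le C\exp\Big\{-\tfrac12\sum_{M}\sum_{j}\Big|\kappa_{Mj}-\tfrac1n\sum_l\kappa_{Ml}\Big|^2\Big\}\quad\text{for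 all }\underline{\boldsymbol k},$$ where $|\cdot|$ on the right is the Euclidean norm of $\mathbb R^4$. (5) If $\lambda$ is real-valued, $S[\lambda]$ is unitary as a formal series: the $S^{(N)}[\lambda]$ have adjoints $R^{(N)}:D_{\mathcal S}\to D_{\mathcal S}$ (i.e. $\langle R^{(N)}\Phi,\Psi\rangle=\langle\Phi,S^{(N)}[\lambda]\Psi\rangle$), and for all $N\ge0$ and $\Phi,\Psi\in D_{\mathcal S}$ $$\sum_{a+b=N}\langle(-i)^aS^{(a)}[\lambda]\Phi,(-i)^bS^{(b)}[\lambda]\Psi\rangle=\delta_{N0}\langle\Phi,\Psi\rangle=\sum_{a+b=N}\langle i^aR^{(a)}\Phi,i^bR^{(b)}\Psi\rangle .$$ -/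

import Mathlib

open MeasureTheory ComplexConjugate
open scoped SchwartzMap InnerProductSpace

noncomputable section

namespace QSTDyson

/-- Three-dimensional momentum (or position) space. -/
abbrev Mom : Type := EuclideanSpace ℝ (Fin 3)

/-! ### The symmetric Fock space over `L²(ℝ³)` and its Schwartz domain -/

/-- Permuting the particle arguments preserves Lebesgue measure on `(ℝ³)^l`. -/
theorem measurePreserving_perm (l : ℕ) (σ : Equiv.Perm (Fin l)) :
    MeasurePreserving (fun k : Fin l → Mom => k ∘ σ) volume volume :=
  volume_preserving_arrowCongr' σ.symm (MeasurableEquiv.refl Mom) (MeasurePreserving.id _)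

instance volumeHasTemperateGrowth (l : ℕ) :
    (volume : Measure (Fin l → Mom)).HasTemperateGrowth :=
  Measure.IsAddHaarMeasure.instHasTemperateGrowth (h := inferInstance)

/-- The `l`-particle space: symmetric square integrable functions of `l` momenta. -/
def symL2 (l : ℕ) : Submodule ℂ (Lp ℂ 2 (volume : Measure (Fin l → Mom))) :=
  ⨅ σ : Equiv.Perm (Fin l),
    LinearMap.eqLocus (Lp.compMeasurePreservingₗ ℂ _ (measurePreserving_perm l σ)) LinearMap.id

/-- The symmetric Fock space: the Hilbert sum of the `l`-particle spaces. -/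
abbrev Fock : Type := lp (fun l : ℕ => symL2 l) 2

/-- Symmetric Schwartz functions of `l` momenta. -/
def symSchwartz (l : ℕ) : Submodule ℂ 𝓢(Fin l → Mom, ℂ) where
  carrier := {f | ∀ (σ : Equiv.Perm (Fin l)) (k : Fin l → Mom), f (k ∘ σ) = f k}
  add_mem' := fun hf hg σ k => by simp [hf σ k, hg σ k]
  zero_mem' := fun _ _ => rfl
  smul_mem' := fun c f hf σ k => by simp [hf σ k]

/-- Finite sequences of symmetric Schwartz functions, i.e. the finite particle vectors with
Schwartz components, described by their components. -/
abbrev SchwartzFock : Type := Π₀ l : ℕ, symSchwartz l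

/-- A symmetric Schwartz function as an `l`-particle vector. -/
def symToL2 (l : ℕ) : symSchwartz l →ₗ[ℂ] symL2 l :=
  LinearMap.codRestrict (symL2 l)
    ((SchwartzMap.toLpCLM ℂ ℂ 2 (volume : Measure (Fin l → Mom))).toLinearMap ∘ₗ
      (symSchwartz l).subtype) (by
    intro f
    simp only [symL2, Submodule.mem_iInf, LinearMap.mem_eqLocus]
    intro σ
    have hσ := measurePreserving_perm l σ
    apply Lp.ext
    have h0 := (f : 𝓢(Fin l → Mom, ℂ)).coeFn_toLp 2 (volume : Measure (Fin l → Mom))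
    refine (Lp.coeFn_compMeasurePreserving _ hσ).trans ?_
    have h1 := hσ.quasiMeasurePreserving.ae_eq_comp h0
    refine h1.trans ?_
    refine Filter.EventuallyEq.trans ?_ h0.symm
    filter_upwards with k
    exact f.2 σ k)

/-- The inclusion of the finite particle Schwartz vectors into Fock space. -/
def toFock : SchwartzFock →ₗ[ℂ] Fock :=
  DFinsupp.lsum ℂ fun l => (lp.lsingle (𝕜 := ℂ) (E := fun l : ℕ => symL2 l) 2 l) ∘ₗ symToL2 l

/-- The subspace `D_S` of Fock space: vectors with finitely many particles and with Schwartz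
components. -/
def DS : Submodule ℂ Fock := LinearMap.range toFock

/-- `A`, an operator on the finite particle Schwartz vectors, is closable as an operator in Fock
space, with core `D_S`: there is a closed operator with core `D_S` whose graph contains the pairs
`(ψ, A ψ)`, `ψ ∈ D_S`. -/
def ClosableWithCoreDS (A : Module.End ℂ SchwartzFock) : Prop :=
  ∃ T : Fock →ₗ.[ℂ] Fock, T.IsClosed ∧ T.HasCore DS ∧
    ∀ ψ : SchwartzFock, (toFock ψ, toFock (A ψ)) ∈ T.graph

/-! ### Creation and destruction operators at sharp momentum, as quadratic forms -/

/-- A sequence of `l`-particle wave functions, defined pointwise. -/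
abbrev Wave : Type := ∀ l : ℕ, (Fin l → Mom) → ℂ

/-- The pointwise wave functions of a vector of `D_S`. -/
def wave (ψ : SchwartzFock) : Wave := fun l k => (ψ l : 𝓢(Fin l → Mom, ℂ)) k

/-- The destruction operator at sharp momentum:
`(a(k)ψ)^(l) (q_1, …, q_l) = √(l+1) ψ^(l+1) (k, q_1, …, q_l)`. -/
def destroy (k : Mom) (ψ : Wave) : Wave :=
  fun l q => (Real.sqrt (l + 1) : ℂ) * ψ (l + 1) (Fin.cons k q)

/-- The Fock scalar product of pointwise wave functions. -/
def waveInner (φ ψ : Wave) : ℂ := ∑' l : ℕ, ∫ q : Fin l → Mom, conj (φ l q) * ψ l q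

/-- The quadratic form `⟨Φ, a†(p_1) ⋯ a†(p_r) a(q_1) ⋯ a(q_s) Ψ⟩`, that is
`⟨a(p_r) ⋯ a(p_1) Φ, a(q_1) ⋯ a(q_s) Ψ⟩`. -/
def normalForm (p q : List Mom) (Φ Ψ : SchwartzFock) : ℂ :=
  waveInner (p.foldl (fun φ k => destroy k φ) (wave Φ)) (q.foldr destroy (wave Ψ))

/-! ### The effective interaction -/

/-- The one-particle energy `ω(k) = √(|k|² + m²)`. -/
def omega (m : ℝ) (k : Mom) : ℝ := Real.sqrt (‖k‖ ^ 2 + m ^ 2)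

/-- The sign `+1` for creation legs (`j ∈ J`), `-1` for destruction legs (`j ∉ J`). -/
def sgn {n : ℕ} (J : Finset (Fin n)) (j : Fin n) : ℝ := if j ∈ J then 1 else -1

/-- The signed on-shell four-momenta `± (ω(k_j), k_j)`, `j = 1, …, n`. -/
def shell {n : ℕ} (m : ℝ) (J : Finset (Fin n)) (k : Fin n → Mom) (j : Fin n) : ℝ × Mom :=
  (sgn J j * omega m (k j), sgn J j • k j)

/-- The kernel `r_n` of the quantum diagonal map:
`exp (-½ ∑_μ (∑_j k_{jμ}² - n⁻¹ ∑_{j,l} k_{jμ} k_{lμ}))`, in Planck units. -/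
def rKer {n : ℕ} (k : Fin n → ℝ × Mom) : ℝ :=
  Real.exp (-(1 / 2) *
    ((∑ j, ((k j).1 ^ 2 + ‖(k j).2‖ ^ 2)) -
      (1 / (n : ℝ)) * ∑ j, ∑ l, ((k j).1 * (k l).1 + ⟪(k j).2, (k l).2⟫_ℝ)))

/-- The plane wave `exp (i ∑_j k_{jμ} x^μ)` for the signature `(+,-,-,-)`. -/
def planeWave {n : ℕ} (k : Fin n → ℝ × Mom) (t : ℝ) (x : Mom) : ℂ :=
  Complex.exp (Complex.I * ((∑ j, ((k j).1 * t - ⟪(k j).2, x⟫_ℝ) : ℝ) : ℂ))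

/-- The quadratic form `⟨Φ, L_eff(t,x) Ψ⟩` on `D_S × D_S`, where
`L_eff(x) = ∫ dk_1 ⋯ dk_n r_n(k_1,…,k_n) :φ̌(k_1) ⋯ φ̌(k_n): exp (i (k_1 + ⋯ + k_n) x)`
and `φ` is the free field of mass `m`,
`φ(t,x) = (2π)^{-3/2} ∫ dk (2 ω(k))^{-1/2} (e^{i(ω(k)t - k·x)} a†(k) + e^{-i(ω(k)t - k·x)} a(k))`.
The term with index `J` collects the creation parts of the fields `j ∈ J` and the destruction
parts of the others, so that `k_j` runs over the positive or negative mass shell. -/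
def leffForm (n : ℕ) (m t : ℝ) (x : Mom) (Φ Ψ : SchwartzFock) : ℂ :=
  ∑ J : Finset (Fin n), ∫ k : Fin n → Mom,
    ((∏ j, 1 / ((2 * Real.pi) ^ (3 / 2 : ℝ) * Real.sqrt (2 * omega m (k j))) : ℝ) : ℂ) *
      (rKer (shell m J k) : ℂ) * planeWave (shell m J k) t x *
      normalForm ((J.sort (· ≤ ·)).map k) ((Jᶜ.sort (· ≤ ·)).map k) Φ Ψ

/-- The quadratic form of the cutoff interaction Hamiltonian at time `t`,
`H(t) = ∫ dx λ'(t) λ''(x) L_eff(t,x)`. -/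
def hamForm (n : ℕ) (m : ℝ) (lamT : 𝓢(ℝ, ℂ)) (lamX : 𝓢(Mom, ℂ)) (t : ℝ)
    (Φ Ψ : SchwartzFock) : ℂ :=
  ∫ x : Mom, lamT t * lamX x * leffForm n m t x Φ Ψ

/-- `H` is the family of operators on `D_S` with the quadratic forms `hamForm`. -/
def IsCutoffHamiltonian (n : ℕ) (m : ℝ) (lamT : 𝓢(ℝ, ℂ)) (lamX : 𝓢(Mom, ℂ))
    (H : ℝ → Module.End ℂ SchwartzFock) : Prop :=
  ∀ (t : ℝ) (Φ Ψ : SchwartzFock),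
    ⟪toFock Φ, toFock (H t Ψ)⟫_ℂ = hamForm n m lamT lamX t Φ Ψ

/-! ### The time-ordered Dyson series -/

/-- The time-ordered region `t_1 > t_2 > ⋯ > t_N`. -/
def ordered (N : ℕ) : Set (Fin N → ℝ) := {t | StrictAnti t}

/-- The matrix elements of the product `H(t_1) H(t_2) ⋯ H(t_N)`. -/
def orderedProd (H : ℝ → Module.End ℂ SchwartzFock) (N : ℕ) (Φ Ψ : SchwartzFock)
    (t : Fin N → ℝ) : ℂ :=
  ⟪toFock Φ, toFock ((List.ofFn fun M => H (t M)).prod Ψ)⟫_ℂ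

/-- `S` is the `N`-th order coefficient
`S^(N) = ∫_{t_1 > ⋯ > t_N} H(t_1) ⋯ H(t_N) dt_1 ⋯ dt_N` of
`T exp (-i ∫ H(t) dt) = I + ∑_N (-i)^N S^(N)`; the integral converges absolutely in the sense of
quadratic forms on `D_S × D_S`. -/
def IsDysonTerm (H : ℝ → Module.End ℂ SchwartzFock) (N : ℕ)
    (S : Module.End ℂ SchwartzFock) : Prop :=
  ∀ Φ Ψ : SchwartzFock, IntegrableOn (orderedProd H N Φ Ψ) (ordered N) ∧
    ⟪toFock Φ, toFock (S Ψ)⟫_ℂ = ∫ t in ordered N, orderedProd H N Φ Ψ t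

/-! ### Momentum kernels and Wick reduction -/

/-- The momentum kernel `K^{J_1,…,J_N}(k)` of the `N`-th order term in which the legs
`(M, j)`, `j ∈ J_M`, carry creation operators and the others destruction operators
(without the factors `ω^{-1/2}`). -/
def dysonKernel (n : ℕ) (m : ℝ) (lamT : 𝓢(ℝ, ℂ)) (lamX : 𝓢(Mom, ℂ)) {N : ℕ}
    (J : Fin N → Finset (Fin n)) (k : Fin N → Fin n → Mom) : ℂ :=
  ((1 / ((2 * Real.pi) ^ (3 / 2 : ℝ) * Real.sqrt 2) : ℝ) : ℂ) ^ (n * N) *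
    ∫ t in ordered N, ∫ x : Fin N → Mom,
      ∏ M, (lamT (t M) * lamX (x M) * (rKer (shell m (J M) (k M)) : ℂ) *
        planeWave (shell m (J M) (k M)) (t M) (x M))

/-- The sum over the vertices of the squared Euclidean deviations of the signed on-shell
four-momenta from their mean at the vertex. -/
def vertexSpread {n N : ℕ} (m : ℝ) (J : Fin N → Finset (Fin n)) (k : Fin N → Fin n → Mom) : ℝ :=
  ∑ M, ∑ j,
    (((shell m (J M) (k M) j).1 - (1 / (n : ℝ)) * ∑ l, (shell m (J M) (k M) l).1) ^ 2 +
      ‖(shell m (J M) (k M) j).2 - (1 / (n : ℝ)) • ∑ l, (shell m (J M) (k M) l).2‖ ^ 2)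

/-- The total signed three-momentum at the vertex `M`. -/
def vertexSum {n N : ℕ} (J : Fin N → Finset (Fin n)) (k : Fin N → Fin n → Mom) (M : Fin N) :
    Mom :=
  ∑ j, sgn (J M) j • k M j

/-- A term of the Wick reduction of a product of `N` normally ordered monomials of degree `n`: a
choice of creation legs at each vertex, and a set of contractions of destruction legs with creation
legs at later (further right) vertices. There are `r` free creation legs, `s` free destruction
legs and `c` contracted pairs. -/
structure WickTerm (n N : ℕ) where
  /-- the creation legs at each vertex -/
  J : Fin N → Finset (Fin n)
  /-- number of uncontracted creation operators -/
  r : ℕ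
  /-- number of uncontracted destruction operators -/
  s : ℕ
  /-- number of contractions -/
  c : ℕ
  /-- labelling of all legs: free creation, contracted creation, free destruction, contracted
  destruction -/
  leg : (Fin r ⊕ Fin c) ⊕ (Fin s ⊕ Fin c) ≃ Fin N × Fin n
  creation : ∀ i, (leg (Sum.inl i)).2 ∈ J (leg (Sum.inl i)).1
  destruction : ∀ i, (leg (Sum.inr i)).2 ∉ J (leg (Sum.inr i)).1
  contraction : ∀ u : Fin c, (leg (Sum.inr (Sum.inr u))).1 < (leg (Sum.inl (Sum.inr u))).1

/-- The momenta of all legs in terms of the free momenta `p`, `q` and of the momenta `u` shared by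
the contracted pairs. -/
def WickTerm.momenta {n N : ℕ} (τ : WickTerm n N) (p : Fin τ.r → Mom) (q : Fin τ.s → Mom)
    (u : Fin τ.c → Mom) : Fin N → Fin n → Mom :=
  fun M j => Sum.elim (Sum.elim p u) (Sum.elim q u) (τ.leg.symm (M, j))

/-- The kernel `W(p,q)` of a term of the Wick reduction: `K / √(∏ ω)` with equal momenta for the two
legs of each contracted pair, integrated over the momenta of the contracted pairs. -/
def WickTerm.kernel {n N : ℕ} (m : ℝ) (lamT : 𝓢(ℝ, ℂ)) (lamX : 𝓢(Mom, ℂ)) (τ : WickTerm n N)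
    (p : Fin τ.r → Mom) (q : Fin τ.s → Mom) : ℂ :=
  ∫ u : Fin τ.c → Mom,
    dysonKernel n m lamT lamX τ.J (τ.momenta p q u) /
      ((∏ M, ∏ j, Real.sqrt (omega m (τ.momenta p q u M j)) : ℝ) : ℂ)

/-- The quadratic form of `∫ dp dq W(p,q) a†(p_1) ⋯ a†(p_r) a(q_1) ⋯ a(q_s)`. -/
def wickForm {r s : ℕ} (W : (Fin r → Mom) → (Fin s → Mom) → ℂ) (Φ Ψ : SchwartzFock) : ℂ :=
  ∫ z : (Fin r → Mom) × (Fin s → Mom),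
    W z.1 z.2 * normalForm (List.ofFn z.1) (List.ofFn z.2) Φ Ψ

/-- `A` is the operator on `D_S` with the quadratic form of the Wick term `τ`. -/
def IsWickOperator {n N : ℕ} (m : ℝ) (lamT : 𝓢(ℝ, ℂ)) (lamX : 𝓢(Mom, ℂ)) (τ : WickTerm n N)
    (A : Module.End ℂ SchwartzFock) : Prop :=
  ∀ Φ Ψ : SchwartzFock,
    ⟪toFock Φ, toFock (A Ψ)⟫_ℂ = wickForm (τ.kernel m lamT lamX) Φ Ψ

/-- Unitarity of the formal series `∑_N (-i)^N S^(N)`, order by order: the operators `S^(N)` have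
adjoints `R^(N)` on `D_S`, and `S* S = I = S S*` as formal power series, in the sense of quadratic
forms on `D_S × D_S`. -/
def FormallyUnitary (S : ℕ → Module.End ℂ SchwartzFock) : Prop :=
  ∃ R : ℕ → Module.End ℂ SchwartzFock,
    (∀ (N : ℕ) (Φ Ψ : SchwartzFock),
      ⟪toFock (R N Φ), toFock Ψ⟫_ℂ = ⟪toFock Φ, toFock (S N Ψ)⟫_ℂ) ∧
    (∀ (N : ℕ) (Φ Ψ : SchwartzFock),
      (∑ j ∈ Finset.range (N + 1),
        ⟪(-Complex.I) ^ j • toFock (S j Φ), (-Complex.I) ^ (N - j) • toFock (S (N - j) Ψ)⟫_ℂ) =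
          if N = 0 then ⟪toFock Φ, toFock Ψ⟫_ℂ else 0) ∧
    (∀ (N : ℕ) (Φ Ψ : SchwartzFock),
      (∑ j ∈ Finset.range (N + 1),
        ⟪Complex.I ^ j • toFock (R j Φ), Complex.I ^ (N - j) • toFock (R (N - j) Ψ)⟫_ℂ) =
          if N = 0 then ⟪toFock Φ, toFock Ψ⟫_ℂ else 0)

end QSTDyson

end

open QSTDyson

/-!
# Finiteness and formal unitarity of the Dyson series of a Gaussian-smeared Wick power

Why the series is finite. In momentum space a vertex carries the kernel
`r_n(κ) · λ̂''(∑ κ) · ∏ ω^{-1/2}`. By `rKer_eq`, `r_n` is a Gaussian in the deviations of the signed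
on-shell four-momenta from their mean. The spatial deviations together with the total spatial
momentum determine all momenta, so the spatial Gaussian times the Fourier transform of the cutoff is
a Schwartz function (`isSchwartz_spaceFactor`). All other factors have temperate growth: the
energies and their powers because `m > 0`, the Gaussian in the energies, and the time-ordered
integral of `∏ λ'(t_M) e^{i E_M t_M}` as a function of the energies `E_M`, since its derivatives
only produce moments of a Schwartz function (`hasTemperateGrowth_orderedFourier`). The sharp time
ordering therefore does not destroy smoothness or decay, and `K^J` is a Schwartz function
(`isSchwartz_dysonKernel`). The time-ordered integral is moreover bounded, which leaves the product
of the `r_n` as a Gaussian majorant (`dysonKernel_gaussian_bound`).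

Operators. For a Schwartz kernel `W`, the Wick monomial `∫ W a† ⋯ a† a ⋯ a` acts on pointwise wave
functions and preserves symmetry, boundedness of the particle number and the Schwartz property;
this defines `wickOp W` on `D_S`. Its quadratic form is the expected one (`inner_wickOp`), and the
monomial with the conjugate kernel is an adjoint of it on `D_S`. Since `D_S` is dense, the existence
of an adjoint on `D_S` gives closability (`IsAdjointOn.closable`), for the single terms as well as
for their sums.

Wick reduction. A product of vertices is a word in letters `∫ dp_y a†(p_y)` and `a(p_x)` acting on
`V(p) Ψ`, followed by integration over the momenta `p_x` of the destruction letters. The commutation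
relation, in the pointwise form `destroy_cre`, moves the destruction letters to the right; every
commutator replaces the momentum of a creation letter further to the right by `p_x`. An induction on
the word (`word_eq_sum`) gives the sum over all contraction schemes, and Fubini's theorem, justified
by product bounds on the wave functions (`Tame`), collects the integrations in the kernel
(`exists_wickTerms`). The time integral is exchanged with the momentum integrals in the same way
(`exists_dysonTerm`).

Unitarity. For real `λ` the Hamiltonians are symmetric, so `⟨S^(a) Φ, S^(b) Ψ⟩` is the integral of
`⟨Φ, H(τ_1) ⋯ H(τ_N) Ψ⟩`, `N = a + b`, over the times which increase along the first `a` indices and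
decrease along the others. Such a region splits, up to null sets, according to which of the two
monotone pieces the larger of the times at the junction continues, and the alternating sum over `a`
telescopes to zero (`sum_upDown`); this is `S* S = 1`. As formal power series with constant term `1`
are invertible, the left inverse `S*` is also a right inverse (`formallyUnitary_of_isometry`).
-/

noncomputable section

namespace QSTDyson

/-! ### Closure properties of Schwartz functions -/

/-- The function `f` is (the underlying function of) a Schwartz function. -/
def IsSchwartz {E V : Type*} [NormedAddCommGroup E] [NormedSpace ℝ E] [NormedAddCommGroup V]
    [NormedSpace ℝ V] (f : E → V) : Prop :=
  ∃ F : 𝓢(E, V), ∀ x, F x = f x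

section Schwartz

variable {E F V : Type} [NormedAddCommGroup E] [NormedSpace ℝ E]
  [NormedAddCommGroup F] [NormedSpace ℝ F] [NormedAddCommGroup V] [NormedSpace ℝ V]

theorem isSchwartz_coe (f : 𝓢(E, V)) : IsSchwartz f := ⟨f, fun _ => rfl⟩

theorem IsSchwartz.continuous {f : E → V} (hf : IsSchwartz f) : Continuous f := by
  obtain ⟨g, hg⟩ := hf
  rw [← funext hg]
  exact g.continuous

theorem IsSchwartz.congr {f g : E → V} (hf : IsSchwartz f) (h : ∀ x, f x = g x) :
    IsSchwartz g := by rwa [← funext h]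

theorem IsSchwartz.add {f g : E → V} (hf : IsSchwartz f) (hg : IsSchwartz g) :
    IsSchwartz fun x => f x + g x := by
  obtain ⟨f', hf⟩ := hf
  obtain ⟨g', hg⟩ := hg
  exact ⟨f' + g', fun x => by simp [hf, hg]⟩

theorem isSchwartz_zero : IsSchwartz fun _ : E => (0 : V) := ⟨0, fun _ => rfl⟩

theorem IsSchwartz.sum {ι : Type*} {s : Finset ι} {f : ι → E → V}
    (hf : ∀ i ∈ s, IsSchwartz (f i)) : IsSchwartz fun x => ∑ i ∈ s, f i x := by
  classical
  induction s using Finset.induction_on with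
  | empty => simpa using isSchwartz_zero
  | insert a s ha ih =>
    simp only [Finset.sum_insert ha]
    exact (hf a (by simp)).add (ih fun i hi => hf i (by simp [hi]))

theorem IsSchwartz.temperate_mul {f : E → ℂ} (hf : IsSchwartz f) {g : E → ℂ}
    (hg : g.HasTemperateGrowth) : IsSchwartz fun x => g x * f x := by
  obtain ⟨f', hf⟩ := hf
  exact ⟨SchwartzMap.smulLeftCLM ℂ g f', fun x => by
    rw [SchwartzMap.smulLeftCLM_apply_apply hg, hf, smul_eq_mul]⟩

theorem IsSchwartz.const_mul {f : E → ℂ} (hf : IsSchwartz f) (c : ℂ) :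
    IsSchwartz fun x => c * f x :=
  hf.temperate_mul (.const c)

theorem IsSchwartz.star {f : E → ℂ} (hf : IsSchwartz f) : IsSchwartz fun x => conj (f x) := by
  obtain ⟨f', hf⟩ := hf
  exact ⟨SchwartzMap.postcompCLM (𝕜 := ℝ) Complex.conjCLE.toContinuousLinearMap f', fun x => by
    simp [SchwartzMap.postcompCLM_apply, hf]⟩

/-- A Schwartz function composed with an injective linear map is a Schwartz function. -/
theorem IsSchwartz.comp_injective [FiniteDimensional ℝ F] {f : E → V} (hf : IsSchwartz f)
    (L : F →ₗ[ℝ] E) (hL : Function.Injective L) : IsSchwartz fun x => f (L x) := by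
  obtain ⟨f', hf⟩ := hf
  obtain ⟨K, -, hK⟩ := LinearMap.exists_antilipschitzWith L (LinearMap.ker_eq_bot.2 hL)
  have hT : Function.HasTemperateGrowth L :=
    (LinearMap.toContinuousLinearMap L).hasTemperateGrowth
  exact ⟨SchwartzMap.compCLMOfAntilipschitz ℝ hT hK f', fun x => by simp [hf]⟩

theorem IsSchwartz.tensor {f : E → ℂ} {g : F → ℂ} (hf : IsSchwartz f) (hg : IsSchwartz g) :
    IsSchwartz fun z : E × F => f z.1 * g z.2 := by
  obtain ⟨f, rfl⟩ : ∃ f' : 𝓢(E, ℂ), f = f' := by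
    obtain ⟨f', h⟩ := hf; exact ⟨f', funext fun x => (h x).symm⟩
  obtain ⟨g, rfl⟩ : ∃ g' : 𝓢(F, ℂ), g = g' := by
    obtain ⟨f', h⟩ := hg; exact ⟨f', funext fun x => (h x).symm⟩
  have hf1 : ContDiff ℝ (⊤ : ℕ∞) fun z : E × F => f z.1 := (f.smooth ⊤).comp contDiff_fst
  have hg1 : ContDiff ℝ (⊤ : ℕ∞) fun z : E × F => g z.2 := (g.smooth ⊤).comp contDiff_snd
  have bf : ∀ (i : ℕ) (z : E × F), ‖iteratedFDeriv ℝ i (fun z : E × F => f z.1) z‖ ≤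
      ‖iteratedFDeriv ℝ i f z.1‖ := fun i z => by
    have := (ContinuousLinearMap.fst ℝ E F).iteratedFDeriv_comp_right (f.smooth ⊤) z
      (i := i) (by exact_mod_cast le_top)
    change ‖iteratedFDeriv ℝ i (f ∘ ContinuousLinearMap.fst ℝ E F) z‖ ≤ _
    rw [this]
    refine (ContinuousMultilinearMap.norm_compContinuousLinearMap_le _ _).trans ?_
    refine mul_le_of_le_one_right (norm_nonneg _) (Finset.prod_le_one (fun _ _ => norm_nonneg _)
      fun _ _ => ContinuousLinearMap.norm_fst_le _ _ _)
  have bg : ∀ (i : ℕ) (z : E × F), ‖iteratedFDeriv ℝ i (fun z : E × F => g z.2) z‖ ≤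
      ‖iteratedFDeriv ℝ i g z.2‖ := fun i z => by
    have := (ContinuousLinearMap.snd ℝ E F).iteratedFDeriv_comp_right (g.smooth ⊤) z
      (i := i) (by exact_mod_cast le_top)
    change ‖iteratedFDeriv ℝ i (g ∘ ContinuousLinearMap.snd ℝ E F) z‖ ≤ _
    rw [this]
    refine (ContinuousMultilinearMap.norm_compContinuousLinearMap_le _ _).trans ?_
    refine mul_le_of_le_one_right (norm_nonneg _) (Finset.prod_le_one (fun _ _ => norm_nonneg _)
      fun _ _ => ContinuousLinearMap.norm_snd_le _ _ _)
  refine ⟨⟨fun z => f z.1 * g z.2, hf1.mul hg1, fun k n => ?_⟩, fun _ => rfl⟩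
  set sf : ℕ → ℕ → ℝ := fun k i => SchwartzMap.seminorm ℝ k i f
  set sg : ℕ → ℕ → ℝ := fun k i => SchwartzMap.seminorm ℝ k i g
  refine ⟨∑ i ∈ Finset.range (n + 1), (n.choose i : ℝ) *
    (sf k i * sg 0 (n - i) + sf 0 i * sg k (n - i)), fun z => ?_⟩
  have h1 := norm_iteratedFDeriv_mul_le hf1 hg1 z (n := n) (by exact_mod_cast le_top)
  calc ‖z‖ ^ k * _ ≤ ‖z‖ ^ k * _ := by gcongr
    _ = _ := Finset.mul_sum _ _ _
    _ ≤ _ := Finset.sum_le_sum fun i _ => ?_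
  have a1 := SchwartzMap.le_seminorm ℝ k i f z.1
  have a2 := SchwartzMap.le_seminorm ℝ 0 i f z.1
  have a3 := SchwartzMap.le_seminorm ℝ k (n - i) g z.2
  have a4 := SchwartzMap.le_seminorm ℝ 0 (n - i) g z.2
  simp only [pow_zero, one_mul] at a2 a4
  have hz : ‖z‖ ^ k ≤ ‖z.1‖ ^ k + ‖z.2‖ ^ k := by
    rcases max_cases ‖z.1‖ ‖z.2‖ with h | h
    · rw [Prod.norm_def, h.1]; simp
    · rw [Prod.norm_def, h.1]; simp
  calc _ ≤ (‖z.1‖ ^ k + ‖z.2‖ ^ k) * ((n.choose i : ℝ) * ‖iteratedFDeriv ℝ i f z.1‖ *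
        ‖iteratedFDeriv ℝ (n - i) g z.2‖) := by
        gcongr
        · exact bf i z
        · exact bg (n - i) z
    _ = (n.choose i : ℝ) * ((‖z.1‖ ^ k * ‖iteratedFDeriv ℝ i f z.1‖) *
        ‖iteratedFDeriv ℝ (n - i) g z.2‖ + ‖iteratedFDeriv ℝ i f z.1‖ *
          (‖z.2‖ ^ k * ‖iteratedFDeriv ℝ (n - i) g z.2‖)) := by ring
    _ ≤ _ := by gcongr

/-- Products over the coordinates of Schwartz functions are Schwartz functions. -/
theorem IsSchwartz.pi_prod [FiniteDimensional ℝ E] {N : ℕ} {f : Fin N → E → ℂ}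
    (hf : ∀ i, IsSchwartz (f i)) : IsSchwartz fun x : Fin N → E => ∏ i, f i (x i) := by
  induction N with
  | zero =>
    refine ⟨⟨fun _ => 1, contDiff_const, fun k n => ⟨‖iteratedFDeriv ℝ n
      (fun _ : Fin 0 → E => (1 : ℂ)) 0‖, fun x => ?_⟩⟩, fun x => by simp; rfl⟩
    obtain rfl : x = 0 := Subsingleton.elim _ _
    rcases k with _ | k
    · simp
    · rw [norm_zero, zero_pow (by simp), zero_mul]
      exact norm_nonneg _
  | succ N ih =>
    have h := (hf 0).tensor (ih fun i => hf i.succ)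
    refine (h.comp_injective (F := Fin (N + 1) → E)
      ((LinearMap.proj 0).prod (LinearMap.funLeft ℝ E Fin.succ)) ?_).congr fun x => ?_
    · intro x y hxy
      funext i
      refine Fin.cases (congrArg Prod.fst hxy) (fun j => ?_) i
      exact congrFun (congrArg Prod.snd hxy) j
    · simp [Fin.prod_univ_succ, LinearMap.funLeft_apply]

end Schwartz

section PartialIntegral

variable {E F : Type} [NormedAddCommGroup E] [NormedSpace ℝ E]
  [NormedAddCommGroup F] [NormedSpace ℝ F] [MeasurableSpace F] (μ : Measure F)
  [μ.HasTemperateGrowth]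

/-- A Schwartz function of two variables, times a power of the first one, is dominated by an
integrable function of the second one. -/
theorem exists_integrable_bound {V : Type} [NormedAddCommGroup V] [NormedSpace ℝ V]
    (f : 𝓢(E × F, V)) (k : ℕ) :
    ∃ b : F → ℝ, Integrable b μ ∧ ∀ x u, ‖x‖ ^ k * ‖f (x, u)‖ ≤ b u := by
  set d := μ.integrablePower
  refine ⟨fun u => (2 ^ (k + d) *
    ((Finset.Iic (k + d, 0)).sup (fun m => SchwartzMap.seminorm ℝ m.1 m.2) f)) *
      (1 + ‖u‖) ^ (-(d : ℝ)), (Measure.integrable_pow_neg_integrablePower μ).const_mul _,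
    fun x u => ?_⟩
  have h := SchwartzMap.one_add_le_sup_seminorm_apply (𝕜 := ℝ) (m := (k + d, 0)) (k := k + d)
    (n := 0) le_rfl le_rfl f (x, u)
  simp only [norm_iteratedFDeriv_zero] at h
  have h1 : ‖x‖ ≤ 1 + ‖(x, u)‖ := (norm_fst_le (x, u)).trans (by simp)
  have h2 : 1 + ‖u‖ ≤ 1 + ‖(x, u)‖ := by gcongr; exact norm_snd_le (x, u)
  beta_reduce
  rw [Real.rpow_neg (by positivity), Real.rpow_natCast, ← div_eq_mul_inv,
    le_div_iff₀ (by positivity)]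
  refine le_trans ?_ h
  rw [pow_add]
  calc ‖x‖ ^ k * ‖f (x, u)‖ * (1 + ‖u‖) ^ d = ‖x‖ ^ k * (1 + ‖u‖) ^ d * ‖f (x, u)‖ := by ring
    _ ≤ _ := by gcongr

variable [BorelSpace F] [SecondCountableTopology F]

theorem integrable_slice {V : Type} [NormedAddCommGroup V] [NormedSpace ℝ V]
    (f : 𝓢(E × F, V)) (x : E) : Integrable (fun u => f (x, u)) μ := by
  obtain ⟨b, hb, h⟩ := exists_integrable_bound μ f 0
  refine hb.mono' ?_ (.of_forall fun u => by simpa using h x u)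
  exact (f.continuous.comp (Continuous.prodMk_right x)).aestronglyMeasurable

/-- The partial derivative of a Schwartz function in the first variable. -/
def partialDeriv {V : Type} [NormedAddCommGroup V] [NormedSpace ℝ V] (f : 𝓢(E × F, V)) :
    𝓢(E × F, E →L[ℝ] V) :=
  SchwartzMap.postcompCLM (𝕜 := ℝ)
    ((ContinuousLinearMap.compL ℝ E (E × F) V).flip (ContinuousLinearMap.inl ℝ E F))
    (SchwartzMap.fderivCLM ℝ (E × F) V f)

theorem hasFDerivAt_partialIntegral {V : Type} [NormedAddCommGroup V] [NormedSpace ℝ V]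
    (f : 𝓢(E × F, V)) (x : E) :
    HasFDerivAt (fun x => ∫ u, f (x, u) ∂μ) (∫ u, partialDeriv f (x, u) ∂μ) x := by
  obtain ⟨b, hb, h⟩ := exists_integrable_bound μ (partialDeriv f) 0
  refine hasFDerivAt_integral_of_dominated_of_fderiv_le (F' := fun x u => partialDeriv f (x, u))
    (bound := b) Filter.univ_mem (.of_forall fun y => (integrable_slice μ f y).1)
    (integrable_slice μ f x) (integrable_slice μ (partialDeriv f) x).1
    (.of_forall fun u y _ => by simpa using h y u) hb (.of_forall fun u y _ => ?_)
  have h1 := (f.differentiable (y, u)).hasFDerivAt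
  have h2 : HasFDerivAt (fun y : E => (y, u)) (ContinuousLinearMap.inl ℝ E F) y :=
    hasFDerivAt_prodMk_left y u
  exact h1.comp y h2

/-- Derivatives are taken under the integral; the codomain is generalized for the induction on the
order. -/
theorem contDiff_partialIntegral (n : ℕ) : ∀ {V : Type} [NormedAddCommGroup V] [NormedSpace ℝ V]
    (f : 𝓢(E × F, V)), ContDiff ℝ n fun x => ∫ u, f (x, u) ∂μ := by
  induction n with
  | zero =>
    intro V _ _ f
    exact contDiff_zero.2 (continuous_iff_continuousAt.2 fun x =>
      (hasFDerivAt_partialIntegral μ f x).continuousAt)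
  | succ n ih =>
    intro V _ _ f
    refine (contDiff_succ_iff_hasFDerivAt (n := n)).2 ?_
    exact ⟨_, ih (partialDeriv f), hasFDerivAt_partialIntegral μ f⟩

theorem decay_partialIntegral (k n : ℕ) : ∀ {V : Type} [NormedAddCommGroup V] [NormedSpace ℝ V]
    (f : 𝓢(E × F, V)), ∃ C : ℝ, ∀ x,
      ‖x‖ ^ k * ‖iteratedFDeriv ℝ n (fun x => ∫ u, f (x, u) ∂μ) x‖ ≤ C := by
  induction n with
  | zero =>
    intro V _ _ f
    obtain ⟨b, hb, h⟩ := exists_integrable_bound μ f k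
    refine ⟨∫ u, b u ∂μ, fun x => ?_⟩
    rw [norm_iteratedFDeriv_zero]
    calc _ ≤ ‖x‖ ^ k * ∫ u, ‖f (x, u)‖ ∂μ := by
          gcongr
          exact norm_integral_le_integral_norm _
      _ = ∫ u, ‖x‖ ^ k * ‖f (x, u)‖ ∂μ := (integral_const_mul _ _).symm
      _ ≤ _ := integral_mono ((integrable_slice μ f x).norm.const_mul _) hb (h x)
  | succ n ih =>
    intro V _ _ f
    obtain ⟨C, hC⟩ := ih (partialDeriv f)
    refine ⟨C, fun x => ?_⟩
    rw [← norm_iteratedFDeriv_fderiv]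
    have : fderiv ℝ (fun x => ∫ u, f (x, u) ∂μ) = fun x => ∫ u, partialDeriv f (x, u) ∂μ :=
      funext fun x => (hasFDerivAt_partialIntegral μ f x).fderiv
    rw [this]
    exact hC x

/-- Integrating out some of the variables of a Schwartz function gives a Schwartz function. -/
theorem IsSchwartz.partialIntegral {V : Type} [NormedAddCommGroup V] [NormedSpace ℝ V]
    {f : E × F → V} (hf : IsSchwartz f) : IsSchwartz fun x => ∫ u, f (x, u) ∂μ := by
  obtain ⟨f', hf⟩ := hf
  obtain rfl : f = f' := funext fun x => (hf x).symm
  exact ⟨⟨fun x => ∫ u, f' (x, u) ∂μ,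
    contDiff_infty.2 fun n => contDiff_partialIntegral μ n f',
    fun k n => decay_partialIntegral μ k n f'⟩, fun _ => rfl⟩

end PartialIntegral

section Gaussian

variable {H : Type} [NormedAddCommGroup H] [InnerProductSpace ℝ H]

theorem hasFDerivAt_gaussian (x : H) :
    HasFDerivAt (fun x : H => Real.exp (-(1 / 2) * ‖x‖ ^ 2))
      (Real.exp (-(1 / 2) * ‖x‖ ^ 2) • -(innerSL ℝ x)) x := by
  have h := ((hasStrictFDerivAt_norm_sq x).hasFDerivAt.const_mul (-(1 / 2 : ℝ))).exp
  convert h using 1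
  ext v
  simp

theorem contDiff_gaussian : ContDiff ℝ (⊤ : ℕ∞) fun x : H => Real.exp (-(1 / 2) * ‖x‖ ^ 2) :=
  (contDiff_const.mul (contDiff_norm_sq ℝ)).exp

theorem hasTemperateGrowth_fderiv {V : Type*} [NormedAddCommGroup V] [NormedSpace ℝ V]
    {P : H → V} (hP : P.HasTemperateGrowth) : (fderiv ℝ P).HasTemperateGrowth :=
  ⟨hP.1.fderiv_right (by simp), fun n => by
    simpa only [norm_iteratedFDeriv_fderiv] using hP.2 (n + 1)⟩

/-- A Gaussian times a function `P` of temperate growth decays rapidly with all its derivatives. The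
vector valued `P` makes this class of functions stable under differentiation. -/
theorem decay_gaussian (k n : ℕ) : ∀ {V : Type} [NormedAddCommGroup V] [NormedSpace ℝ V]
    {P : H → V}, P.HasTemperateGrowth → ∃ C : ℝ, ∀ x,
      ‖x‖ ^ k * ‖iteratedFDeriv ℝ n (fun x => Real.exp (-(1 / 2) * ‖x‖ ^ 2) • P x) x‖ ≤ C := by
  induction n with
  | zero =>
    intro V _ _ P hP
    obtain ⟨l, C, hC0, hC⟩ := hP.norm_iteratedFDeriv_le_uniform 0
    -- `s ^ j exp (-s² / 2)` is bounded because `exp (-s² / 2) ≤ e · exp (-s)`.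
    have key : ∀ s : ℝ, 0 ≤ s → (1 + s) ^ (k + l) * Real.exp (-(1 / 2) * s ^ 2) ≤
        (k + l).factorial * Real.exp 2 := fun s hs => by
      have h1 := Real.pow_div_factorial_le_exp (1 + s) (by positivity) (k + l)
      rw [div_le_iff₀ (by positivity)] at h1
      calc _ ≤ Real.exp (1 + s) * (k + l).factorial * Real.exp (-(1 / 2) * s ^ 2) := by gcongr
        _ = (k + l).factorial * (Real.exp ((1 + s) + -(1 / 2) * s ^ 2)) := by
          rw [Real.exp_add (1 + s) (-(1 / 2) * s ^ 2)]
          generalize Real.exp (1 + s) = a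
          ring
        _ ≤ _ := by
          gcongr
          nlinarith [sq_nonneg (s - 1)]
    refine ⟨C * ((k + l).factorial * Real.exp 2), fun x => ?_⟩
    have hx := hC 0 le_rfl x
    rw [norm_iteratedFDeriv_zero] at hx ⊢
    rw [norm_smul, Real.norm_of_nonneg (Real.exp_pos _).le]
    calc _ ≤ (1 + ‖x‖) ^ k * (Real.exp (-(1 / 2) * ‖x‖ ^ 2) * (C * (1 + ‖x‖) ^ l)) := by
          gcongr
          linarith [norm_nonneg x]
      _ = C * ((1 + ‖x‖) ^ (k + l) * Real.exp (-(1 / 2) * ‖x‖ ^ 2)) := by rw [pow_add]; ring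
      _ ≤ _ := mul_le_mul_of_nonneg_left (key _ (norm_nonneg x)) hC0
  | succ n ih =>
    intro V _ _ P hP
    have hQ : Function.HasTemperateGrowth fun x =>
        fderiv ℝ P x - (ContinuousLinearMap.smulRightL ℝ H V (innerSL ℝ x)) (P x) := by
      refine Function.HasTemperateGrowth.sub (hasTemperateGrowth_fderiv hP) ?_
      exact (ContinuousLinearMap.smulRightL ℝ H V).bilinear_hasTemperateGrowth
        (innerSL ℝ (E := H)).hasTemperateGrowth hP
    obtain ⟨C, hC⟩ := ih hQ
    refine ⟨C, fun x => ?_⟩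
    rw [← norm_iteratedFDeriv_fderiv]
    have : fderiv ℝ (fun x => Real.exp (-(1 / 2) * ‖x‖ ^ 2) • P x) = fun x =>
        Real.exp (-(1 / 2) * ‖x‖ ^ 2) •
          (fderiv ℝ P x - (ContinuousLinearMap.smulRightL ℝ H V (innerSL ℝ x)) (P x)) := by
      funext x
      have hd := (hasFDerivAt_gaussian x).smul
        ((hP.1.differentiable (by simp)) x).hasFDerivAt
      refine (HasFDerivAt.fderiv hd).trans ?_
      ext v
      simp [smul_smul, sub_eq_add_neg]
    rw [this]
    exact hC x

theorem isSchwartz_gaussian {H : Type} [NormedAddCommGroup H] [InnerProductSpace ℝ H] :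
    IsSchwartz fun x : H => (Real.exp (-(1 / 2) * ‖x‖ ^ 2) : ℂ) := by
  refine ⟨⟨fun x => (Real.exp (-(1 / 2) * ‖x‖ ^ 2) : ℂ),
    Complex.ofRealCLM.contDiff.comp contDiff_gaussian, fun k n => ?_⟩, fun _ => rfl⟩
  obtain ⟨C, hC⟩ := decay_gaussian (H := H) k n (P := fun _ => (1 : ℂ)) (.const 1)
  exact ⟨C, fun x => by simpa using hC x⟩

end Gaussian

/-! ### The Schwartz domain inside Fock space -/

theorem toFock_apply (Φ : SchwartzFock) (l : ℕ) : toFock Φ l = symToL2 l (Φ l) := by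
  classical
  induction Φ using DFinsupp.induction with
  | h0 => simp
  | ha i b f _ _ ih =>
    rw [map_add, lp.coeFn_add, Pi.add_apply, ih, DFinsupp.add_apply, map_add]
    congr 1
    have h : toFock (DFinsupp.single i b) = lp.lsingle (𝕜 := ℂ) (E := fun l : ℕ => symL2 l) 2 i
        (symToL2 i b) := by
      simp [toFock]
    rw [h]
    by_cases hil : i = l
    · subst hil
      simp
    · simp [DFinsupp.single_eq_of_ne (Ne.symm hil), Ne.symm hil]

theorem inner_symToL2 {l : ℕ} (f g : symSchwartz l) :
    ⟪symToL2 l f, symToL2 l g⟫_ℂ =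
      ∫ k, conj ((f : 𝓢(Fin l → Mom, ℂ)) k) * (g : 𝓢(Fin l → Mom, ℂ)) k := by
  rw [Submodule.coe_inner, L2.inner_def]
  refine integral_congr_ae ?_
  filter_upwards [(f : 𝓢(Fin l → Mom, ℂ)).coeFn_toLp 2 volume,
    (g : 𝓢(Fin l → Mom, ℂ)).coeFn_toLp 2 volume] with k h1 h2
  have e1 : ((symToL2 l f : Lp ℂ 2 (volume : Measure (Fin l → Mom))) : (Fin l → Mom) → ℂ) k =
    (f : 𝓢(Fin l → Mom, ℂ)) k := h1
  have e2 : ((symToL2 l g : Lp ℂ 2 (volume : Measure (Fin l → Mom))) : (Fin l → Mom) → ℂ) k =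
    (g : 𝓢(Fin l → Mom, ℂ)) k := h2
  rw [e1, e2, RCLike.inner_apply, mul_comm]

/-- On `D_S`, the scalar product of Fock space is computed with the pointwise wave functions. -/
theorem inner_toFock (Φ Ψ : SchwartzFock) :
    ⟪toFock Φ, toFock Ψ⟫_ℂ = waveInner (wave Φ) (wave Ψ) := by
  rw [lp.inner_eq_tsum]
  refine tsum_congr fun l => ?_
  rw [toFock_apply, toFock_apply, inner_symToL2]
  rfl

theorem symToL2_injective (l : ℕ) : Function.Injective (symToL2 l) := by
  intro f g h
  have h1 : (f : 𝓢(Fin l → Mom, ℂ)).toLp 2 volume = (g : 𝓢(Fin l → Mom, ℂ)).toLp 2 volume :=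
    congrArg Subtype.val h
  exact Subtype.ext (SchwartzMap.injective_toLp 2 volume h1)

theorem toFock_injective : Function.Injective toFock := by
  intro Φ Ψ h
  refine DFinsupp.ext fun l => symToL2_injective l ?_
  rw [← toFock_apply, ← toFock_apply, h]

/-- A vector of `D_S` is determined by its scalar products with `D_S`; operators on `D_S` are
therefore determined by their quadratic forms. -/
theorem ext_inner_toFock {Φ Ψ : SchwartzFock}
    (h : ∀ X : SchwartzFock, ⟪toFock X, toFock Φ⟫_ℂ = ⟪toFock X, toFock Ψ⟫_ℂ) : Φ = Ψ := by
  refine toFock_injective (sub_eq_zero.1 ?_)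
  rw [← inner_self_eq_zero (𝕜 := ℂ), inner_sub_right, ← map_sub, h, sub_self]

theorem isClosed_symL2 (l : ℕ) :
    IsClosed (symL2 l : Set (Lp ℂ 2 (volume : Measure (Fin l → Mom)))) := by
  simp only [symL2, Submodule.coe_iInf]
  refine isClosed_iInter fun σ => ?_
  exact isClosed_eq (Lp.compMeasurePreservingₗᵢ ℂ _ (measurePreserving_perm l σ)).continuous
    continuous_id

instance (l : ℕ) : CompleteSpace (symL2 l) := (isClosed_symL2 l).completeSpace_coe

/-- Permuting the arguments of a Schwartz function. -/
def permSchwartz {l : ℕ} (σ : Equiv.Perm (Fin l)) (f : 𝓢(Fin l → Mom, ℂ)) :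
    𝓢(Fin l → Mom, ℂ) :=
  ((isSchwartz_coe f).comp_injective (LinearMap.funLeft ℝ Mom σ)
    (LinearMap.funLeft_injective_of_surjective ℝ Mom σ σ.surjective)).choose

theorem permSchwartz_apply {l : ℕ} (σ : Equiv.Perm (Fin l)) (f : 𝓢(Fin l → Mom, ℂ))
    (k : Fin l → Mom) : permSchwartz σ f k = f (k ∘ σ) :=
  ((isSchwartz_coe f).comp_injective (LinearMap.funLeft ℝ Mom σ)
    (LinearMap.funLeft_injective_of_surjective ℝ Mom σ σ.surjective)).choose_spec k

/-- The sum of a Schwartz function over all permutations of its arguments. -/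
def symmetrize {l : ℕ} (f : 𝓢(Fin l → Mom, ℂ)) : symSchwartz l :=
  ⟨∑ σ : Equiv.Perm (Fin l), permSchwartz σ f, fun τ k => by
    simp only [sum_apply, permSchwartz_apply]
    exact Fintype.sum_equiv (Equiv.mulLeft τ) _ _ fun σ => rfl⟩

theorem toLp_permSchwartz {l : ℕ} (σ : Equiv.Perm (Fin l)) (f : 𝓢(Fin l → Mom, ℂ)) :
    (permSchwartz σ f).toLp 2 volume =
      Lp.compMeasurePreservingₗᵢ ℂ _ (measurePreserving_perm l σ) (f.toLp 2 volume) := by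
  apply Lp.ext
  refine (SchwartzMap.coeFn_toLp _ _ _).trans ?_
  refine Filter.EventuallyEq.symm
    ((Lp.coeFn_compMeasurePreserving _ (measurePreserving_perm l σ)).trans ?_)
  refine ((measurePreserving_perm l σ).quasiMeasurePreserving.ae_eq_comp
    (f.coeFn_toLp 2 volume)).trans ?_
  filter_upwards with k
  exact (permSchwartz_apply σ f k).symm

/-- A symmetric function is orthogonal to all Schwartz functions once it is orthogonal to the
symmetric ones. -/
theorem eq_zero_of_inner_symToL2 {l : ℕ} (y : symL2 l)
    (h : ∀ f : symSchwartz l, ⟪symToL2 l f, y⟫_ℂ = 0) : y = 0 := by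
  have key : ∀ f : 𝓢(Fin l → Mom, ℂ),
      ⟪f.toLp 2 volume, (y : Lp ℂ 2 (volume : Measure (Fin l → Mom)))⟫_ℂ = 0 := fun f => by
    have h1 := h (symmetrize f)
    rw [Submodule.coe_inner] at h1
    have h2 : ((symToL2 l (symmetrize f) : symL2 l) :
        Lp ℂ 2 (volume : Measure (Fin l → Mom))) =
        ∑ σ : Equiv.Perm (Fin l), (permSchwartz σ f).toLp 2 volume :=
      map_sum (SchwartzMap.toLpCLM ℂ ℂ 2 (volume : Measure (Fin l → Mom)))
        (fun σ => permSchwartz σ f) Finset.univ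
    rw [h2, sum_inner] at h1
    have h3 : ∀ σ : Equiv.Perm (Fin l), ⟪(permSchwartz σ f).toLp 2 volume,
        (y : Lp ℂ 2 (volume : Measure (Fin l → Mom)))⟫_ℂ =
        ⟪f.toLp 2 volume, (y : Lp ℂ 2 (volume : Measure (Fin l → Mom)))⟫_ℂ := fun σ => by
      have hy := y.2
      simp only [symL2, Submodule.mem_iInf, LinearMap.mem_eqLocus] at hy
      have hy' : Lp.compMeasurePreservingₗᵢ ℂ _ (measurePreserving_perm l σ)
        (y : Lp ℂ 2 (volume : Measure (Fin l → Mom))) = y := hy σ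
      rw [toLp_permSchwartz]
      conv_lhs => rw [← hy']
      exact LinearIsometry.inner_map_map _ _ _
    simp only [h3, Finset.sum_const, Finset.card_univ, nsmul_eq_mul] at h1
    exact (mul_eq_zero.1 h1).resolve_left (by exact_mod_cast Fintype.card_ne_zero)
  have hd := SchwartzMap.denseRange_toLpCLM (E := Fin l → Mom) (F := ℂ) (p := 2)
    (μ := volume) (by simp)
  refine Subtype.ext (hd.eq_zero_of_inner_left ℂ ?_)
  exact fun f => inner_eq_zero_symm.1 (key f)

/-- The finite particle Schwartz vectors are dense in Fock space. -/
theorem dense_DS : Dense (DS : Set Fock) := by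
  rw [Submodule.dense_iff_topologicalClosure_eq_top, Submodule.topologicalClosure_eq_top_iff,
    Submodule.eq_bot_iff]
  intro y hy
  refine lp.ext (funext fun l => ?_)
  refine eq_zero_of_inner_symToL2 (y l) fun f => ?_
  have h := hy (toFock (DFinsupp.single l f)) ⟨_, rfl⟩
  rw [lp.inner_eq_tsum, tsum_eq_single l] at h
  · rwa [toFock_apply, DFinsupp.single_eq_same] at h
  · intro i hi
    rw [toFock_apply, DFinsupp.single_eq_of_ne hi, map_zero, inner_zero_left]

/-- An operator on the finite particle Schwartz vectors as a partially defined operator in Fock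
space, with domain `D_S`. -/
def toPMap (A : Module.End ℂ SchwartzFock) : Fock →ₗ.[ℂ] Fock where
  domain := DS
  toFun := toFock ∘ₗ A ∘ₗ (LinearEquiv.ofInjective toFock toFock_injective).symm.toLinearMap

theorem toPMap_apply (A : Module.End ℂ SchwartzFock) (ψ : SchwartzFock) (h : toFock ψ ∈ DS) :
    toPMap A ⟨toFock ψ, h⟩ = toFock (A ψ) := by
  have : (LinearEquiv.ofInjective toFock toFock_injective).symm ⟨toFock ψ, h⟩ = ψ := by
    rw [LinearEquiv.symm_apply_eq]
    rfl
  change toFock (A ((LinearEquiv.ofInjective toFock toFock_injective).symm ⟨toFock ψ, h⟩)) = _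
  rw [this]

/-- `B` is an adjoint of `A` on the finite particle Schwartz vectors. -/
def IsAdjointOn (A B : Module.End ℂ SchwartzFock) : Prop :=
  ∀ Φ Ψ : SchwartzFock, ⟪toFock (B Φ), toFock Ψ⟫_ℂ = ⟪toFock Φ, toFock (A Ψ)⟫_ℂ

/-- An operator having an adjoint on the dense subspace `D_S` is closable, since the Hilbert space
adjoint of the latter is a closed extension of it. -/
theorem IsAdjointOn.closable {A B : Module.End ℂ SchwartzFock} (h : IsAdjointOn A B) :
    ClosableWithCoreDS A := by
  have hf : (toPMap B).IsFormalAdjoint (toPMap A) := by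
    rintro ⟨_, ψ, rfl⟩ ⟨_, φ, rfl⟩
    exact (congrArg (inner ℂ · (toFock φ)) (toPMap_apply B ψ ⟨ψ, rfl⟩)).trans
      ((h ψ φ).trans (congrArg (inner ℂ (toFock ψ)) (toPMap_apply A φ ⟨φ, rfl⟩)).symm)
  have hB : Dense ((toPMap B).domain : Set Fock) := dense_DS
  have hc : (toPMap A).IsClosable :=
    ((toPMap B).adjoint_isClosed hB).isClosable.leIsClosable (hf.le_adjoint hB)
  refine ⟨(toPMap A).closure, hc.closure_isClosed, (toPMap A).closureHasCore, fun ψ => ?_⟩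
  have hle := LinearPMap.le_graph_of_le (toPMap A).le_closure
  refine hle ?_
  rw [← toPMap_apply A ψ ⟨ψ, rfl⟩]
  exact (toPMap A).mem_graph ⟨toFock ψ, ⟨ψ, rfl⟩⟩

/-! ### Wave functions: smeared creation and the canonical commutation relation -/

/-- The smeared creation operator `∫ dp a†(p) F(p)` on pointwise wave functions. -/
def cre (F : Mom → Wave) : Wave
  | 0 => fun _ => 0
  | l + 1 => fun k => (Real.sqrt (l + 1) : ℂ)⁻¹ * ∑ i, F (k i) l (Fin.removeNth i k)

/-- The pointwise integral of a family of wave functions. -/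
def waveInt {α : Type*} [MeasureSpace α] (F : α → Wave) : Wave := fun l k => ∫ u, F u l k

/-- Symmetry of a wave function in the particle arguments. -/
def WaveSymm (φ : Wave) : Prop :=
  ∀ (l : ℕ) (σ : Equiv.Perm (Fin l)) (k : Fin l → Mom), φ l (k ∘ σ) = φ l k

theorem sqrt_succ_ne_zero (l : ℕ) : (Real.sqrt ((l : ℝ) + 1) : ℂ) ≠ 0 := by
  exact_mod_cast (Real.sqrt_pos.2 (by positivity : (0 : ℝ) < (l : ℝ) + 1)).ne'

/-- The canonical commutation relation `a(k) a†(p) = a†(p) a(k) + δ(k - p)`, smeared in `p`. As an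
identity between pointwise wave functions it holds without any regularity assumption. -/
theorem destroy_cre (k : Mom) (F : Mom → Wave) :
    destroy k (cre F) = cre (fun p => destroy k (F p)) + F k := by
  funext l q
  cases l with
  | zero =>
    simp only [destroy, cre, Pi.add_apply, Fin.sum_univ_succ, Finset.univ_eq_empty,
      Finset.sum_empty, Fin.cons_zero, add_zero, zero_add]
    rw [mul_inv_cancel_left₀ (sqrt_succ_ne_zero 0)]
    congr 1
  | succ l =>
    simp only [destroy, cre, Pi.add_apply]
    rw [mul_inv_cancel_left₀ (sqrt_succ_ne_zero (l + 1)), Fin.sum_univ_succ, ← Finset.mul_sum,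
      inv_mul_cancel_left₀ (sqrt_succ_ne_zero l), add_comm]
    congr 1
    refine Finset.sum_congr rfl fun i _ => ?_
    congr 1
    funext j
    refine Fin.cases ?_ (fun j => ?_) j <;> simp [Fin.removeNth]

theorem cre_add (F G : Mom → Wave) : cre (fun p => F p + G p) = cre F + cre G := by
  funext l k
  cases l with
  | zero => simp [cre]
  | succ l => simp [cre, Finset.sum_add_distrib, mul_add]

theorem cre_zero : cre (fun _ => 0) = 0 := by
  funext l k
  cases l with
  | zero => simp [cre]
  | succ l => simp [cre]

theorem cre_smul (c : ℂ) (F : Mom → Wave) : cre (fun p => c • F p) = c • cre F := by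
  funext l k
  cases l with
  | zero => simp [cre]
  | succ l => simp [cre, ← Finset.mul_sum, mul_left_comm]

theorem destroy_add (k : Mom) (φ ψ : Wave) : destroy k (φ + ψ) = destroy k φ + destroy k ψ := by
  funext l q
  simp [destroy, mul_add]

theorem destroy_smul (k : Mom) (c : ℂ) (φ : Wave) : destroy k (c • φ) = c • destroy k φ := by
  funext l q
  simp [destroy, mul_left_comm]

theorem destroy_waveInt {α : Type*} [MeasureSpace α] (k : Mom) (F : α → Wave) :
    destroy k (waveInt F) = waveInt fun u => destroy k (F u) := by
  funext l q
  simp only [destroy, waveInt, integral_const_mul]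

theorem cre_waveInt {α : Type*} [MeasureSpace α] (F : Mom → α → Wave)
    (h : ∀ p l k, Integrable fun u => F p u l k) :
    cre (fun p => waveInt (F p)) = waveInt fun u => cre fun p => F p u := by
  funext l k
  cases l with
  | zero => simp [cre, waveInt]
  | succ l =>
    simp only [cre, waveInt]
    rw [integral_const_mul, integral_finsetSum _ fun i _ => h _ _ _]

theorem waveInt_smul {α : Type*} [MeasureSpace α] (c : ℂ) (F : α → Wave) :
    (waveInt fun u => c • F u) = c • waveInt F := by
  funext l k
  simp [waveInt, integral_const_mul]

theorem WaveSymm.destroy {φ : Wave} (h : WaveSymm φ) (k : Mom) : WaveSymm (destroy k φ) := by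
  intro l σ q
  simp only [QSTDyson.destroy]
  congr 1
  rw [← h (l + 1) (Equiv.Perm.decomposeFin.symm (0, σ)) (Fin.cons k q)]
  congr 1
  funext i
  refine Fin.cases ?_ (fun j => ?_) i <;> simp

theorem WaveSymm.waveInt {α : Type*} [MeasureSpace α] {F : α → Wave} (h : ∀ u, WaveSymm (F u)) :
    WaveSymm (waveInt F) := fun l σ q => by
  simp only [QSTDyson.waveInt]
  exact integral_congr_ae (.of_forall fun u => h u l σ q)

theorem WaveSymm.smul {φ : Wave} (h : WaveSymm φ) (c : ℂ) : WaveSymm (c • φ) :=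
  fun l σ q => by simp [h l σ q]

/-- Deleting one argument before and after a permutation of the arguments: the deleted families
differ by a permutation. -/
theorem exists_perm_removeNth {l : ℕ} (σ : Equiv.Perm (Fin (l + 1))) (i : Fin (l + 1)) :
    ∃ τ : Equiv.Perm (Fin l), ∀ k : Fin (l + 1) → Mom,
      Fin.removeNth i (k ∘ σ) = Fin.removeNth (σ i) k ∘ τ := by
  have h1 : ∀ j, σ j ≠ σ i ↔ j ≠ i := fun j => by simp
  let e : {j // j ≠ i} ≃ {j // j ≠ σ i} := σ.subtypeEquiv fun j => (h1 j).symm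
  refine ⟨((finSuccAboveEquiv i).trans e).trans (finSuccAboveEquiv (σ i)).symm,
    fun k => ?_⟩
  funext j
  simp only [Fin.removeNth, Function.comp_apply]
  congr 1
  have h2 := (finSuccAboveEquiv (σ i)).apply_symm_apply
    (e ((finSuccAboveEquiv i) j))
  exact (congrArg Subtype.val h2).symm

theorem WaveSymm.cre {F : Mom → Wave} (h : ∀ p, WaveSymm (F p)) : WaveSymm (cre F) := by
  intro l σ q
  cases l with
  | zero => rfl
  | succ l =>
    simp only [QSTDyson.cre]
    congr 1
    refine Fintype.sum_equiv σ _ _ fun i => ?_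
    obtain ⟨τ, hτ⟩ := exists_perm_removeNth σ i
    rw [hτ, h _ l τ]
    rfl

/-- Destruction operators commute on symmetric wave functions. -/
theorem WaveSymm.destroy_comm {φ : Wave} (h : WaveSymm φ) (k k' : Mom) :
    QSTDyson.destroy k (QSTDyson.destroy k' φ) = QSTDyson.destroy k' (QSTDyson.destroy k φ) := by
  funext l q
  simp only [QSTDyson.destroy]
  congr 2
  rw [← h (l + 1 + 1) (Equiv.swap 0 1)]
  congr 1
  funext i
  refine Fin.cases ?_ (fun j => Fin.cases ?_ (fun j => ?_) j) i
  · rw [Function.comp_apply, Equiv.swap_apply_left]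
    rfl
  · rw [Function.comp_apply, ← show (1 : Fin (l + 1 + 1)) = Fin.succ 0 from rfl,
      Equiv.swap_apply_right]
    rfl
  · have : Equiv.swap (0 : Fin (l + 1 + 1)) 1 j.succ.succ = j.succ.succ :=
      Equiv.swap_apply_of_ne_of_ne (Fin.succ_ne_zero _) (by
        rw [show (1 : Fin (l + 1 + 1)) = Fin.succ 0 from rfl]
        exact fun h => Fin.succ_ne_zero _ (Fin.succ_injective _ h))
    rw [Function.comp_apply, this]
    rfl

theorem WaveSymm.foldr {φ : Wave} (h : WaveSymm φ) (q : List Mom) :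
    WaveSymm (q.foldr QSTDyson.destroy φ) := by
  induction q with
  | nil => exact h
  | cons k q ih => exact ih.destroy k

theorem WaveSymm.foldl_eq_foldr (q : List Mom) : ∀ {φ : Wave}, WaveSymm φ →
    q.foldl (fun φ k => QSTDyson.destroy k φ) φ = q.foldr QSTDyson.destroy φ := by
  have comm : ∀ (q : List Mom) (k : Mom) {φ : Wave}, WaveSymm φ →
      q.foldr QSTDyson.destroy (QSTDyson.destroy k φ) =
        QSTDyson.destroy k (q.foldr QSTDyson.destroy φ) := by
    intro q k φ h
    induction q with
    | nil => rfl
    | cons k' q ih =>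
      simp only [List.foldr_cons, ih]
      exact (h.foldr q).destroy_comm k' k
  induction q with
  | nil => intro φ _; rfl
  | cons k q ih =>
    intro φ h
    rw [List.foldl_cons, ih (h.destroy k), comm q k h, List.foldr_cons]

theorem waveSymm_wave (Φ : SchwartzFock) : WaveSymm (wave Φ) := fun l σ k => (Φ l).2 σ k

theorem wave_injective : Function.Injective wave := by
  intro Φ Ψ h
  refine DFinsupp.ext fun l => Subtype.ext (SchwartzMap.ext fun k => ?_)
  exact congrFun (congrFun h l) k

theorem wave_add (Φ Ψ : SchwartzFock) : wave (Φ + Ψ) = wave Φ + wave Ψ := rfl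

theorem wave_smul (c : ℂ) (Φ : SchwartzFock) : wave (c • Φ) = c • wave Φ := rfl

theorem exists_bound_wave (Φ : SchwartzFock) : ∃ L, ∀ l, L ≤ l → wave Φ l = 0 := by
  classical
  refine ⟨Φ.support.sup id + 1, fun l hl => ?_⟩
  have : Φ l = 0 := by
    by_contra h
    have := Finset.le_sup (f := id) (DFinsupp.mem_support_iff.2 h)
    simp only [id] at this
    omega
  funext k
  simp [wave, this]

/-- A symmetric sequence of Schwartz functions, only finitely many of them nonzero, is a vector of
`D_S`. -/
theorem exists_wave_eq {φ : Wave} (hb : ∃ L, ∀ l, L ≤ l → φ l = 0) (hs : ∀ l, IsSchwartz (φ l))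
    (hsym : WaveSymm φ) : ∃ Φ : SchwartzFock, wave Φ = φ := by
  classical
  obtain ⟨L, hL⟩ := hb
  choose f hf using hs
  refine ⟨DFinsupp.mk (Finset.range L) fun l => ⟨f l, fun σ k => by rw [hf, hf, hsym]⟩, ?_⟩
  funext l k
  simp only [wave, DFinsupp.mk_apply]
  split_ifs with h
  · exact hf _ _
  · rw [hL l (by simpa using h)]
    rfl

/-- Iterated smeared creation `∫ dp_1 ⋯ dp_r a†(p_1) ⋯ a†(p_r) F(p_1, …, p_r)`. -/
def iterCre : ∀ r : ℕ, ((Fin r → Mom) → Wave) → Wave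
  | 0, F => F Fin.elim0
  | r + 1, F => cre fun p => iterCre r fun z => F (Fin.cons p z)

theorem iterCre_add (r : ℕ) : ∀ F G : (Fin r → Mom) → Wave,
    iterCre r (fun p => F p + G p) = iterCre r F + iterCre r G := by
  induction r with
  | zero => intro F G; rfl
  | succ r ih => intro F G; simp only [iterCre, ih, cre_add]

theorem iterCre_smul (r : ℕ) (c : ℂ) : ∀ F : (Fin r → Mom) → Wave,
    iterCre r (fun p => c • F p) = c • iterCre r F := by
  induction r with
  | zero => intro F; rfl
  | succ r ih => intro F; simp only [iterCre, ih, cre_smul]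

theorem WaveSymm.iterCre (r : ℕ) : ∀ {F : (Fin r → Mom) → Wave}, (∀ p, WaveSymm (F p)) →
    WaveSymm (iterCre r F) := by
  induction r with
  | zero => intro F h; exact h _
  | succ r ih => intro F h; exact WaveSymm.cre fun p => ih fun z => h _

/-! ### Schwartz families of wave functions -/

/-- A family of wave functions, jointly Schwartz in the parameter and the particle momenta. -/
structure SchwartzFamily {E : Type} [NormedAddCommGroup E] [NormedSpace ℝ E]
    (F : E → Wave) : Prop where
  bounded : ∃ L, ∀ l, L ≤ l → ∀ e, F e l = 0
  schwartz : ∀ l, IsSchwartz fun z : E × (Fin l → Mom) => F z.1 l z.2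

section SchwartzFamily

variable {E E' : Type} [NormedAddCommGroup E] [NormedSpace ℝ E]
  [NormedAddCommGroup E'] [NormedSpace ℝ E']

theorem SchwartzFamily.comp [FiniteDimensional ℝ E'] {F : E → Wave} (hF : SchwartzFamily F)
    (L : E' →ₗ[ℝ] E) (hL : Function.Injective L) : SchwartzFamily fun e => F (L e) where
  bounded := hF.bounded.imp fun _ h l hl _ => h l hl _
  schwartz l := (hF.schwartz l).comp_injective (L.prodMap LinearMap.id)
    (Function.Injective.prodMap hL Function.injective_id)

theorem SchwartzFamily.destroy [FiniteDimensional ℝ E] {F : E → Wave} (hF : SchwartzFamily F) :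
    SchwartzFamily fun e : E × Mom => destroy e.2 (F e.1) where
  bounded := hF.bounded.imp fun L h l hl _ => by
    funext q
    simp [QSTDyson.destroy, h (l + 1) (by omega)]
  schwartz l := by
    let L : ((E × Mom) × (Fin l → Mom)) →ₗ[ℝ] E × (Fin (l + 1) → Mom) :=
      { toFun := fun z => (z.1.1, Fin.cons z.1.2 z.2)
        map_add' := fun x y => by
          ext1
          · rfl
          · funext i
            refine Fin.cases rfl (fun j => rfl) i
        map_smul' := fun c x => by
          ext1
          · rfl
          · funext i
            refine Fin.cases rfl (fun j => rfl) i }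
    refine ((hF.schwartz (l + 1)).comp_injective L ?_).const_mul _
    rintro ⟨⟨e, p⟩, k⟩ ⟨⟨e', p'⟩, k'⟩ h
    have h1 : e = e' := congrArg Prod.fst h
    have h2 : (Fin.cons p k : Fin (l + 1) → Mom) = Fin.cons p' k' := congrArg Prod.snd h
    have h3 := Fin.cons_inj.1 h2
    rw [h1, h3.1, h3.2]

theorem SchwartzFamily.cre [FiniteDimensional ℝ E] {F : E × Mom → Wave} (hF : SchwartzFamily F) :
    SchwartzFamily fun e : E => cre fun p => F (e, p) where
  bounded := hF.bounded.imp' (· + 1) fun L h l hl e => by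
    funext q
    obtain ⟨l, rfl⟩ : ∃ l', l = l' + 1 := ⟨l - 1, by omega⟩
    simp [QSTDyson.cre, h l (by omega)]
  schwartz l := by
    cases l with
    | zero => exact isSchwartz_zero
    | succ l =>
      refine IsSchwartz.const_mul (IsSchwartz.sum fun i _ => ?_) _
      refine (hF.schwartz l).comp_injective (F := E × (Fin (l + 1) → Mom))
        ((LinearMap.prodMap LinearMap.id (LinearMap.proj i)).prod
          (LinearMap.funLeft ℝ Mom i.succAbove ∘ₗ LinearMap.snd ℝ E _)) ?_
      rintro ⟨e, k⟩ ⟨e', k'⟩ h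
      have h1 : e = e' := congrArg (fun z => z.1.1) h
      have h2 : k i = k' i := congrArg (fun z => z.1.2) h
      have h3 : ∀ j, k (i.succAbove j) = k' (i.succAbove j) :=
        fun j => congrFun (congrArg Prod.snd h) j
      rw [h1]
      congr 1
      funext j
      rcases Fin.eq_self_or_eq_succAbove i j with rfl | ⟨j, rfl⟩
      · exact h2
      · exact h3 j

theorem SchwartzFamily.iterCre (r : ℕ) : ∀ {E : Type} [NormedAddCommGroup E] [NormedSpace ℝ E]
    [FiniteDimensional ℝ E] {F : E × (Fin r → Mom) → Wave}, SchwartzFamily F →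
    SchwartzFamily fun e : E => iterCre r fun p => F (e, p) := by
  induction r with
  | zero =>
    intro E _ _ _ F hF
    refine hF.comp (LinearMap.inl ℝ E (Fin 0 → Mom)) LinearMap.inl_injective |> fun h => ?_
    have e : (Fin.elim0 : Fin 0 → Mom) = 0 := Subsingleton.elim _ _
    simp only [QSTDyson.iterCre, e]
    exact h
  | succ r ih =>
    intro E _ _ _ F hF
    let L : ((E × Mom) × (Fin r → Mom)) →ₗ[ℝ] E × (Fin (r + 1) → Mom) :=
      { toFun := fun z => (z.1.1, Fin.cons z.1.2 z.2)
        map_add' := fun x y => by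
          ext1
          · rfl
          · funext i
            refine Fin.cases rfl (fun j => rfl) i
        map_smul' := fun c x => by
          ext1
          · rfl
          · funext i
            refine Fin.cases rfl (fun j => rfl) i }
    refine (ih (hF.comp L ?_)).cre
    rintro ⟨⟨e, p⟩, k⟩ ⟨⟨e', p'⟩, k'⟩ h
    have h1 : e = e' := congrArg Prod.fst h
    have h2 : (Fin.cons p k : Fin (r + 1) → Mom) = Fin.cons p' k' := congrArg Prod.snd h
    have h3 := Fin.cons_inj.1 h2
    rw [h1, h3.1, h3.2]

theorem SchwartzFamily.waveInt [FiniteDimensional ℝ E] [FiniteDimensional ℝ E'] [MeasureSpace E']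
    [BorelSpace E'] [(volume : Measure E').HasTemperateGrowth] {F : E × E' → Wave}
    (hF : SchwartzFamily F) : SchwartzFamily fun e : E => waveInt fun u : E' => F (e, u) where
  bounded := hF.bounded.imp fun L h l hl e => by
    funext q
    simp [QSTDyson.waveInt, h l hl]
  schwartz l := by
    have : ProperSpace E' := FiniteDimensional.proper_real E'
    refine IsSchwartz.partialIntegral (f := fun z : (E × (Fin l → Mom)) × E' =>
      F (z.1.1, z.2) l z.1.2) volume ?_
    refine (hF.schwartz l).comp_injective (F := (E × (Fin l → Mom)) × E')
      (((LinearMap.fst ℝ _ _ ∘ₗ LinearMap.fst ℝ _ _).prod (LinearMap.snd ℝ _ _)).prod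
        (LinearMap.snd ℝ _ _ ∘ₗ LinearMap.fst ℝ _ _)) ?_
    rintro ⟨⟨e, k⟩, u⟩ ⟨⟨e', k'⟩, u'⟩ h
    have h1 : e = e' := congrArg (fun z => z.1.1) h
    have h2 : u = u' := congrArg (fun z => z.1.2) h
    have h3 : k = k' := congrArg Prod.snd h
    rw [h1, h2, h3]

theorem isSchwartz_wave (Ψ : SchwartzFock) (l : ℕ) : IsSchwartz (wave Ψ l) :=
  ⟨Ψ l, fun _ => rfl⟩

/-- The functions `a(q_1) ⋯ a(q_s) Ψ` are Schwartz functions of `q_1, …, q_s` and the remaining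
momenta. -/
theorem schwartzFamily_destroys (Ψ : SchwartzFock) (s : ℕ) :
    SchwartzFamily fun q : Fin s → Mom => (List.ofFn q).foldr destroy (wave Ψ) := by
  induction s with
  | zero =>
    refine ⟨(exists_bound_wave Ψ).imp fun L h l hl _ => by simpa using h l hl, fun l => ?_⟩
    refine ((isSchwartz_wave Ψ l).comp_injective (F := (Fin 0 → Mom) × (Fin l → Mom))
      (LinearMap.snd ℝ _ _) ?_).congr fun x => by simp
    rintro ⟨a, b⟩ ⟨c, d⟩ h
    have : b = d := h
    rw [this, Subsingleton.elim a c]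
  | succ s ih =>
    have h := ih.destroy.comp (E' := Fin (s + 1) → Mom)
      ((LinearMap.funLeft ℝ Mom Fin.succ).prod (LinearMap.proj 0)) (by
        intro x y hxy
        funext i
        refine Fin.cases (congrArg Prod.snd hxy) (fun j => ?_) i
        exact congrFun (congrArg Prod.fst hxy) j)
    simp only [List.ofFn_succ]
    exact h

theorem SchwartzFamily.smul [FiniteDimensional ℝ E] [FiniteDimensional ℝ E'] {F : E' → Wave}
    (hF : SchwartzFamily F) {W : E → ℂ} (hW : IsSchwartz W) (L : E →ₗ[ℝ] E') :
    SchwartzFamily fun e : E => W e • F (L e) where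
  bounded := hF.bounded.imp fun _ h l hl e => by simp [h l hl]
  schwartz l := by
    refine (hW.tensor (hF.schwartz l)).comp_injective (F := E × (Fin l → Mom))
      ((LinearMap.fst ℝ _ _).prod (L.prodMap LinearMap.id)) ?_
    rintro ⟨e, k⟩ ⟨e', k'⟩ h
    have h1 : e = e' := congrArg Prod.fst h
    have h2 : k = k' := congrArg (fun z => z.2.2) h
    rw [h1, h2]

end SchwartzFamily

/-! ### Wick monomials with Schwartz kernel as operators on the Schwartz domain -/

section WickOp

variable {r s : ℕ}

/-- `∫ dp dq W(p,q) a†(p_1) ⋯ a†(p_r) a(q_1) ⋯ a(q_s) ψ` as a pointwise wave function. -/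
def wickWave (W : (Fin r → Mom) → (Fin s → Mom) → ℂ) (ψ : Wave) : Wave :=
  iterCre r fun p => waveInt fun q => W p q • (List.ofFn q).foldr destroy ψ

theorem foldr_destroy_add (q : List Mom) (φ ψ : Wave) :
    q.foldr destroy (φ + ψ) = q.foldr destroy φ + q.foldr destroy ψ := by
  induction q with
  | nil => rfl
  | cons k q ih => simp only [List.foldr_cons, ih, destroy_add]

theorem foldr_destroy_smul (q : List Mom) (c : ℂ) (ψ : Wave) :
    q.foldr destroy (c • ψ) = c • q.foldr destroy ψ := by
  induction q with
  | nil => rfl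
  | cons k q ih => simp only [List.foldr_cons, ih, destroy_smul]

theorem schwartzFamily_wickIntegrand (W : 𝓢((Fin r → Mom) × (Fin s → Mom), ℂ))
    (Ψ : SchwartzFock) : SchwartzFamily fun z : (Fin r → Mom) × (Fin s → Mom) =>
      W z • (List.ofFn z.2).foldr destroy (wave Ψ) :=
  (schwartzFamily_destroys Ψ s).smul (isSchwartz_coe W) (LinearMap.snd ℝ _ _)

theorem integrable_wickIntegrand (W : 𝓢((Fin r → Mom) × (Fin s → Mom), ℂ))
    (Ψ : SchwartzFock) (p : Fin r → Mom) (l : ℕ) (k : Fin l → Mom) :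
    Integrable fun q => (W (p, q) • (List.ofFn q).foldr destroy (wave Ψ)) l k := by
  obtain ⟨f, hf⟩ := (schwartzFamily_wickIntegrand W Ψ).schwartz l
  obtain ⟨g, hg⟩ := (isSchwartz_coe f).comp_injective
    (F := ((Fin r → Mom) × (Fin l → Mom)) × (Fin s → Mom))
    (((LinearMap.fst ℝ _ _ ∘ₗ LinearMap.fst ℝ _ _).prod (LinearMap.snd ℝ _ _)).prod
        (LinearMap.snd ℝ _ _ ∘ₗ LinearMap.fst ℝ _ _)) (by
      rintro ⟨⟨e, k⟩, u⟩ ⟨⟨e', k'⟩, u'⟩ h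
      have h1 : e = e' := congrArg (fun z => z.1.1) h
      have h2 : u = u' := congrArg (fun z => z.1.2) h
      have h3 : k = k' := congrArg Prod.snd h
      rw [h1, h2, h3])
  refine (integrable_slice volume g (p, k)).congr (.of_forall fun q => ?_)
  beta_reduce
  rw [hg]
  exact hf ((p, q), k)

theorem exists_wickOp (W : 𝓢((Fin r → Mom) × (Fin s → Mom), ℂ)) (Ψ : SchwartzFock) :
    ∃ Φ : SchwartzFock, wave Φ = wickWave (fun p q => W (p, q)) (wave Ψ) := by
  have h1 := (schwartzFamily_wickIntegrand W Ψ).waveInt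
  have h2 := h1.comp (E' := (Fin 0 → Mom) × (Fin r → Mom)) (LinearMap.snd ℝ _ _) (by
    rintro ⟨a, b⟩ ⟨c, d⟩ h
    have : b = d := h
    rw [this, Subsingleton.elim a c])
  have h3 := SchwartzFamily.iterCre r h2
  refine exists_wave_eq (h3.bounded.imp fun L h l hl => h l hl 0) (fun l => ?_) ?_
  · exact ((h3.schwartz l).comp_injective (LinearMap.inr ℝ (Fin 0 → Mom) (Fin l → Mom))
      LinearMap.inr_injective).congr fun k => rfl
  · exact WaveSymm.iterCre r fun p => WaveSymm.waveInt fun q =>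
      ((waveSymm_wave Ψ).foldr _).smul _

theorem waveInt_add {α : Type*} [MeasureSpace α] {F G : α → Wave}
    (hF : ∀ l k, Integrable fun u => F u l k) (hG : ∀ l k, Integrable fun u => G u l k) :
    (waveInt fun u => F u + G u) = waveInt F + waveInt G := by
  funext l k
  exact integral_add (hF l k) (hG l k)

/-- The operator `∫ dp dq W(p,q) a†(p_1) ⋯ a†(p_r) a(q_1) ⋯ a(q_s)` with Schwartz kernel `W`. -/
def wickOp (W : 𝓢((Fin r → Mom) × (Fin s → Mom), ℂ)) : Module.End ℂ SchwartzFock where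
  toFun Ψ := (exists_wickOp W Ψ).choose
  map_add' Φ Ψ := wave_injective (by
    refine (exists_wickOp W (Φ + Ψ)).choose_spec.trans (Eq.trans ?_ (congrArg₂ (· + ·)
      (exists_wickOp W Φ).choose_spec (exists_wickOp W Ψ).choose_spec).symm)
    rw [wave_add]
    simp only [wickWave, foldr_destroy_add, smul_add]
    rw [← iterCre_add]
    congr 1
    funext p
    exact waveInt_add (integrable_wickIntegrand W Φ p) (integrable_wickIntegrand W Ψ p))
  map_smul' c Ψ := wave_injective (by
    refine (exists_wickOp W (c • Ψ)).choose_spec.trans (Eq.trans ?_ (congrArg (c • ·)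
      (exists_wickOp W Ψ).choose_spec).symm)
    rw [wave_smul]
    simp only [wickWave, foldr_destroy_smul, smul_comm _ c]
    rw [← iterCre_smul]
    simp only [waveInt_smul])

theorem wave_wickOp (W : 𝓢((Fin r → Mom) × (Fin s → Mom), ℂ)) (Ψ : SchwartzFock) :
    wave (wickOp W Ψ) = wickWave (fun p q => W (p, q)) (wave Ψ) :=
  (exists_wickOp W Ψ).choose_spec

end WickOp

/-! ### Continuous families of wave functions with integrable product bounds -/

/-- An integrable weight on momentum space; the exponent only has to exceed the dimension `3`. -/
def wt (q : Mom) : ℝ := ((1 + ‖q‖) ^ 4)⁻¹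

theorem wt_pos (q : Mom) : 0 < wt q := by unfold wt; positivity

theorem wt_le_one (q : Mom) : wt q ≤ 1 :=
  inv_le_one_of_one_le₀ (one_le_pow₀ (by linarith [norm_nonneg q]))

theorem integrable_wt : Integrable wt := by
  have h := integrable_one_add_norm (E := Mom) (μ := volume) (r := (4 : ℝ)) (by simp; norm_num)
  refine h.congr (.of_forall fun q => ?_)
  simp only [wt]
  rw [Real.rpow_neg (by positivity)]
  norm_cast

theorem prod_wt_nonneg {ι : Type*} (s : Finset ι) (k : ι → Mom) : 0 ≤ ∏ i ∈ s, wt (k i) :=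
  Finset.prod_nonneg fun _ _ => (wt_pos _).le

theorem prod_wt_le_one {ι : Type*} (s : Finset ι) (k : ι → Mom) : ∏ i ∈ s, wt (k i) ≤ 1 :=
  Finset.prod_le_one (fun _ _ => (wt_pos _).le) fun _ _ => wt_le_one _

theorem integrable_prod_wt (ι : Type*) [Fintype ι] :
    Integrable fun k : ι → Mom => ∏ i, wt (k i) :=
  Integrable.fintype_prod fun _ => integrable_wt

/-- Schwartz functions decay in any finite number of momentum components. -/
theorem IsSchwartz.exists_le_prod_wt {E : Type} [NormedAddCommGroup E] [NormedSpace ℝ E]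
    {f : E → ℂ} (hf : IsSchwartz f) {ι : Type*} [Fintype ι] (π : ι → E → Mom)
    (hπ : ∀ i x, ‖π i x‖ ≤ ‖x‖) : ∃ C, 0 ≤ C ∧ ∀ x, ‖f x‖ ≤ C * ∏ i, wt (π i x) := by
  obtain ⟨f', hf⟩ := hf
  have h := fun x => SchwartzMap.one_add_le_sup_seminorm_apply (𝕜 := ℝ)
    (m := (4 * Fintype.card ι, 0)) (k := 4 * Fintype.card ι) (n := 0) le_rfl le_rfl f' x
  simp only [norm_iteratedFDeriv_zero] at h
  refine ⟨_, le_trans (by positivity) (h 0), fun x => ?_⟩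
  have h1 : ∏ i, wt (π i x) = (∏ i, (1 + ‖π i x‖) ^ 4)⁻¹ := by
    simp [wt, Finset.prod_inv_distrib]
  rw [h1, ← div_eq_mul_inv, le_div_iff₀ (Finset.prod_pos fun i _ => by positivity), ← hf]
  refine le_trans ?_ (h x)
  rw [mul_comm, pow_mul]
  gcongr
  calc ∏ i, (1 + ‖π i x‖) ^ 4 ≤ ∏ i : ι, (1 + ‖x‖) ^ 4 := by
        gcongr with i
        exact hπ i x
    _ = _ := by simp

/-- A family of wave functions with boundedly many particles which is jointly continuous in the
parameter and the momenta, and dominated by `b t` times a product of integrable weights. -/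
structure Tame {T : Type*} [TopologicalSpace T] (b : T → ℝ) (F : T → Wave) : Prop where
  bounded : ∃ L, ∀ l, L ≤ l → ∀ t, F t l = 0
  cont : ∀ l, Continuous fun z : T × (Fin l → Mom) => F z.1 l z.2
  bound : ∀ l, ∃ C, 0 ≤ C ∧ ∀ t k, ‖F t l k‖ ≤ C * (b t * ∏ i, wt (k i))

section Tame

variable {T T' : Type*} [TopologicalSpace T] [TopologicalSpace T'] {b : T → ℝ}

theorem Tame.comp {F : T → Wave} (hF : Tame b F) {f : T' → T} (hf : Continuous f) :
    Tame (fun t => b (f t)) fun t => F (f t) where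
  bounded := hF.bounded.imp fun _ h l hl _ => h l hl _
  cont l := (hF.cont l).comp (hf.prodMap continuous_id)
  bound l := (hF.bound l).imp fun _ h => ⟨h.1, fun _ => h.2 _⟩

theorem Tame.mono {b' : T → ℝ} {F : T → Wave} (hF : Tame b F) (h : ∀ t, b t ≤ b' t) :
    Tame b' F where
  bounded := hF.bounded
  cont := hF.cont
  bound l := (hF.bound l).imp fun C hC => ⟨hC.1, fun t k => (hC.2 t k).trans (by
    have := hC.1
    have := prod_wt_nonneg Finset.univ k
    gcongr
    exact h t)⟩

theorem Tame.smul {F : T → Wave} (hF : Tame b F) {V : T → ℂ} {c : T → ℝ}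
    (hV : Continuous V) (hVc : ∃ C, 0 ≤ C ∧ ∀ t, ‖V t‖ ≤ C * c t) :
    Tame (fun t => c t * b t) fun t => V t • F t where
  bounded := hF.bounded.imp fun _ h l hl t => by simp [h l hl]
  cont l := (hV.comp continuous_fst).mul (hF.cont l)
  bound l := by
    obtain ⟨C, hC, h⟩ := hF.bound l
    obtain ⟨C', hC', h'⟩ := hVc
    refine ⟨C' * C, by positivity, fun t k => ?_⟩
    simp only [Pi.smul_apply, norm_smul]
    calc _ ≤ (C' * c t) * (C * (b t * ∏ i, wt (k i))) :=
          mul_le_mul (h' t) (h t k) (norm_nonneg _) ((norm_nonneg _).trans (h' t))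
      _ = _ := by ring

/-- The momentum fixed by a destruction operator becomes a parameter and keeps its weight. -/
theorem Tame.destroy {F : T → Wave} (hF : Tame b F) {f : T → Mom} (hf : Continuous f) :
    Tame (fun t => b t * wt (f t)) fun t => destroy (f t) (F t) where
  bounded := hF.bounded.imp fun L h l hl t => by
    funext q
    simp [QSTDyson.destroy, h (l + 1) (by omega)]
  cont l := continuous_const.mul ((hF.cont (l + 1)).comp (continuous_fst.prodMk
    (continuous_pi fun i => Fin.cases (hf.comp continuous_fst)
      (fun j => (continuous_apply j).comp continuous_snd) i)))
  bound l := by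
    obtain ⟨C, hC, h⟩ := hF.bound (l + 1)
    refine ⟨Real.sqrt (l + 1) * C, by positivity, fun t k => ?_⟩
    simp only [QSTDyson.destroy, norm_mul, Complex.norm_real,
      Real.norm_of_nonneg (Real.sqrt_nonneg _)]
    calc _ ≤ Real.sqrt (l + 1) *
          (C * (b t * ∏ i, wt ((Fin.cons (f t) k : Fin (l + 1) → Mom) i))) := by
          gcongr
          exact h _ _
      _ = _ := by rw [Fin.prod_univ_succ]; simp; ring

/-- Every summand of a smeared creation operator has one of the particle momenta as its parameter,
whose weight becomes that of the particle. -/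
theorem Tame.cre {F : T × Mom → Wave} (hF : Tame (fun z => b z.1 * wt z.2) F) :
    Tame b fun t => cre fun p => F (t, p) where
  bounded := hF.bounded.imp' (· + 1) fun L h l hl t => by
    funext q
    obtain ⟨l, rfl⟩ : ∃ l', l = l' + 1 := ⟨l - 1, by omega⟩
    simp [QSTDyson.cre, h l (by omega)]
  cont l := by
    cases l with
    | zero => exact continuous_const
    | succ l =>
      refine continuous_const.mul (continuous_finsetSum _ fun i _ => ?_)
      exact (hF.cont l).comp ((continuous_fst.prodMk ((continuous_apply i).comp
        continuous_snd)).prodMk (continuous_pi fun j => (continuous_apply _).comp continuous_snd))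
  bound l := by
    cases l with
    | zero => exact ⟨0, le_rfl, fun t k => by simp [QSTDyson.cre]⟩
    | succ l =>
      obtain ⟨C, hC, h⟩ := hF.bound l
      refine ⟨(l + 1) * C, by positivity, fun t k => ?_⟩
      simp only [QSTDyson.cre, norm_mul, norm_inv, Complex.norm_real,
        Real.norm_of_nonneg (Real.sqrt_nonneg _)]
      have h1 : (Real.sqrt (l + 1))⁻¹ ≤ 1 :=
        inv_le_one_of_one_le₀ (Real.one_le_sqrt.2 (by simp))
      calc _ ≤ 1 * ∑ i, ‖F (t, k i) l (Fin.removeNth i k)‖ := by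
            gcongr
            exact norm_sum_le _ _
        _ ≤ 1 * ∑ i : Fin (l + 1), C * (b t * ∏ i, wt (k i)) := by
            gcongr with i
            refine (h _ _).trans (le_of_eq ?_)
            rw [Fin.prod_univ_succAbove _ i, ← mul_assoc (b t)]
            rfl
        _ = _ := by simp; ring

theorem Tame.iterCre (r : ℕ) : ∀ {T : Type} [TopologicalSpace T] {b : T → ℝ}
    {F : T × (Fin r → Mom) → Wave}, Tame (fun z => b z.1 * ∏ i, wt (z.2 i)) F →
    Tame b fun t => iterCre r fun p => F (t, p) := by
  induction r with
  | zero =>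
    intro T _ b F hF
    have := hF.comp (f := fun t : T => (t, (Fin.elim0 : Fin 0 → Mom)))
      (continuous_id.prodMk continuous_const)
    simp only [Finset.univ_eq_empty, Finset.prod_empty, mul_one] at this
    exact this
  | succ r ih =>
    intro T _ b F hF
    refine Tame.cre (ih (F := fun z => F (z.1.1, Fin.cons z.1.2 z.2)) ?_)
    have := hF.comp (f := fun z : (T × Mom) × (Fin r → Mom) =>
        (z.1.1, (Fin.cons z.1.2 z.2 : Fin (r + 1) → Mom)))
      ((continuous_fst.comp continuous_fst).prodMk (continuous_pi fun i =>
        Fin.cases (continuous_snd.comp continuous_fst)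
          (fun j => (continuous_apply j).comp continuous_snd) i))
    refine this.mono fun z => le_of_eq ?_
    simp [Fin.prod_univ_succ, mul_assoc]

theorem Tame.foldr {ι : Type*} {F : T → Wave} (hF : Tame b F) (f : ι → T → Mom)
    (hf : ∀ i, Continuous (f i)) (q : List ι) :
    Tame (fun t => b t * (q.map fun i => wt (f i t)).prod) fun t =>
      (q.map fun i => f i t).foldr QSTDyson.destroy (F t) := by
  induction q with
  | nil => simpa using hF
  | cons i q ih =>
    refine (ih.destroy (hf i)).mono fun t => le_of_eq ?_
    simp only [List.map_cons, List.prod_cons]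
    ring

variable {α : Type*} [TopologicalSpace α] [MeasureSpace α] [OpensMeasurableSpace α] {c : α → ℝ}

theorem Tame.integrable {F : T × α → Wave} (hF : Tame (fun z => b z.1 * c z.2) F)
    (hc : Integrable c) (t : T) (l : ℕ) (k : Fin l → Mom) :
    Integrable fun u => F (t, u) l k := by
  obtain ⟨C, hC, h⟩ := hF.bound l
  refine (hc.const_mul (C * b t * ∏ i, wt (k i))).mono' ?_ (.of_forall fun u => ?_)
  · exact ((hF.cont l).comp ((continuous_const.prodMk continuous_id).prodMk
      continuous_const)).aestronglyMeasurable
  · exact (h (t, u) k).trans (le_of_eq (by ring))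

/-- Parameters with an integrable weight can be integrated out. -/
theorem Tame.waveInt [FirstCountableTopology T] {F : T × α → Wave}
    (hF : Tame (fun z => b z.1 * c z.2) F)
    (hc : Integrable c) (hc0 : ∀ u, 0 ≤ c u) (hb : ∀ t, 0 ≤ b t ∧ b t ≤ 1) :
    Tame b fun t => waveInt fun u => F (t, u) where
  bounded := hF.bounded.imp fun L h l hl t => by
    funext q
    simp [QSTDyson.waveInt, h l hl]
  cont l := by
    obtain ⟨C, hC, h⟩ := hF.bound l
    refine continuous_of_dominated (bound := fun u => C * c u) (fun z => ?_)
      (fun z => .of_forall fun u => ?_) (hc.const_mul C) (.of_forall fun u => ?_)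
    · exact (hF.integrable hc z.1 l z.2).1
    · refine (h (z.1, u) z.2).trans ?_
      gcongr
      have h1 := prod_wt_le_one Finset.univ z.2
      have h2 := prod_wt_nonneg Finset.univ z.2
      have h3 := hc0 u
      obtain ⟨h4, h5⟩ := hb z.1
      calc b z.1 * c u * ∏ i, wt (z.2 i) ≤ 1 * c u * 1 := by gcongr
        _ = c u := by ring
    · exact (hF.cont l).comp ((continuous_fst.prodMk continuous_const).prodMk continuous_snd)
  bound l := by
    obtain ⟨C, hC, h⟩ := hF.bound l
    refine ⟨C * ∫ u, c u, mul_nonneg hC (integral_nonneg hc0), fun t k => ?_⟩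
    calc ‖∫ u, F (t, u) l k‖ ≤ ∫ u, ‖F (t, u) l k‖ := norm_integral_le_integral_norm _
      _ ≤ ∫ u, C * (b t * ∏ i, wt (k i)) * c u :=
          integral_mono (hF.integrable hc t l k).norm (hc.const_mul _)
            fun u => (h (t, u) k).trans (le_of_eq (by ring))
      _ = _ := by rw [integral_const_mul]; ring

end Tame

/-- A single continuous, rapidly decaying wave function with boundedly many particles. -/
abbrev TameWave (φ : Wave) : Prop := Tame (fun _ : Unit => (1 : ℝ)) fun _ => φ

theorem TameWave.const {φ : Wave} (h : TameWave φ) (T : Type*) [TopologicalSpace T] :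
    Tame (fun _ : T => (1 : ℝ)) fun _ => φ :=
  Tame.comp h (f := fun _ : T => ()) continuous_const

theorem tameWave_wave (Φ : SchwartzFock) : TameWave (wave Φ) where
  bounded := (exists_bound_wave Φ).imp fun _ h l hl _ => h l hl
  cont l := (isSchwartz_wave Φ l).continuous.comp continuous_snd
  bound l := by
    obtain ⟨C, hC, h⟩ := (isSchwartz_wave Φ l).exists_le_prod_wt (fun i k => k i)
      fun i x => norm_le_pi_norm x i
    exact ⟨C, hC, fun _ k => by simpa using h k⟩

theorem TameWave.destroy {φ : Wave} (h : TameWave φ) (k : Mom) : TameWave (destroy k φ) :=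
  (Tame.destroy h (f := fun _ => k) continuous_const).mono fun _ => by
    simpa using wt_le_one k

/-! ### The scalar product of wave functions -/

theorem waveInner_eq_sum {φ ψ : Wave} {L : ℕ} (h : ∀ l, L ≤ l → ψ l = 0) :
    waveInner φ ψ = ∑ l ∈ Finset.range L, ∫ q : Fin l → Mom, conj (φ l q) * ψ l q :=
  tsum_eq_sum fun l hl => by simp [h l (by simpa using hl)]

theorem waveInner_smul (c : ℂ) (φ ψ : Wave) : waveInner φ (c • ψ) = c * waveInner φ ψ := by
  simp only [waveInner, ← tsum_mul_left, ← integral_const_mul]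
  congr! 4 with l q
  simp only [Pi.smul_apply, smul_eq_mul]
  ring

theorem conj_waveInner (φ ψ : Wave) : conj (waveInner φ ψ) = waveInner ψ φ := by
  simp only [waveInner]
  rw [Complex.conj_tsum]
  refine tsum_congr fun l => ?_
  rw [← integral_conj]
  refine integral_congr_ae (.of_forall fun q => ?_)
  simp [mul_comm]

section Inner

variable {T : Type*} [TopologicalSpace T] {b b' : T → ℝ}

theorem Tame.exists_inner_bound {F G : T → Wave} (hF : Tame b F) (hG : Tame b' G) (l : ℕ) :
    ∃ C, 0 ≤ C ∧ ∀ t k, ‖conj (F t l k) * G t l k‖ ≤ C * (b t * b' t * ∏ i, wt (k i)) := by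
  obtain ⟨C, hC, h⟩ := hF.bound l
  obtain ⟨C', hC', h'⟩ := hG.bound l
  refine ⟨C * C', by positivity, fun t k => ?_⟩
  have h1 := prod_wt_le_one Finset.univ k
  have h2 : 0 < ∏ i, wt (k i) := Finset.prod_pos fun i _ => wt_pos _
  rw [norm_mul, RCLike.norm_conj]
  have h3 := mul_le_mul (h t k) (h' t k) (norm_nonneg _) ((norm_nonneg _).trans (h t k))
  have h4 : 0 ≤ C * C' * (b t * b' t * ∏ i, wt (k i)) := by
    refine nonneg_of_mul_nonneg_left (b := ∏ i, wt (k i)) ?_ h2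
    refine ((mul_nonneg (norm_nonneg _) (norm_nonneg _)).trans h3).trans (le_of_eq ?_)
    ring
  calc _ ≤ _ := h3
    _ = (C * C' * (b t * b' t * ∏ i, wt (k i))) * ∏ i, wt (k i) := by ring
    _ ≤ _ := mul_le_of_le_one_right h4 h1

theorem Tame.continuous_inner {F G : T → Wave} (hF : Tame b F) (hG : Tame b' G) (l : ℕ) :
    Continuous fun z : T × (Fin l → Mom) => conj (F z.1 l z.2) * G z.1 l z.2 :=
  (Complex.continuous_conj.comp (hF.cont l)).mul (hG.cont l)

theorem Tame.integrable_inner {F G : T → Wave} (hF : Tame b F) (hG : Tame b' G) (l : ℕ) (t : T) :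
    Integrable fun k => conj (F t l k) * G t l k := by
  obtain ⟨C, hC, h⟩ := hF.exists_inner_bound hG l
  refine ((integrable_prod_wt (Fin l)).const_mul (C * (b t * b' t))).mono'
    ((hF.continuous_inner hG l).comp (continuous_const.prodMk
      continuous_id)).aestronglyMeasurable (.of_forall fun k => ?_)
  exact (h t k).trans (le_of_eq (by ring))

theorem Tame.continuous_waveInner [FirstCountableTopology T] {F G : T → Wave} (hF : Tame b F)
    (hG : Tame b' G) (hb : ∀ t, 0 ≤ b t ∧ b t ≤ 1) (hb' : ∀ t, 0 ≤ b' t ∧ b' t ≤ 1) :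
    Continuous fun t => waveInner (F t) (G t) := by
  obtain ⟨L, hL⟩ := hG.bounded
  simp only [fun t => waveInner_eq_sum (φ := F t) (ψ := G t) fun l hl => hL l hl t]
  refine continuous_finsetSum _ fun l _ => ?_
  obtain ⟨C, hC, h⟩ := hF.exists_inner_bound hG l
  refine continuous_of_dominated (bound := fun k => C * ∏ i, wt (k i)) (fun t => ?_)
    (fun t => .of_forall fun k => ?_) ((integrable_prod_wt _).const_mul C)
    (.of_forall fun k => ?_)
  · exact (hF.integrable_inner hG l t).1
  · refine (h t k).trans ?_
    have h2 := prod_wt_nonneg Finset.univ k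
    obtain ⟨h4, h5⟩ := hb t
    obtain ⟨h6, h7⟩ := hb' t
    calc C * (b t * b' t * ∏ i, wt (k i)) ≤ C * (1 * 1 * ∏ i, wt (k i)) := by gcongr
      _ = _ := by ring
  · exact (hF.continuous_inner hG l).comp (continuous_id.prodMk continuous_const)

theorem Tame.exists_waveInner_bound {F G : T → Wave} (hF : Tame b F) (hG : Tame b' G) :
    ∃ C, 0 ≤ C ∧ ∀ t, 0 ≤ b t → 0 ≤ b' t → ‖waveInner (F t) (G t)‖ ≤ C * (b t * b' t) := by
  obtain ⟨L, hL⟩ := hG.bounded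
  choose C hC h using hF.exists_inner_bound hG
  refine ⟨∑ l ∈ Finset.range L, C l * ∫ k : Fin l → Mom, ∏ i, wt (k i),
    Finset.sum_nonneg fun l _ => mul_nonneg (hC l) (integral_nonneg fun k =>
      prod_wt_nonneg _ _), fun t _ _ => ?_⟩
  rw [waveInner_eq_sum fun l hl => hL l hl t, Finset.sum_mul]
  refine (norm_sum_le _ _).trans (Finset.sum_le_sum fun l _ => ?_)
  calc _ ≤ ∫ k : Fin l → Mom, ‖conj (F t l k) * G t l k‖ := norm_integral_le_integral_norm _
    _ ≤ ∫ k : Fin l → Mom, C l * (b t * b' t) * ∏ i, wt (k i) :=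
        integral_mono (hF.integrable_inner hG l t).norm ((integrable_prod_wt _).const_mul _)
          fun k => (h l t k).trans (le_of_eq (by ring))
    _ = _ := by rw [integral_const_mul]; ring

/-- Fubini's theorem for the scalar product with an integral of wave functions. -/
theorem waveInner_waveInt {α : Type*} [TopologicalSpace α] [MeasureSpace α]
    [OpensMeasurableSpace α] [SFinite (volume : Measure α)] {c : α → ℝ} {φ : Wave}
    (hφ : TameWave φ) {F : α → Wave} (hF : Tame c F) (hc : Integrable c) :
    waveInner φ (waveInt F) = ∫ u, waveInner φ (F u) := by
  obtain ⟨L, hL⟩ := hF.bounded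
  have e : ∀ u, waveInner φ (F u) = _ := fun u =>
    waveInner_eq_sum (φ := φ) (ψ := F u) fun l hl => hL l hl u
  have hint : ∀ l, Integrable (Function.uncurry fun (u : α) (q : Fin l → Mom) =>
      conj (φ l q) * F u l q) (volume.prod volume) := fun l => by
    obtain ⟨C, hC, h⟩ := (hφ.const α).exists_inner_bound hF l
    refine ((hc.mul_prod (integrable_prod_wt (Fin l))).const_mul C).mono'
      ((hφ.const α).continuous_inner hF l).aestronglyMeasurable (.of_forall fun z => ?_)
    exact (h z.1 z.2).trans (le_of_eq (by ring))
  simp only [e]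
  rw [integral_finsetSum (Finset.range L) (f := fun l u => ∫ q : Fin l → Mom,
      conj (φ l q) * F u l q) fun l _ => (hint l).integral_prod_left,
    waveInner_eq_sum (L := L) fun l hl => by funext q; simp [waveInt, hL l hl]]
  refine Finset.sum_congr rfl fun l _ => ?_
  simp only [waveInt, ← integral_const_mul]
  exact (integral_integral_swap (hint l)).symm

/-- Fubini's theorem for one distinguished momentum. -/
theorem integral_insertNth {l : ℕ} (i : Fin (l + 1)) (g : (Fin (l + 1) → Mom) → ℂ)
    (hg : Integrable g) :
    ∫ k, g k = ∫ p : Mom, ∫ q : Fin l → Mom, g (Fin.insertNth i p q) := by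
  have h := (volume_preserving_piFinSuccAbove (fun _ : Fin (l + 1) => Mom) i).symm
  rw [← h.integral_comp', Measure.volume_eq_prod, integral_prod]
  · rfl
  · exact (h.integrable_comp_emb (MeasurableEquiv.measurableEmbedding _)).2 hg

/-- By symmetry of `φ`, every term of `cre F` contributes the same integral. -/
theorem integral_conj_mul_removeNth {φ : Wave} (hφ : TameWave φ) (hs : WaveSymm φ)
    {F : Mom → Wave} (hF : Tame wt F) {l : ℕ} (i : Fin (l + 1)) :
    Integrable (fun k : Fin (l + 1) → Mom => conj (φ (l + 1) k) * F (k i) l (Fin.removeNth i k)) ∧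
      ∫ k : Fin (l + 1) → Mom, conj (φ (l + 1) k) * F (k i) l (Fin.removeNth i k) =
        ∫ p : Mom, ∫ q : Fin l → Mom, conj (φ (l + 1) (Fin.cons p q)) * F p l q := by
  have h1 : Integrable fun k : Fin (l + 1) → Mom =>
      conj (φ (l + 1) k) * F (k i) l (Fin.removeNth i k) := by
    obtain ⟨C, hC, h⟩ := hφ.bound (l + 1)
    obtain ⟨C', hC', h'⟩ := hF.bound l
    refine ((integrable_prod_wt (Fin (l + 1))).const_mul (C * C')).mono' ?_
      (.of_forall fun k => ?_)
    · refine Continuous.aestronglyMeasurable ?_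
      have c1 : Continuous fun k : Fin (l + 1) → Mom => φ (l + 1) k :=
        (hφ.cont (l + 1)).comp ((continuous_const (y := ())).prodMk continuous_id)
      have c2 : Continuous fun k : Fin (l + 1) → Mom => F (k i) l (Fin.removeNth i k) :=
        (hF.cont l).comp (f := fun k : Fin (l + 1) → Mom => (k i, Fin.removeNth i k))
          ((continuous_apply i).prodMk (continuous_pi fun j => continuous_apply _))
      exact (Complex.continuous_conj.comp c1).mul c2
    · have h2 := prod_wt_nonneg Finset.univ k
      have h3 := prod_wt_le_one Finset.univ k
      have h5 := h' (k i) (Fin.removeNth i k)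
      rw [show wt (k i) * ∏ j, wt (Fin.removeNth i k j) = ∏ j, wt (k j) from
        (Fin.prod_univ_succAbove (fun j => wt (k j)) i).symm] at h5
      rw [norm_mul, RCLike.norm_conj]
      calc _ ≤ (C * (1 * ∏ j, wt (k j))) * (C' * ∏ j, wt (k j)) :=
            mul_le_mul (h () k) h5 (norm_nonneg _) (by positivity)
        _ ≤ (C * (1 * 1)) * (C' * ∏ j, wt (k j)) := by gcongr
        _ = _ := by ring
  refine ⟨h1, (integral_insertNth i _ h1).trans ?_⟩
  congr 1
  funext p
  congr 1
  funext q
  rw [Fin.insertNth_apply_same, Fin.removeNth_insertNth, ← hs (l + 1) i.cycleRange.symm,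
    Fin.insertNth_comp_cycleRange_symm]

theorem integrable_conj_destroy {φ : Wave} (hφ : TameWave φ) {F : Mom → Wave}
    (hF : Tame wt F) (l : ℕ) : Integrable (Function.uncurry fun (u : Mom) (q : Fin l → Mom) =>
      conj (destroy u φ l q) * F u l q) (volume.prod volume) := by
  have hd : Tame (fun p => 1 * wt p) fun p : Mom => destroy p φ :=
    (hφ.const Mom).destroy continuous_id
  obtain ⟨C, hC, h⟩ := hd.exists_inner_bound hF l
  have hi : Integrable (fun z : Mom × (Fin l → Mom) => C * (wt z.1 * ∏ i, wt (z.2 i)))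
      (volume.prod volume) := (integrable_wt.mul_prod (integrable_prod_wt (Fin l))).const_mul C
  refine hi.mono' (hd.continuous_inner hF l).aestronglyMeasurable (.of_forall fun z => ?_)
  refine (h z.1 z.2).trans ?_
  have h1 := prod_wt_nonneg Finset.univ z.2
  have h2 := (wt_pos z.1).le
  have h3 := wt_le_one z.1
  have h4 : 1 * wt z.1 * wt z.1 ≤ wt z.1 := by nlinarith
  exact mul_le_mul_of_nonneg_left (mul_le_mul_of_nonneg_right h4 h1) hC

/-- Smeared creation is the adjoint of destruction. -/
theorem waveInner_cre {φ : Wave} (hφ : TameWave φ) (hs : WaveSymm φ) {F : Mom → Wave}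
    (hF : Tame wt F) : waveInner φ (cre F) = ∫ p, waveInner (destroy p φ) (F p) := by
  obtain ⟨L, hL⟩ := hF.bounded
  have e : ∀ u, waveInner (destroy u φ) (F u) = _ := fun u =>
    waveInner_eq_sum (φ := destroy u φ) (ψ := F u) fun l hl => hL l hl u
  have hint := fun l => integrable_conj_destroy hφ hF l
  simp only [e]
  rw [integral_finsetSum (Finset.range L) (f := fun l u => ∫ q : Fin l → Mom,
      conj (destroy u φ l q) * F u l q) fun l _ => (hint l).integral_prod_left,
    waveInner_eq_sum (L := L + 1) fun l hl => by
      obtain ⟨l, rfl⟩ : ∃ l', l = l' + 1 := ⟨l - 1, by omega⟩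
      funext q
      simp [cre, hL l (by omega)], Finset.sum_range_succ']
  have h0 : ∫ q : Fin 0 → Mom, conj (φ 0 q) * cre F 0 q = 0 := by simp [cre]
  rw [h0, add_zero]
  refine Finset.sum_congr rfl fun l _ => ?_
  have hterm := fun i : Fin (l + 1) => integral_conj_mul_removeNth hφ hs hF i
  have e1 : ∀ k : Fin (l + 1) → Mom, conj (φ (l + 1) k) * cre F (l + 1) k =
      (Real.sqrt (l + 1) : ℂ)⁻¹ *
        ∑ i, conj (φ (l + 1) k) * F (k i) l (Fin.removeNth i k) := fun k => by
    rw [← Finset.mul_sum, cre]; ring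
  have e2 : ∀ (p : Mom) (q : Fin l → Mom), conj (destroy p φ l q) * F p l q =
      (Real.sqrt (l + 1) : ℂ) * (conj (φ (l + 1) (Fin.cons p q)) * F p l q) := fun p q => by
    simp only [destroy, map_mul, Complex.conj_ofReal, mul_assoc]
  simp only [e1, e2]
  rw [integral_const_mul, integral_finsetSum _ fun i _ => (hterm i).1]
  simp only [(hterm _).2, Finset.sum_const, Finset.card_univ, Fintype.card_fin, nsmul_eq_mul]
  simp only [integral_const_mul]
  rw [inv_mul_eq_iff_eq_mul₀ (sqrt_succ_ne_zero l), ← mul_assoc]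
  rw [← Complex.ofReal_mul, Real.mul_self_sqrt (by positivity)]
  push_cast
  ring

end Inner

/-! ### Quadratic forms of Wick monomials -/

theorem list_prod_wt_mem {ι : Type*} (P : List ι) (z : ι → Mom) :
    0 ≤ (P.map fun i => wt (z i)).prod ∧ (P.map fun i => wt (z i)).prod ≤ 1 := by
  induction P with
  | nil => simp
  | cons i P ih =>
    simp only [List.map_cons, List.prod_cons]
    exact ⟨mul_nonneg (wt_pos _).le ih.1, mul_le_one₀ (wt_le_one _) ih.1 ih.2⟩

theorem conj_normalForm (p q : List Mom) (Φ Ψ : SchwartzFock) :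
    conj (normalForm p q Φ Ψ) = normalForm q p Ψ Φ := by
  rw [normalForm, conj_waveInner, normalForm, (waveSymm_wave Φ).foldl_eq_foldr,
    (waveSymm_wave Ψ).foldl_eq_foldr]

section NormalForm

variable {T : Type*} [TopologicalSpace T] {ι : Type*} {f : ι → T → Mom}

theorem tame_destroys (hf : ∀ i, Continuous (f i)) (P : List ι) (Φ : SchwartzFock) :
    Tame (fun t => (P.map fun i => wt (f i t)).prod) fun t =>
      (P.map fun i => f i t).foldr destroy (wave Φ) := by
  simpa using ((tameWave_wave Φ).const T).foldr f hf P

theorem normalForm_eq (p q : List Mom) (Φ Ψ : SchwartzFock) :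
    normalForm p q Φ Ψ = waveInner (p.foldr destroy (wave Φ)) (q.foldr destroy (wave Ψ)) := by
  rw [normalForm, (waveSymm_wave Φ).foldl_eq_foldr]

theorem continuous_normalForm [FirstCountableTopology T] (hf : ∀ i, Continuous (f i))
    (P Q : List ι) (Φ Ψ : SchwartzFock) :
    Continuous fun t => normalForm (P.map fun i => f i t) (Q.map fun i => f i t) Φ Ψ := by
  simp only [normalForm_eq]
  exact (tame_destroys hf P Φ).continuous_waveInner (tame_destroys hf Q Ψ)
    (fun t => list_prod_wt_mem P fun i => f i t) fun t => list_prod_wt_mem Q fun i => f i t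

/-- The form `⟨Φ, a†(p_1) ⋯ a(q_s) Ψ⟩` decays in each of its momenta. -/
theorem exists_normalForm_bound (hf : ∀ i, Continuous (f i)) (P Q : List ι)
    (Φ Ψ : SchwartzFock) : ∃ C, 0 ≤ C ∧ ∀ t,
      ‖normalForm (P.map fun i => f i t) (Q.map fun i => f i t) Φ Ψ‖ ≤
        C * ((P.map fun i => wt (f i t)).prod * (Q.map fun i => wt (f i t)).prod) := by
  simp only [normalForm_eq]
  obtain ⟨C, hC, h⟩ := (tame_destroys hf P Φ).exists_waveInner_bound (tame_destroys hf Q Ψ)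
  exact ⟨C, hC, fun t => h t (list_prod_wt_mem P fun i => f i t).1
    (list_prod_wt_mem Q fun i => f i t).1⟩

end NormalForm

theorem ofFn_eq_map {r : ℕ} (p : Fin r → Mom) : List.ofFn p = (List.finRange r).map fun i => p i :=
  List.ofFn_eq_map

theorem integral_cons {l : ℕ} (g : (Fin (l + 1) → Mom) → ℂ) (hg : Integrable g) :
    ∫ k, g k = ∫ p : Mom, ∫ q : Fin l → Mom, g (Fin.cons p q) := by
  rw [integral_insertNth 0 g hg]
  simp only [Fin.insertNth_zero']

theorem TameWave.foldl (q : List Mom) : ∀ {φ : Wave}, TameWave φ →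
    TameWave (q.foldl (fun φ k => QSTDyson.destroy k φ) φ) := by
  induction q with
  | nil => intro φ h; exact h
  | cons k q ih => intro φ h; exact ih (h.destroy k)

/-- Moving iterated smeared creation to the other side of the scalar product. -/
theorem waveInner_iterCre (r : ℕ) : ∀ {φ : Wave}, TameWave φ → WaveSymm φ →
    ∀ {F : (Fin r → Mom) → Wave}, Tame (fun p => ∏ i, wt (p i)) F →
    waveInner φ (iterCre r F) =
      ∫ p, waveInner ((List.ofFn p).foldl (fun φ k => destroy k φ) φ) (F p) := by
  induction r with
  | zero =>
    intro φ _ _ F _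
    rw [integral_unique]
    simp only [iterCre, List.ofFn_zero, List.foldl_nil, Measure.real, volume_pi]
    simp
    congr 1
  | succ r ih =>
    intro φ hφ hs F hF
    have hF' : Tame (fun z : Mom × (Fin r → Mom) => wt z.1 * ∏ i, wt (z.2 i))
        fun z => F (Fin.cons z.1 z.2) := by
      refine (hF.comp (f := fun z : Mom × (Fin r → Mom) => (Fin.cons z.1 z.2 : Fin (r + 1) → Mom))
        (continuous_pi fun i => Fin.cases continuous_fst
          (fun j => (continuous_apply j).comp continuous_snd) i)).mono fun z => le_of_eq ?_
      simp [Fin.prod_univ_succ]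
    have hi : Integrable fun p : Fin (r + 1) → Mom =>
        waveInner ((List.ofFn p).foldl (fun φ k => destroy k φ) φ) (F p) := by
      simp only [hs.foldl_eq_foldr, ofFn_eq_map]
      have hd := (hφ.const (Fin (r + 1) → Mom)).foldr (fun (i : Fin (r + 1)) p => p i)
        (fun i => continuous_apply i) (List.finRange (r + 1))
      simp only [one_mul] at hd
      obtain ⟨C, hC, h⟩ := hd.exists_waveInner_bound hF
      refine ((integrable_prod_wt (Fin (r + 1))).const_mul C).mono'
        (hd.continuous_waveInner hF (fun t => list_prod_wt_mem _ _) fun t =>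
          ⟨prod_wt_nonneg _ _, prod_wt_le_one _ _⟩).aestronglyMeasurable (.of_forall fun p => ?_)
      refine (h p (list_prod_wt_mem _ _).1 (prod_wt_nonneg _ _)).trans ?_
      refine mul_le_mul_of_nonneg_left ?_ hC
      exact mul_le_of_le_one_left (prod_wt_nonneg _ _) (list_prod_wt_mem _ _).2
    rw [integral_cons _ hi, iterCre, waveInner_cre hφ hs (Tame.iterCre r hF')]
    refine integral_congr_ae (.of_forall fun p => ?_)
    beta_reduce
    have hFp : Tame (fun z : Fin r → Mom => ∏ i, wt (z i)) fun z => F (Fin.cons p z) :=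
      (hF'.comp (f := fun z => (p, z)) (by fun_prop)).mono fun z =>
        mul_le_of_le_one_left (prod_wt_nonneg _ _) (wt_le_one p)
    rw [ih (hφ.destroy p) (hs.destroy p) hFp]
    simp [List.ofFn_succ]

instance volumeProdHasTemperateGrowth (r s : ℕ) :
    (volume : Measure ((Fin r → Mom) × (Fin s → Mom))).HasTemperateGrowth := by
  have h1 : (volume : Measure (Fin r → Mom)).IsAddHaarMeasure := inferInstance
  have h2 : (volume : Measure (Fin s → Mom)).IsAddHaarMeasure := inferInstance
  exact Measure.IsAddHaarMeasure.instHasTemperateGrowth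
    (h := Measure.prod.instIsAddHaarMeasure _ _)

section WickOp

variable {r s : ℕ} (W : 𝓢((Fin r → Mom) × (Fin s → Mom), ℂ))

theorem exists_kernel_bound : ∃ C, 0 ≤ C ∧ ∀ z : (Fin r → Mom) × (Fin s → Mom),
    ‖W z‖ ≤ C * ((∏ i, wt (z.1 i)) * ∏ i, wt (z.2 i)) := by
  obtain ⟨C, hC, h⟩ := (isSchwartz_coe W).exists_le_prod_wt (ι := Fin r ⊕ Fin s)
    (fun i z => Sum.elim z.1 z.2 i) (fun i z => by
      rcases i with i | i
      · exact (norm_le_pi_norm z.1 i).trans (norm_fst_le z)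
      · exact (norm_le_pi_norm z.2 i).trans (norm_snd_le z))
  exact ⟨C, hC, fun z => by simpa using h z⟩

theorem continuous_normalForm_ofFn (Φ Ψ : SchwartzFock) :
    Continuous fun z : (Fin r → Mom) × (Fin s → Mom) =>
      normalForm (List.ofFn z.1) (List.ofFn z.2) Φ Ψ := by
  have h := continuous_normalForm (T := (Fin r → Mom) × (Fin s → Mom))
    (f := fun (i : Fin r ⊕ Fin s) z => Sum.elim z.1 z.2 i)
    (by rintro (i | i) <;> simp <;> fun_prop) ((List.finRange r).map Sum.inl)
    ((List.finRange s).map Sum.inr) Φ Ψ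
  simpa [ofFn_eq_map, Function.comp_def] using h

theorem exists_normalForm_ofFn_bound (r s : ℕ) (Φ Ψ : SchwartzFock) :
    ∃ C, 0 ≤ C ∧ ∀ z : (Fin r → Mom) × (Fin s → Mom),
      ‖normalForm (List.ofFn z.1) (List.ofFn z.2) Φ Ψ‖ ≤ C := by
  obtain ⟨C, hC, h⟩ := exists_normalForm_bound (T := (Fin r → Mom) × (Fin s → Mom))
    (f := fun (i : Fin r ⊕ Fin s) z => Sum.elim z.1 z.2 i)
    (by rintro (i | i) <;> simp <;> fun_prop) ((List.finRange r).map Sum.inl)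
    ((List.finRange s).map Sum.inr) Φ Ψ
  refine ⟨C, hC, fun z => ?_⟩
  have h1 := h z
  simp only [List.map_map, Function.comp_def, Sum.elim_inl, Sum.elim_inr, ← ofFn_eq_map] at h1
  refine h1.trans (mul_le_of_le_one_right hC ?_)
  exact mul_le_one₀ (list_prod_wt_mem _ _).2 (list_prod_wt_mem _ _).1 (list_prod_wt_mem _ _).2

/-- The form of a Wick monomial with Schwartz kernel converges absolutely. -/
theorem integrable_wickForm (Φ Ψ : SchwartzFock) :
    Integrable fun z : (Fin r → Mom) × (Fin s → Mom) =>
      W z * normalForm (List.ofFn z.1) (List.ofFn z.2) Φ Ψ := by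
  obtain ⟨C, hC, h⟩ := exists_normalForm_ofFn_bound r s Φ Ψ
  exact W.integrable.mul_bdd (continuous_normalForm_ofFn Φ Ψ).aestronglyMeasurable
    (.of_forall h)

/-- The quadratic form of a Wick monomial. -/
theorem waveInner_wickOp (Φ Ψ : SchwartzFock) :
    waveInner (wave Φ) (wave (wickOp W Ψ)) = wickForm (fun p q => W (p, q)) Φ Ψ := by
  have hG : Tame (fun z : (Fin r → Mom) × (Fin s → Mom) => (∏ i, wt (z.1 i)) * ∏ i, wt (z.2 i))
      fun z => W z • (List.ofFn z.2).foldr destroy (wave Ψ) := by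
    have h := tame_destroys (T := (Fin r → Mom) × (Fin s → Mom))
      (f := fun (i : Fin s) z => z.2 i) (fun i => by fun_prop) (List.finRange s) Ψ
    simp only [← ofFn_eq_map] at h
    refine (h.smul W.continuous (exists_kernel_bound W)).mono fun z => ?_
    exact mul_le_of_le_one_right (mul_nonneg (prod_wt_nonneg _ _) (prod_wt_nonneg _ _))
      (list_prod_wt_mem _ _).2
  have hF : Tame (fun p : Fin r → Mom => ∏ i, wt (p i)) fun p => waveInt fun q : Fin s → Mom =>
      W (p, q) • (List.ofFn q).foldr destroy (wave Ψ) :=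
    Tame.waveInt (b := fun p : Fin r → Mom => ∏ i, wt (p i))
      (c := fun q : Fin s → Mom => ∏ i, wt (q i))
      (F := fun z => W z • (List.ofFn z.2).foldr destroy (wave Ψ)) hG
      (integrable_prod_wt (Fin s)) (fun q => prod_wt_nonneg _ _)
      (fun p => ⟨prod_wt_nonneg _ _, prod_wt_le_one _ _⟩)
  rw [wave_wickOp, wickWave, waveInner_iterCre r (tameWave_wave Φ) (waveSymm_wave Φ) hF, wickForm,
    Measure.volume_eq_prod, integral_prod _ (integrable_wickForm W Φ Ψ)]
  refine integral_congr_ae (.of_forall fun p => ?_)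
  beta_reduce
  have hGp : Tame (fun q : Fin s → Mom => ∏ i, wt (q i)) fun q =>
      W (p, q) • (List.ofFn q).foldr destroy (wave Ψ) := by
    have hc : Continuous fun q : Fin s → Mom => (p, q) := by fun_prop
    exact (hG.comp hc).mono fun q =>
      mul_le_of_le_one_left (prod_wt_nonneg _ _) (prod_wt_le_one _ _)
  have h1 := waveInner_waveInt ((tameWave_wave Φ).foldl (List.ofFn p)) hGp (integrable_prod_wt _)
  refine h1.trans ?_
  exact integral_congr_ae (.of_forall fun q => waveInner_smul _ _ _)

theorem inner_wickOp (Φ Ψ : SchwartzFock) :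
    ⟪toFock Φ, toFock (wickOp W Ψ)⟫_ℂ = wickForm (fun p q => W (p, q)) Φ Ψ := by
  rw [inner_toFock, waveInner_wickOp]

/-- The kernel of the adjoint of a Wick monomial. -/
theorem exists_adjoint_kernel : ∃ W' : 𝓢((Fin s → Mom) × (Fin r → Mom), ℂ),
    ∀ p q, W' (q, p) = conj (W (p, q)) := by
  obtain ⟨W', h⟩ := (isSchwartz_coe W).star.comp_injective
    (LinearEquiv.prodComm ℝ (Fin s → Mom) (Fin r → Mom)).toLinearMap
    (LinearEquiv.injective _)
  exact ⟨W', fun p q => h (q, p)⟩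

/-- The Wick monomial with the conjugate kernel is an adjoint. -/
theorem exists_adjoint_wickOp : ∃ B, IsAdjointOn (wickOp W) B := by
  obtain ⟨W', hW'⟩ := exists_adjoint_kernel W
  refine ⟨wickOp W', fun Φ Ψ => ?_⟩
  rw [← inner_conj_symm, inner_wickOp, inner_wickOp, wickForm, wickForm, ← integral_conj]
  have hsw : MeasurePreserving (MeasurableEquiv.prodComm :
      (Fin r → Mom) × (Fin s → Mom) ≃ᵐ (Fin s → Mom) × (Fin r → Mom)) volume volume :=
    Measure.measurePreserving_swap
  rw [← hsw.integral_comp']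
  refine integral_congr_ae (.of_forall fun z => ?_)
  change conj (W' (z.2, z.1) * normalForm (List.ofFn z.2) (List.ofFn z.1) Ψ Φ) = _
  rw [map_mul, conj_normalForm, hW', Complex.conj_conj]

end WickOp

theorem exists_adjoint_sum {ι : Type*} (s : Finset ι) {A : ι → Module.End ℂ SchwartzFock}
    (h : ∀ i ∈ s, ∃ B, IsAdjointOn (A i) B) : ∃ B, IsAdjointOn (∑ i ∈ s, A i) B := by
  classical
  choose! B hB using h
  refine ⟨∑ i ∈ s, B i, fun Φ Ψ => ?_⟩
  simp only [LinearMap.sum_apply, map_sum, sum_inner, inner_sum]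
  exact Finset.sum_congr rfl fun i hi => hB i hi Φ Ψ

/-! ### Normal ordering of words of creation and destruction letters -/

/-!
Letters act on families of wave functions indexed by assignments of momenta to variables in `X`. The
momentum of a creation letter is integrated over by the letter itself, as smeared creation leaves no
singularity. That of a destruction letter stays free, to be integrated over at the end, so that a
commutator is a substitution of variables instead of a delta function.
-/

section Letters

variable {X : Type} [DecidableEq X]

/-- The creation letter `∫ dp_y a†(p_y)`, consuming the momentum variable `y`. -/
def creL (y : X) (F : (X → Mom) → Wave) : (X → Mom) → Wave :=
  fun z => cre fun p => F (Function.update z y p)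

/-- The destruction letter `a(p_x)`, keeping the momentum variable `x`. -/
def desL (x : X) (F : (X → Mom) → Wave) : (X → Mom) → Wave :=
  fun z => destroy (z x) (F z)

/-- The contraction `δ(p_x - p_y)`, replacing the momentum variable `y` by `x`. -/
def conL (x y : X) (F : (X → Mom) → Wave) : (X → Mom) → Wave :=
  fun z => F (Function.update z y (z x))

/-- Integration over the momentum variable `x`. -/
def intL (x : X) (F : (X → Mom) → Wave) : (X → Mom) → Wave :=
  fun z => waveInt fun p => F (Function.update z x p)

theorem creL_add (y : X) (F G : (X → Mom) → Wave) : creL y (F + G) = creL y F + creL y G :=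
  funext fun _ => cre_add _ _

theorem creL_zero (y : X) : creL y (0 : (X → Mom) → Wave) = 0 := funext fun _ => cre_zero

omit [DecidableEq X] in
theorem desL_add (x : X) (F G : (X → Mom) → Wave) : desL x (F + G) = desL x F + desL x G :=
  funext fun _ => destroy_add _ _ _

omit [DecidableEq X] in
theorem desL_zero (x : X) : desL x (0 : (X → Mom) → Wave) = 0 := by
  funext z l q
  simp [desL, destroy]

/-- The commutation relation for letters. -/
theorem desL_creL {x y : X} (h : x ≠ y) (F : (X → Mom) → Wave) :
    desL x (creL y F) = creL y (desL x F) + conL x y F := by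
  funext z
  change destroy (z x) (cre fun p => F (Function.update z y p)) = _
  rw [destroy_cre]
  simp only [creL, desL, conL, Pi.add_apply, Function.update_of_ne h]

theorem conL_creL {x y y' : X} (h : y' ≠ x) (h' : y' ≠ y) (F : (X → Mom) → Wave) :
    conL x y (creL y' F) = creL y' (conL x y F) := by
  funext z
  simp only [conL, creL, Function.update_of_ne h.symm]
  congr! 2 with p
  rw [Function.update_comm h']

theorem conL_desL {x y x' : X} (h : x' ≠ y) (F : (X → Mom) → Wave) :
    conL x y (desL x' F) = desL x' (conL x y F) := by
  funext z
  simp only [conL, desL, Function.update_of_ne h]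

/-- A destruction letter is moved to the right of creation letters at the cost of one contraction
with each of them. -/
theorem desL_foldr_creL {x : X} (P : List X) (hP : P.Nodup) (hx : x ∉ P)
    (G : (X → Mom) → Wave) :
    desL x (P.foldr creL G) = P.foldr creL (desL x G) +
      (P.map fun y => (P.erase y).foldr creL (conL x y G)).sum := by
  induction P with
  | nil => simp
  | cons y P ih =>
    rw [List.nodup_cons] at hP
    rw [List.mem_cons, not_or] at hx
    have hcon : conL x y (P.foldr creL G) = P.foldr creL (conL x y G) := by
      have : ∀ P' : List X, x ∉ P' → y ∉ P' →
          conL x y (P'.foldr creL G) = P'.foldr creL (conL x y G) := by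
        intro P' h1 h2
        induction P' with
        | nil => rfl
        | cons y' P' ih' =>
          rw [List.mem_cons, not_or] at h1 h2
          rw [List.foldr_cons, conL_creL (Ne.symm h1.1) (Ne.symm h2.1), ih' h1.2 h2.2]
          rfl
      exact this P hx.2 hP.1
    have hsum : creL y ((P.map fun y' => (P.erase y').foldr creL (conL x y' G)).sum) =
        (P.map fun y' => ((y :: P).erase y').foldr creL (conL x y' G)).sum := by
      have : ∀ P' : List X, (∀ y' ∈ P', y' ∈ P) →
          creL y ((P'.map fun y' => (P.erase y').foldr creL (conL x y' G)).sum) =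
            (P'.map fun y' => ((y :: P).erase y').foldr creL (conL x y' G)).sum := by
        intro P' h
        induction P' with
        | nil => simpa using creL_zero y
        | cons y' P' ih' =>
          have hne : y ≠ y' := fun e => hP.1 (e ▸ h y' (by simp))
          rw [List.map_cons, List.sum_cons, creL_add, ih' fun a ha => h a (by simp [ha]),
            List.map_cons, List.sum_cons, List.erase_cons_tail (by simpa using hne)]
          rfl
      exact this P fun _ h => h
    rw [List.foldr_cons, desL_creL hx.1, ih hP.2 hx.2, creL_add, hcon, hsum]
    simp only [List.map_cons, List.sum_cons, List.erase_cons_head, List.foldr_cons]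
    abel

theorem conL_foldr_desL {x y : X} (Q : List X) (hy : y ∉ Q) (G : (X → Mom) → Wave) :
    conL x y (Q.foldr desL G) = Q.foldr desL (conL x y G) := by
  induction Q with
  | nil => rfl
  | cons x' Q ih =>
    rw [List.mem_cons, not_or] at hy
    rw [List.foldr_cons, conL_desL (Ne.symm hy.1), ih hy.2]
    rfl

/-- A normally ordered expression: free creation letters, free destruction letters, and the
contracted pairs (destruction letter, creation letter). -/
abbrev Contraction (X : Type) : Type := List X × List X × List (X × X)

/-- The family of wave functions described by a normally ordered expression. -/
def normalWord (t : Contraction X) (F : (X → Mom) → Wave) : (X → Mom) → Wave :=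
  t.1.foldr creL (t.2.1.foldr desL (t.2.2.foldr (fun c => conL c.1 c.2) F))

variable (cr : X → Prop) [DecidablePred cr]

/-- A word of creation letters (`cr x`) and destruction letters (`¬ cr x`), acting on `F`. -/
def word (w : List X) (F : (X → Mom) → Wave) : (X → Mom) → Wave :=
  w.foldr (fun x G => if cr x then creL x G else desL x G) F

/-- The normally ordered expressions arising from a normally ordered one by multiplication from the
left with the letter `x`. -/
def contractHead (x : X) (t : Contraction X) : List (Contraction X) :=
  if cr x then [(x :: t.1, t.2.1, t.2.2)]
  else (t.1, x :: t.2.1, t.2.2) :: t.1.map fun y => (t.1.erase y, t.2.1, (x, y) :: t.2.2)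

/-- The normally ordered expressions in the Wick expansion of a word. -/
def contractions : List X → List (Contraction X)
  | [] => [([], [], [])]
  | x :: w => (contractions w).flatMap (contractHead cr x)

/-- The properties of the contraction schemes occurring in the Wick expansion of the word `w`; `R`
is any relation satisfied by each destruction letter and the creation letters to its right. -/
structure IsContraction (R : X → X → Prop) (w : List X) (t : Contraction X) : Prop where
  perm : (t.1 ++ t.2.1 ++ t.2.2.map Prod.fst ++ t.2.2.map Prod.snd).Perm w
  creation : ∀ x ∈ t.1, cr x
  destruction : ∀ x ∈ t.2.1, ¬ cr x
  pair_fst : ∀ c ∈ t.2.2, ¬ cr c.1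
  pair_snd : ∀ c ∈ t.2.2, cr c.2
  rel : ∀ c ∈ t.2.2, R c.1 c.2

theorem isContraction_of_mem {R : X → X → Prop} : ∀ (w : List X),
    w.Pairwise (fun x y => ¬ cr x → cr y → R x y) →
    ∀ t ∈ contractions cr w, IsContraction cr R w t := by
  intro w
  induction w with
  | nil =>
    intro _ t ht
    obtain rfl : t = ([], [], []) := by simpa [contractions] using ht
    exact ⟨by simp, by simp, by simp, by simp, by simp, by simp⟩
  | cons x w ih =>
    intro hw t ht
    rw [List.pairwise_cons] at hw
    obtain ⟨t', ht', h⟩ := List.mem_flatMap.1 ht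
    have i := ih hw.2 t' ht'
    obtain ⟨P, Q, C⟩ := t'
    rw [contractHead] at h
    split_ifs at h with hx
    · obtain rfl : t = (x :: P, Q, C) := by simpa using h
      exact ⟨by simpa using i.perm, by simpa [hx] using i.creation, i.destruction, i.pair_fst,
        i.pair_snd, i.rel⟩
    · rw [List.mem_cons] at h
      rcases h with rfl | h
      · refine ⟨?_, i.creation, by simpa [hx] using i.destruction, i.pair_fst, i.pair_snd, i.rel⟩
        have := i.perm.cons x
        refine List.Perm.trans ?_ this
        simp only [List.append_assoc, List.cons_append]
        exact List.perm_middle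
      · obtain ⟨y, hy, rfl⟩ := List.mem_map.1 h
        have hyw : y ∈ w := i.perm.subset (by simp [hy])
        refine ⟨?_, fun a ha => i.creation a (List.mem_of_mem_erase ha), i.destruction,
          by simpa [hx] using i.pair_fst, by simpa [i.creation y hy] using i.pair_snd, ?_⟩
        · refine List.Perm.trans ?_ (i.perm.cons x)
          have h1 := List.perm_cons_erase hy
          rw [List.perm_iff_count]
          intro a
          have h2 := h1.count_eq a
          simp only [List.count_append, List.map_cons, List.count_cons] at h2 ⊢
          omega
        · intro c hc
          rcases List.mem_cons.1 hc with rfl | hc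
          · exact hw.1 y hyw hx (i.creation y hy)
          · exact i.rel c hc

omit [DecidableEq X] [DecidablePred cr] in
theorem IsContraction.nodup {R : X → X → Prop} {w : List X} {t : Contraction X}
    (h : IsContraction cr R w t) (hw : w.Nodup) :
    (t.1 ++ t.2.1 ++ t.2.2.map Prod.fst ++ t.2.2.map Prod.snd).Nodup :=
  h.perm.nodup_iff.2 hw

theorem map_list_sum_eq {A : Type*} [AddMonoid A] {f : A → A} (h0 : f 0 = 0)
    (hadd : ∀ a b, f (a + b) = f a + f b) (L : List A) : f L.sum = (L.map f).sum := by
  induction L with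
  | nil => simpa using h0
  | cons a L ih => simp [hadd, ih]

theorem list_sum_flatMap {ι A : Type*} [AddMonoid A] (L : List ι) (f : ι → List A) :
    (L.flatMap f).sum = (L.map fun a => (f a).sum).sum := by
  induction L with
  | nil => rfl
  | cons a L ih => simp [ih]

/-- Wick's theorem for words of letters. -/
theorem word_eq_sum (F : (X → Mom) → Wave) : ∀ (w : List X), w.Nodup →
    word cr w F = ((contractions cr w).map fun t => normalWord t F).sum := by
  intro w
  induction w with
  | nil => intro _; simp [word, contractions, normalWord]
  | cons x w ih =>
    intro hw
    rw [List.nodup_cons] at hw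
    have i := isContraction_of_mem cr (R := fun _ _ => True) w
      (List.pairwise_of_forall (by simp))
    have step : ∀ t ∈ contractions cr w,
        (if cr x then creL x (normalWord t F) else desL x (normalWord t F)) =
          ((contractHead cr x t).map fun t => normalWord t F).sum := by
      intro t ht
      obtain ⟨P, Q, C⟩ := t
      have hn := (i _ ht).nodup cr hw.2
      have hp := (i _ ht).perm
      simp only at hn hp
      rw [contractHead]
      split_ifs with hx
      · simp [normalWord]
      · have hP : P.Nodup := by
          simp only [List.append_assoc] at hn
          exact (List.nodup_append.1 hn).1
        have hxP : x ∉ P := fun h => hw.1 (hp.subset (by simp [h]))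
        simp only [normalWord, List.map_cons, List.sum_cons, List.map_map]
        rw [desL_foldr_creL P hP hxP]
        congr 2
        refine List.map_congr_left fun y hy => ?_
        have hyQ : y ∉ Q := by
          simp only [List.append_assoc] at hn
          exact fun h => (List.nodup_append.1 hn).2.2 y hy y (by simp [h]) rfl
        rw [conL_foldr_desL Q hyQ]
        rfl
    have h1 : word cr (x :: w) F =
        if cr x then creL x (word cr w F) else desL x (word cr w F) := rfl
    rw [h1, ih hw.2, contractions, List.map_flatMap, list_sum_flatMap]
    rw [← List.map_congr_left step]
    split_ifs
    · rw [map_list_sum_eq (creL_zero x) (creL_add x), List.map_map]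
      rfl
    · rw [map_list_sum_eq (desL_zero x) (desL_add x), List.map_map]
      rfl

end Letters

/-! ### Integrating out the momentum variables of a normally ordered word -/

section Integrate

variable {X : Type} [DecidableEq X]

/-- The product weight in the momentum variables of the finite set `A`. -/
def wtOn (A : Finset X) (z : X → Mom) : ℝ := ∏ x ∈ A, wt (z x)

omit [DecidableEq X] in
theorem wtOn_mem (A : Finset X) (z : X → Mom) : 0 ≤ wtOn A z ∧ wtOn A z ≤ 1 :=
  ⟨prod_wt_nonneg _ _, prod_wt_le_one _ _⟩

theorem wtOn_anti {A B : Finset X} (h : B ⊆ A) (z : X → Mom) : wtOn A z ≤ wtOn B z := by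
  rw [wtOn, ← Finset.sdiff_union_of_subset h, Finset.prod_union Finset.sdiff_disjoint]
  exact mul_le_of_le_one_left (prod_wt_nonneg _ _) (prod_wt_le_one _ _)

theorem wtOn_update {A : Finset X} {x : X} (hx : x ∈ A) (z : X → Mom) (p : Mom) :
    wtOn A (Function.update z x p) = wtOn (A.erase x) z * wt p := by
  rw [wtOn, ← Finset.prod_erase_mul _ _ hx, Function.update_self]
  congr 1
  refine Finset.prod_congr rfl fun y hy => ?_
  rw [Function.update_of_ne (Finset.ne_of_mem_erase hy)]

theorem continuous_update_pair (x : X) :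
    Continuous fun z : (X → Mom) × Mom => Function.update z.1 x z.2 :=
  continuous_fst.update x continuous_snd

theorem Tame.update {A : Finset X} {F : (X → Mom) → Wave} (hF : Tame (wtOn A) F) {x : X}
    (hx : x ∈ A) : Tame (fun z : (X → Mom) × Mom => wtOn (A.erase x) z.1 * wt z.2)
      fun z => F (Function.update z.1 x z.2) :=
  (hF.comp (continuous_update_pair x)).mono fun z => (wtOn_update hx z.1 z.2).le

theorem Tame.anti {A B : Finset X} {F : (X → Mom) → Wave} (hF : Tame (wtOn A) F) (h : B ⊆ A) :
    Tame (wtOn B) F := hF.mono (wtOn_anti h)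

theorem Tame.creL {A : Finset X} {F : (X → Mom) → Wave} (hF : Tame (wtOn A) F) {y : X}
    (hy : y ∈ A) : Tame (wtOn (A.erase y)) (creL y F) :=
  (hF.update hy).cre

theorem Tame.intL [Countable X] {A : Finset X} {F : (X → Mom) → Wave} (hF : Tame (wtOn A) F)
    {x : X} (hx : x ∈ A) : Tame (wtOn (A.erase x)) (intL x F) :=
  Tame.waveInt (hF.update hx) integrable_wt (fun q => (wt_pos q).le) (wtOn_mem _)

omit [DecidableEq X] in
theorem Tame.desL {A : Finset X} {F : (X → Mom) → Wave} (hF : Tame (wtOn A) F) (x : X) :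
    Tame (wtOn A) (desL x F) :=
  (hF.destroy (continuous_apply x)).mono fun z =>
    mul_le_of_le_one_right (wtOn_mem A z).1 (wt_le_one _)

theorem Tame.conL {A : Finset X} {F : (X → Mom) → Wave} (hF : Tame (wtOn A) F) (x y : X) :
    Tame (wtOn (A.erase y)) (conL x y F) := by
  have hc : Continuous fun z : X → Mom => Function.update z y (z x) :=
    continuous_id.update y (continuous_apply x)
  refine ((hF.anti (Finset.erase_subset y A)).comp hc).mono fun z => le_of_eq ?_
  refine Finset.prod_congr rfl fun a ha => ?_
  rw [Function.update_of_ne (Finset.ne_of_mem_erase ha)]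

theorem Tame.integrable_update {A : Finset X} {F : (X → Mom) → Wave} (hF : Tame (wtOn A) F)
    {x : X} (hx : x ∈ A) (z : X → Mom) (l : ℕ) (k : Fin l → Mom) :
    Integrable fun p => F (Function.update z x p) l k :=
  Tame.integrable (hF.update hx) integrable_wt z l k

omit [DecidableEq X] in
theorem Tame.foldr_desL {A : Finset X} {F : (X → Mom) → Wave} (hF : Tame (wtOn A) F)
    (Q : List X) : Tame (wtOn A) (Q.foldr QSTDyson.desL F) := by
  induction Q with
  | nil => exact hF
  | cons x Q ih => exact ih.desL x

theorem Tame.foldr_creL {A : Finset X} {F : (X → Mom) → Wave} (hF : Tame (wtOn A) F)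
    (P : List X) (hP : P.Nodup) (hA : ∀ x ∈ P, x ∈ A) :
    Tame (wtOn (A \ P.toFinset)) (P.foldr QSTDyson.creL F) := by
  induction P with
  | nil => simpa using hF
  | cons y P ih =>
    rw [List.nodup_cons] at hP
    have h1 := (ih hP.2 fun x hx => hA x (by simp [hx])).creL (y := y)
      (by simp [hP.1, hA y (by simp)])
    refine h1.anti fun a ha => ?_
    simp only [List.toFinset_cons, Finset.mem_sdiff, Finset.mem_insert, Finset.mem_erase] at ha ⊢
    tauto

theorem Tame.foldr_intL [Countable X] {A : Finset X} {F : (X → Mom) → Wave}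
    (hF : Tame (wtOn A) F) (D : List X) (hD : D.Nodup) (hA : ∀ x ∈ D, x ∈ A) :
    Tame (wtOn (A \ D.toFinset)) (D.foldr QSTDyson.intL F) := by
  induction D with
  | nil => simpa using hF
  | cons y D ih =>
    rw [List.nodup_cons] at hD
    have h1 := (ih hD.2 fun x hx => hA x (by simp [hx])).intL (x := y)
      (by simp [hD.1, hA y (by simp)])
    refine h1.anti fun a ha => ?_
    simp only [List.toFinset_cons, Finset.mem_sdiff, Finset.mem_insert, Finset.mem_erase] at ha ⊢
    tauto

/-- Integration over the momentum of one letter commutes with the creation letter of another one.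
The integral is interchanged with a finite sum only, but this needs integrability of each
summand. -/
theorem intL_creL {A : Finset X} {F : (X → Mom) → Wave} (hF : Tame (wtOn A) F) {x y : X}
    (hx : x ∈ A) (hxy : x ≠ y) : intL x (creL y F) = creL y (intL x F) := by
  funext z
  simp only [intL, creL]
  rw [cre_waveInt _ fun p l k => hF.integrable_update hx _ l k]
  simp only [Function.update_comm hxy]

theorem intL_desL {x y : X} (hxy : x ≠ y) (F : (X → Mom) → Wave) :
    intL x (desL y F) = desL y (intL x F) := by
  funext z
  simp only [intL, desL, destroy_waveInt, Function.update_of_ne hxy.symm]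

theorem intL_foldr_creL {A : Finset X} {F : (X → Mom) → Wave} (hF : Tame (wtOn A) F) {x : X}
    (hx : x ∈ A) (P : List X) (hP : P.Nodup) (hA : ∀ y ∈ P, y ∈ A) (hxP : x ∉ P) :
    intL x (P.foldr creL F) = P.foldr creL (intL x F) := by
  induction P with
  | nil => rfl
  | cons y P ih =>
    rw [List.nodup_cons] at hP
    rw [List.mem_cons, not_or] at hxP
    rw [List.foldr_cons, intL_creL (hF.foldr_creL P hP.2 fun a ha => hA a (by simp [ha]))
      (by simp [hx, hxP.2]) hxP.1, ih hP.2 (fun a ha => hA a (by simp [ha])) hxP.2]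
    rfl

theorem foldr_intL_foldr_creL [Countable X] {A : Finset X} {F : (X → Mom) → Wave}
    (hF : Tame (wtOn A) F) (D P : List X) (hDP : (D ++ P).Nodup) (hA : ∀ y ∈ D ++ P, y ∈ A) :
    D.foldr intL (P.foldr creL F) = P.foldr creL (D.foldr intL F) := by
  induction D with
  | nil => rfl
  | cons x D ih =>
    rw [List.cons_append, List.nodup_cons, List.mem_append, not_or] at hDP
    obtain ⟨h1, h2, h3⟩ := List.nodup_append.1 hDP.2
    have ht := hF.foldr_intL D h1 fun a ha => hA a (by simp [ha])
    rw [List.foldr_cons, ih hDP.2 fun a ha => hA a (by simp at ha ⊢; tauto),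
      intL_foldr_creL ht (by simp [hDP.1.1, hA x (by simp)]) P h2 (fun a ha => ?_) hDP.1.2]
    · rfl
    · simp only [Finset.mem_sdiff, List.mem_toFinset]
      exact ⟨hA a (by simp [ha]), fun h => h3 a h a ha rfl⟩

theorem foldr_intL_foldr_desL (F : (X → Mom) → Wave) (D Q : List X)
    (hDQ : ∀ x ∈ D, x ∉ Q) : D.foldr intL (Q.foldr desL F) = Q.foldr desL (D.foldr intL F) := by
  have h1 : ∀ (x : X) (Q : List X) (G : (X → Mom) → Wave), x ∉ Q →
      intL x (Q.foldr desL G) = Q.foldr desL (intL x G) := by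
    intro x Q G hx
    induction Q with
    | nil => rfl
    | cons y Q ih =>
      rw [List.mem_cons, not_or] at hx
      rw [List.foldr_cons, intL_desL hx.1, ih hx.2]
      rfl
  induction D with
  | nil => rfl
  | cons x D ih =>
    rw [List.foldr_cons, ih fun a ha => hDQ a (by simp [ha]), h1 x Q _ (hDQ x (by simp))]
    rfl

theorem intL_comm {A : Finset X} {F : (X → Mom) → Wave} (hF : Tame (wtOn A) F) {x y : X}
    (hx : x ∈ A) (hy : y ∈ A) (hxy : x ≠ y) : intL x (intL y F) = intL y (intL x F) := by
  funext z l k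
  simp only [intL, waveInt]
  have hT : Tame (fun w : Mom × Mom => wt w.1 * wt w.2) fun w =>
      F (Function.update (Function.update z x w.1) y w.2) := by
    have hc : Continuous fun w : Mom × Mom => Function.update (Function.update z x w.1) y w.2 :=
      ((continuous_const : Continuous fun _ : Mom × Mom => z).update x continuous_fst).update y
        continuous_snd
    refine (hF.comp hc).mono fun w => ?_
    rw [wtOn_update hy, wtOn_update (Finset.mem_erase.2 ⟨hxy, hx⟩)]
    have h1 := (wtOn_mem ((A.erase y).erase x) z).2
    have h2 := (wt_pos w.1).le
    have h3 := (wt_pos w.2).le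
    rw [mul_assoc]
    exact mul_le_of_le_one_left (by positivity) h1
  obtain ⟨C, hC, h⟩ := hT.bound l
  rw [integral_integral_swap]
  · simp only [Function.update_comm hxy]
  · refine ((integrable_wt.mul_prod integrable_wt).const_mul (C * ∏ i, wt (k i))).mono'
      ((hT.cont l).comp (continuous_id.prodMk continuous_const)).aestronglyMeasurable
      (.of_forall fun w => (h w k).trans (le_of_eq (by ring)))

theorem foldr_intL_perm [Countable X] {A : Finset X} {F : (X → Mom) → Wave}
    (hF : Tame (wtOn A) F) {D D' : List X} (h : D.Perm D') :
    D.Nodup → (∀ x ∈ D, x ∈ A) → D.foldr intL F = D'.foldr intL F := by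
  induction h with
  | nil => intros; rfl
  | cons x h ih =>
    intro hn hA
    rw [List.foldr_cons, ih (List.nodup_cons.1 hn).2 fun a ha => hA a (by simp [ha])]
    rfl
  | swap x y D =>
    intro hn hA
    simp only [List.nodup_cons, List.mem_cons, not_or] at hn
    refine intL_comm (hF.foldr_intL D hn.2.2 fun a ha => hA a (by simp [ha])) ?_ ?_ hn.1.1
    · simp [hn.1.2, hA y (by simp)]
    · simp [hn.2.1, hA x (by simp)]
  | trans h1 _ ih1 ih2 =>
    intro hn hA
    rw [ih1 hn hA, ih2 (h1.nodup_iff.1 hn) fun a ha => hA a (h1.mem_iff.2 ha)]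

theorem Tame.add {T : Type*} [TopologicalSpace T] {b : T → ℝ} {F G : T → Wave} (hF : Tame b F)
    (hG : Tame b G) : Tame b (F + G) where
  bounded := by
    obtain ⟨L, h⟩ := hF.bounded
    obtain ⟨L', h'⟩ := hG.bounded
    refine ⟨max L L', fun l hl t => ?_⟩
    simp [h l (le_trans (le_max_left _ _) hl), h' l (le_trans (le_max_right _ _) hl)]
  cont l := (hF.cont l).add (hG.cont l)
  bound l := by
    obtain ⟨C, hC, h⟩ := hF.bound l
    obtain ⟨C', hC', h'⟩ := hG.bound l
    refine ⟨C + C', by positivity, fun t k => (norm_add_le _ _).trans ?_⟩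
    rw [add_mul]
    exact add_le_add (h t k) (h' t k)

theorem Tame.zero {T : Type*} [TopologicalSpace T] (b : T → ℝ) : Tame b (0 : T → Wave) where
  bounded := ⟨0, fun _ _ _ => rfl⟩
  cont _ := continuous_const
  bound _ := ⟨0, le_rfl, fun _ _ => by simp⟩

theorem foldr_intL_add [Countable X] {A : Finset X} {F G : (X → Mom) → Wave}
    (hF : Tame (wtOn A) F) (hG : Tame (wtOn A) G) (D : List X) (hD : D.Nodup)
    (hA : ∀ x ∈ D, x ∈ A) : D.foldr intL (F + G) = D.foldr intL F + D.foldr intL G := by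
  induction D with
  | nil => rfl
  | cons x D ih =>
    rw [List.nodup_cons] at hD
    have hA' : ∀ a ∈ D, a ∈ A := fun a ha => hA a (by simp [ha])
    have hx : x ∈ A \ D.toFinset := by simp [hD.1, hA x (by simp)]
    rw [List.foldr_cons, ih hD.2 hA']
    funext z
    exact waveInt_add ((hF.foldr_intL D hD.2 hA').integrable_update hx z)
      ((hG.foldr_intL D hD.2 hA').integrable_update hx z)

theorem foldr_intL_list_sum [Countable X] {ι : Type*} {A : Finset X} (ts : List ι)
    {F : ι → (X → Mom) → Wave} (hF : ∀ t ∈ ts, Tame (wtOn A) (F t)) (D : List X) (hD : D.Nodup)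
    (hA : ∀ x ∈ D, x ∈ A) :
    D.foldr intL (ts.map F).sum = (ts.map fun t => D.foldr intL (F t)).sum := by
  have hs : ∀ ts : List ι, (∀ t ∈ ts, Tame (wtOn A) (F t)) → Tame (wtOn A) (ts.map F).sum := by
    intro ts h
    induction ts with
    | nil => exact Tame.zero _
    | cons t ts ih =>
      rw [List.map_cons, List.sum_cons]
      exact (h t (by simp)).add (ih fun a ha => h a (by simp [ha]))
  induction ts with
  | nil =>
    clear hD hA hF
    induction D with
    | nil => rfl
    | cons x D ih =>
      simp only [List.map_nil, List.sum_nil] at ih ⊢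
      rw [List.foldr_cons, ih]
      funext z l k
      simp [intL, waveInt]
  | cons t ts ih =>
    rw [List.map_cons, List.sum_cons, foldr_intL_add (hF t (by simp))
      (hs ts fun a ha => hF a (by simp [ha])) D hD hA, ih fun a ha => hF a (by simp [ha])]
    rfl

end Integrate

/-! ### From words of letters to Wick monomials -/

section Assign

variable {X : Type} [DecidableEq X]

/-- The momentum assignment `z` with the variables in the list `P` replaced by `p`. -/
def upd (z : X → Mom) : ∀ P : List X, (Fin P.length → Mom) → X → Mom
  | [], _ => z
  | y :: P, p => upd (Function.update z y (p 0)) P fun i => p i.succ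

theorem upd_of_notMem {x : X} : ∀ (P : List X) (z : X → Mom) (p : Fin P.length → Mom),
    x ∉ P → upd z P p x = z x := by
  intro P
  induction P with
  | nil => intro z p _; rfl
  | cons y P ih =>
    intro z p hx
    rw [List.mem_cons, not_or] at hx
    rw [upd, ih _ _ hx.2, Function.update_of_ne hx.1]

theorem upd_get : ∀ (P : List X) (z : X → Mom) (p : Fin P.length → Mom), P.Nodup →
    ∀ i, upd z P p (P.get i) = p i := by
  intro P
  induction P with
  | nil => intro z p _ i; exact i.elim0
  | cons y P ih =>
    intro z p hP i
    rw [List.nodup_cons] at hP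
    refine Fin.cases ?_ (fun i => ?_) i
    · rw [upd, List.get_cons_zero, upd_of_notMem P _ _ hP.1, Function.update_self]
    · rw [upd]
      exact ih _ _ hP.2 i

theorem continuous_upd_pair : ∀ P : List X,
    Continuous fun w : (X → Mom) × (Fin P.length → Mom) => upd w.1 P w.2 := by
  intro P
  induction P with
  | nil => exact continuous_fst
  | cons y P ih =>
    have h1 : Continuous fun w : (X → Mom) × (Fin (P.length + 1) → Mom) =>
        Function.update w.1 y (w.2 0) :=
      continuous_fst.update y ((continuous_apply 0).comp continuous_snd)
    have h2 : Continuous fun w : (X → Mom) × (Fin (P.length + 1) → Mom) =>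
        fun i : Fin P.length => w.2 i.succ := by fun_prop
    exact ih.comp (h1.prodMk h2)

theorem continuous_upd (P : List X) (z : X → Mom) :
    Continuous fun p : Fin P.length → Mom => upd z P p :=
  (continuous_upd_pair P).comp (continuous_const.prodMk continuous_id)

theorem wtOn_upd (A : Finset X) : ∀ (D : List X) (z : X → Mom) (d : Fin D.length → Mom),
    D.Nodup → (∀ x ∈ D, x ∈ A) → wtOn A (upd z D d) ≤ ∏ i, wt (d i) := by
  intro D z d hD hA
  refine (wtOn_anti (B := D.toFinset) (fun x hx => hA x (by simpa using hx)) _).trans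
    (le_of_eq ?_)
  rw [wtOn, List.prod_toFinset _ hD, ← Fin.prod_univ_fun_getElem]
  exact Finset.prod_congr rfl fun i _ => congrArg wt (upd_get D z d hD i)

/-- A product of creation letters is an iterated smeared creation operator. -/
theorem foldr_creL_apply (G : (X → Mom) → Wave) : ∀ (P : List X) (z : X → Mom),
    P.foldr creL G z = iterCre P.length fun p => G (upd z P p) := by
  intro P
  induction P with
  | nil => intro z; rfl
  | cons y P ih =>
    intro z
    rw [List.foldr_cons, creL]
    simp only [ih]
    rfl

omit [DecidableEq X] in
theorem foldr_desL_apply (G : (X → Mom) → Wave) (Q : List X) (z : X → Mom) :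
    Q.foldr desL G z = (Q.map z).foldr destroy (G z) := by
  induction Q with
  | nil => rfl
  | cons x Q ih => rw [List.foldr_cons, desL, ih]; rfl

theorem Tame.upd {A : Finset X} {G : (X → Mom) → Wave} (hG : Tame (wtOn A) G) (D : List X)
    (hD : D.Nodup) (hA : ∀ x ∈ D, x ∈ A) (z : X → Mom) :
    Tame (fun d : Fin D.length → Mom => ∏ i, wt (d i)) fun d => G (upd z D d) :=
  (hG.comp (continuous_upd D z)).mono fun d => wtOn_upd A D z d hD hA

/-- Successive integration over several momentum variables is integration over all of them. -/
theorem foldr_intL_apply {A : Finset X} {G : (X → Mom) → Wave} (hG : Tame (wtOn A) G) :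
    ∀ (D : List X) (z : X → Mom), D.Nodup → (∀ x ∈ D, x ∈ A) →
    D.foldr intL G z = waveInt fun d : Fin D.length → Mom => G (upd z D d) := by
  intro D
  induction D with
  | nil =>
    intro z _ _
    funext l k
    simp only [waveInt, List.foldr_nil, QSTDyson.upd]
    simp [Measure.real, volume_pi]
  | cons y D ih =>
    intro z hD hA
    have hi := hG.upd (y :: D) hD hA z
    rw [List.nodup_cons] at hD
    funext l k
    rw [List.foldr_cons, intL]
    simp only [ih _ hD.2 fun x hx => hA x (by simp [hx])]
    simp only [waveInt]
    have h1 : Integrable fun d : Fin (D.length + 1) → Mom => G (QSTDyson.upd z (y :: D) d) l k := by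
      obtain ⟨C, hC, h⟩ := hi.bound l
      refine ((integrable_prod_wt (Fin (D.length + 1))).const_mul (C * ∏ i, wt (k i))).mono'
        ((hi.cont l).comp (continuous_id.prodMk continuous_const)).aestronglyMeasurable
        (.of_forall fun w => (h w k).trans (le_of_eq ?_))
      simp only [List.length_cons]
      ring
    exact (integral_cons _ h1).symm

theorem waveInt_smul_const {α : Type*} [MeasureSpace α] (c : α → ℂ) (ψ : Wave) :
    (waveInt fun u => c u • ψ) = (∫ u, c u) • ψ := by
  funext l k
  simp [waveInt, integral_mul_const]

theorem map_upd (Q : List X) (hQ : Q.Nodup) (z : X → Mom) (q : Fin Q.length → Mom) :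
    Q.map (upd z Q q) = List.ofFn q := by
  refine List.ext_getElem (by simp) fun i h1 h2 => ?_
  rw [List.getElem_map, List.getElem_ofFn]
  exact upd_get Q z q hQ ⟨i, by simpa using h1⟩

/-- A normally ordered word with all its momentum variables integrated out is a Wick monomial. -/
theorem foldr_intL_normal [Countable X] {A : Finset X} {V : (X → Mom) → ℂ} {ψ : Wave}
    (hG : Tame (wtOn A) fun z => V z • ψ) (P Q U : List X) (hn : (P ++ Q ++ U).Nodup)
    (hA : ∀ x ∈ P ++ Q ++ U, x ∈ A) (z : X → Mom) :
    Q.foldr intL (U.foldr intL (P.foldr creL (Q.foldr desL fun z => V z • ψ))) z =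
      wickWave (fun p q => ∫ u, V (upd (upd (upd z P p) Q q) U u)) ψ := by
  obtain ⟨hPQ, hU, h3⟩ := List.nodup_append.1 hn
  obtain ⟨hP, hQ, h4⟩ := List.nodup_append.1 hPQ
  have hUA : ∀ x ∈ U, x ∈ A := fun x hx => hA x (by simp [hx])
  have hQA : ∀ x ∈ Q, x ∈ A := fun x hx => hA x (by simp [hx])
  have hPA : ∀ x ∈ P, x ∈ A := fun x hx => hA x (by simp [hx])
  have nUP : (U ++ P).Nodup :=
    List.nodup_append.2 ⟨hU, hP, fun a ha b hb e => h3 b (by simp [hb]) a ha e.symm⟩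
  have nQP : (Q ++ P).Nodup :=
    List.nodup_append.2 ⟨hQ, hP, fun a ha b hb e => h4 b hb a ha e.symm⟩
  have tU := hG.foldr_intL U hU hUA
  have hQU : ∀ x ∈ Q, x ∈ A \ U.toFinset := fun x hx => by
    simp only [Finset.mem_sdiff, List.mem_toFinset]
    exact ⟨hQA x hx, fun h => h3 x (by simp [hx]) x h rfl⟩
  have hPU : ∀ x ∈ P, x ∈ A \ U.toFinset := fun x hx => by
    simp only [Finset.mem_sdiff, List.mem_toFinset]
    exact ⟨hPA x hx, fun h => h3 x (by simp [hx]) x h rfl⟩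
  rw [foldr_intL_foldr_creL (hG.foldr_desL Q) U P nUP fun x hx => by
      rcases List.mem_append.1 hx with h | h
      exacts [hUA x h, hPA x h],
    foldr_intL_foldr_desL _ U Q fun x hx h => h3 x (by simp [h]) x hx rfl,
    foldr_intL_foldr_creL (tU.foldr_desL Q) Q P nQP fun x hx => by
      rcases List.mem_append.1 hx with h | h
      exacts [hQU x h, hPU x h],
    foldr_creL_apply]
  unfold wickWave
  congr 1
  funext p
  rw [foldr_intL_apply (tU.foldr_desL Q) Q _ hQ hQU]
  congr 1
  funext q
  rw [foldr_desL_apply, map_upd Q hQ, foldr_intL_apply hG U _ hU hUA, waveInt_smul_const,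
    foldr_destroy_smul]

/-- The momentum assignment in which each contracted creation variable carries the momentum of its
partner. -/
def subst : List (X × X) → (X → Mom) → X → Mom
  | [], z => z
  | c :: C, z => subst C (Function.update z c.2 (z c.1))

theorem foldr_conL_apply (F : (X → Mom) → Wave) : ∀ (C : List (X × X)) (z : X → Mom),
    C.foldr (fun c => conL c.1 c.2) F z = F (subst C z) := by
  intro C
  induction C with
  | nil => intro z; rfl
  | cons c C ih => intro z; rw [List.foldr_cons, conL, ih]; rfl

theorem subst_of_notMem {x : X} : ∀ (C : List (X × X)) (z : X → Mom),
    x ∉ C.map Prod.snd → subst C z x = z x := by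
  intro C
  induction C with
  | nil => intro z _; rfl
  | cons c C ih =>
    intro z hx
    rw [List.map_cons, List.mem_cons, not_or] at hx
    rw [subst, ih _ hx.2, Function.update_of_ne hx.1]

/-- In a contraction scheme all letters are distinct, so the substitutions do not interfere. -/
theorem subst_snd : ∀ (C : List (X × X)) (z : X → Mom),
    (C.map Prod.fst ++ C.map Prod.snd).Nodup → ∀ c ∈ C, subst C z c.2 = z c.1 := by
  intro C
  induction C with
  | nil => intro z _ c hc; simp at hc
  | cons c C ih =>
    intro z hn d hd
    obtain ⟨h1, h2, h3⟩ := List.nodup_append.1 hn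
    rw [List.map_cons, List.nodup_cons] at h1 h2
    rw [subst]
    rcases List.mem_cons.1 hd with rfl | hd
    · rw [subst_of_notMem C _ h2.1, Function.update_self]
    · rw [ih _ (List.nodup_append.2 ⟨h1.2, h2.2, fun a ha b hb => h3 a (by simp at ha ⊢; tauto) b
        (by simp at hb ⊢; tauto)⟩) d hd, Function.update_of_ne]
      exact h3 d.1 (List.mem_map_of_mem (List.mem_cons_of_mem _ hd)) c.2 (by simp)

theorem Tame.foldr_conL {A : Finset X} {F : (X → Mom) → Wave} (hF : Tame (wtOn A) F)
    (C : List (X × X)) : Tame (wtOn (A \ (C.map Prod.snd).toFinset))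
      (C.foldr (fun c => QSTDyson.conL c.1 c.2) F) := by
  induction C with
  | nil => simpa using hF
  | cons c C ih =>
    refine (ih.conL c.1 c.2).anti fun a ha => ?_
    simp only [List.map_cons, List.toFinset_cons, Finset.mem_sdiff, Finset.mem_insert,
      Finset.mem_erase] at ha ⊢
    tauto

theorem Tame.word {A : Finset X} {F : (X → Mom) → Wave} (hF : Tame (wtOn A) F)
    (cr : X → Prop) [DecidablePred cr] (w : List X) (hw : w.Nodup) (hA : ∀ x ∈ w, x ∈ A) :
    Tame (wtOn (A \ (w.filter cr).toFinset)) (word cr w F) := by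
  induction w with
  | nil => simpa [QSTDyson.word] using hF
  | cons x w ih =>
    rw [List.nodup_cons] at hw
    have h := ih hw.2 fun a ha => hA a (by simp [ha])
    have e : QSTDyson.word cr (x :: w) F = if cr x then QSTDyson.creL x (QSTDyson.word cr w F)
        else QSTDyson.desL x (QSTDyson.word cr w F) := rfl
    rw [e]
    split_ifs with hx
    · refine (h.creL (y := x) (by simp [hw.1, hA x (by simp)])).anti fun a ha => ?_
      simp only [List.filter_cons, hx, decide_true, if_true, List.toFinset_cons, Finset.mem_sdiff,
        Finset.mem_insert, Finset.mem_erase] at ha ⊢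
      tauto
    · simpa [List.filter_cons, hx] using h.desL x

theorem Tame.normalWord {A : Finset X} {F : (X → Mom) → Wave} (hF : Tame (wtOn A) F)
    (t : Contraction X) (ht : (t.1 ++ t.2.1 ++ t.2.2.map Prod.fst ++ t.2.2.map Prod.snd).Nodup)
    (hA : ∀ x ∈ t.1, x ∈ A) :
    Tame (wtOn ((A \ (t.2.2.map Prod.snd).toFinset) \ t.1.toFinset)) (normalWord t F) := by
  simp only [List.append_assoc] at ht
  obtain ⟨h1, -, h3⟩ := List.nodup_append.1 ht
  refine ((hF.foldr_conL t.2.2).foldr_desL t.2.1).foldr_creL t.1 h1 fun x hx => ?_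
  simp only [Finset.mem_sdiff, List.mem_toFinset]
  exact ⟨hA x hx, fun h => h3 x hx x (by simp [List.mem_append] at h ⊢; tauto) rfl⟩

end Assign

section Pullback

variable {X Y : Type} [DecidableEq X] [DecidableEq Y] {e : Y → X} (he : Function.Injective e)

include he

/-- Injective renaming of the momentum variables. -/
theorem foldr_creL_map (F : (Y → Mom) → Wave) (P : List Y) :
    (P.map e).foldr creL (fun z => F (z ∘ e)) = fun z => P.foldr creL F (z ∘ e) := by
  induction P with
  | nil => rfl
  | cons y P ih =>
    rw [List.map_cons, List.foldr_cons, ih]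
    funext z
    simp only [creL, List.foldr_cons, Function.update_comp_eq_of_injective z he]

omit [DecidableEq X] [DecidableEq Y] he in
theorem foldr_desL_map (F : (Y → Mom) → Wave) (Q : List Y) :
    (Q.map e).foldr desL (fun z => F (z ∘ e)) = fun z => Q.foldr desL F (z ∘ e) := by
  funext z
  rw [foldr_desL_apply, foldr_desL_apply, List.map_map]

theorem foldr_intL_map (F : (Y → Mom) → Wave) (P : List Y) :
    (P.map e).foldr intL (fun z => F (z ∘ e)) = fun z => P.foldr intL F (z ∘ e) := by
  induction P with
  | nil => rfl
  | cons y P ih =>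
    rw [List.map_cons, List.foldr_cons, ih]
    funext z
    simp only [intL, List.foldr_cons, Function.update_comp_eq_of_injective z he]

end Pullback

section Independent

variable {X : Type} [DecidableEq X]

/-- A scalar factor which does not depend on the momenta integrated over can be pulled out. -/
theorem smul_foldr_intL {g : (X → Mom) → ℂ} (F : (X → Mom) → Wave) (D : List X)
    (hg : ∀ x ∈ D, ∀ z p, g (Function.update z x p) = g z) :
    (fun z => g z • D.foldr intL F z) = D.foldr intL fun z => g z • F z := by
  induction D with
  | nil => rfl
  | cons x D ih =>
    rw [List.foldr_cons, List.foldr_cons, ← ih fun a ha => hg a (by simp [ha])]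
    funext z
    simp only [intL, hg x (by simp), waveInt_smul]

/-- A scalar factor which does not depend on the momenta of the letters can be pulled out. -/
theorem smul_word {g : (X → Mom) → ℂ} (cr : X → Prop) [DecidablePred cr] (F : (X → Mom) → Wave)
    (w : List X) (hg : ∀ x ∈ w, ∀ z p, g (Function.update z x p) = g z) :
    (fun z => g z • word cr w F z) = word cr w fun z => g z • F z := by
  induction w with
  | nil => rfl
  | cons x w ih =>
    have e : ∀ F, word cr (x :: w) F = if cr x then creL x (word cr w F)
        else desL x (word cr w F) := fun F => rfl
    rw [e, e, ← ih fun a ha => hg a (by simp [ha])]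
    funext z
    split_ifs
    · simp only [creL, hg x (by simp), cre_smul]
    · simp only [desL, destroy_smul]

theorem word_append (cr : X → Prop) [DecidablePred cr] (w w' : List X) (F : (X → Mom) → Wave) :
    word cr (w ++ w') F = word cr w (word cr w' F) := List.foldr_append

theorem word_of_creation (cr : X → Prop) [DecidablePred cr] (P : List X) (hP : ∀ x ∈ P, cr x)
    (F : (X → Mom) → Wave) : word cr P F = P.foldr creL F := by
  induction P with
  | nil => rfl
  | cons x P ih =>
    rw [List.foldr_cons, ← ih fun a ha => hP a (by simp [ha])]
    exact if_pos (hP x (by simp))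

theorem word_of_destruction (cr : X → Prop) [DecidablePred cr] (P : List X) (hP : ∀ x ∈ P, ¬ cr x)
    (F : (X → Mom) → Wave) : word cr P F = P.foldr desL F := by
  induction P with
  | nil => rfl
  | cons x P ih =>
    rw [List.foldr_cons, ← ih fun a ha => hP a (by simp [ha])]
    exact if_neg (hP x (by simp))

end Independent

/-! ### The operators of the terms of the Wick reduction -/

section WickTermOp

variable {n N : ℕ}

/-- The momenta of all legs as a linear function of the free and the contracted momenta. -/
def WickTerm.momentaL (τ : WickTerm n N) :
    (((Fin τ.r → Mom) × (Fin τ.s → Mom)) × (Fin τ.c → Mom)) →ₗ[ℝ] (Fin N → Fin n → Mom) where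
  toFun z := τ.momenta z.1.1 z.1.2 z.2
  map_add' x y := by
    funext M j
    simp only [WickTerm.momenta, Pi.add_apply]
    rcases τ.leg.symm (M, j) with (i | i) | (i | i) <;> simp
  map_smul' c x := by
    funext M j
    simp only [WickTerm.momenta, Pi.smul_apply]
    rcases τ.leg.symm (M, j) with (i | i) | (i | i) <;> simp

theorem WickTerm.momentaL_apply (τ : WickTerm n N)
    (z : ((Fin τ.r → Mom) × (Fin τ.s → Mom)) × (Fin τ.c → Mom)) :
    τ.momentaL z = τ.momenta z.1.1 z.1.2 z.2 := rfl

theorem WickTerm.momentaL_injective (τ : WickTerm n N) : Function.Injective τ.momentaL := by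
  intro x y h
  have key : ∀ a, Sum.elim (Sum.elim x.1.1 x.2) (Sum.elim x.1.2 x.2) a =
      Sum.elim (Sum.elim y.1.1 y.2) (Sum.elim y.1.2 y.2) a := fun a => by
    have := congrFun (congrFun h (τ.leg a).1) (τ.leg a).2
    simpa [WickTerm.momentaL_apply, WickTerm.momenta] using this
  refine Prod.ext (Prod.ext ?_ ?_) ?_
  · exact funext fun i => key (Sum.inl (Sum.inl i))
  · exact funext fun i => key (Sum.inr (Sum.inl i))
  · exact funext fun i => key (Sum.inr (Sum.inr i))

theorem WickTerm.exists_contract (τ : WickTerm n N) (V : 𝓢(Fin N → Fin n → Mom, ℂ)) :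
    ∃ W : 𝓢((Fin τ.r → Mom) × (Fin τ.s → Mom), ℂ),
      ∀ z, W z = ∫ u : Fin τ.c → Mom, V (τ.momenta z.1 z.2 u) :=
  (((isSchwartz_coe V).comp_injective τ.momentaL τ.momentaL_injective).partialIntegral volume)

/-- The kernel obtained from `V` by equating the momenta of contracted legs and integrating over
them. -/
def WickTerm.contract (τ : WickTerm n N) (V : 𝓢(Fin N → Fin n → Mom, ℂ)) :
    𝓢((Fin τ.r → Mom) × (Fin τ.s → Mom), ℂ) :=
  (τ.exists_contract V).choose

theorem WickTerm.contract_apply (τ : WickTerm n N) (V : 𝓢(Fin N → Fin n → Mom, ℂ))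
    (z : (Fin τ.r → Mom) × (Fin τ.s → Mom)) :
    τ.contract V z = ∫ u : Fin τ.c → Mom, V (τ.momenta z.1 z.2 u) :=
  (τ.exists_contract V).choose_spec z

/-- The Wick monomial of the term `τ` for the momentum kernel `V`. -/
def WickTerm.op (τ : WickTerm n N) (V : 𝓢(Fin N → Fin n → Mom, ℂ)) : Module.End ℂ SchwartzFock :=
  wickOp (τ.contract V)

theorem exists_legs_bound (V : 𝓢(Fin N → Fin n → Mom, ℂ)) : ∃ C, 0 ≤ C ∧
    ∀ z : Fin N × Fin n → Mom, ‖V fun M j => z (M, j)‖ ≤ C * wtOn Finset.univ z := by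
  obtain ⟨C, hC, h⟩ := (isSchwartz_coe V).exists_le_prod_wt (fun (x : Fin N × Fin n) k => k x.1 x.2)
    fun x k => (norm_le_pi_norm (k x.1) x.2).trans (norm_le_pi_norm k x.1)
  exact ⟨C, hC, fun z => h fun M j => z (M, j)⟩

/-- A contraction scheme of the word of all legs, in which contracted letters are in the order
required by `R`, is a term of the Wick reduction, and integrating the normally ordered word over the
momenta of the destruction letters yields the operator of that term. -/
theorem exists_wickTerm_eq {R : Fin N × Fin n → Fin N × Fin n → Prop}
    (hR : ∀ x y, R x y → x.1 < y.1) (J : Fin N → Finset (Fin n)) {w : List (Fin N × Fin n)}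
    (hw : w.Nodup) (hmem : ∀ x, x ∈ w) {t : Contraction (Fin N × Fin n)}
    (ht : IsContraction (fun x => x.2 ∈ J x.1) R w t) :
    ∃ τ : WickTerm n N, τ.J = J ∧ ∀ (V : 𝓢(Fin N → Fin n → Mom, ℂ)) (Ψ : SchwartzFock)
      (z : Fin N × Fin n → Mom),
      (w.filter fun x => ¬ x.2 ∈ J x.1).foldr intL
        (normalWord t fun z => V (fun M j => z (M, j)) • wave Ψ) z = wave (τ.op V Ψ) := by
  obtain ⟨P, Q, C⟩ := t
  have hn := ht.nodup _ hw
  obtain ⟨hperm, hcr, hde, hfst, hsnd, hrel⟩ := ht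
  simp only at hn hperm hcr hde hfst hsnd hrel
  have hlen : (C.map Prod.fst).length = C.length := by simp
  let f : (Fin P.length ⊕ Fin (C.map Prod.fst).length) ⊕
      (Fin Q.length ⊕ Fin (C.map Prod.fst).length) → Fin N × Fin n :=
    Sum.elim (Sum.elim P.get fun i => (C.get (i.cast hlen)).2)
      (Sum.elim Q.get fun i => (C.get (i.cast hlen)).1)
  have hf : Function.Bijective f := by
    rw [Fintype.bijective_iff_surjective_and_card]
    constructor
    · intro x
      have hx := hperm.mem_iff.2 (hmem x)
      simp only [List.mem_append] at hx
      rcases hx with ((h | h) | h) | h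
      · obtain ⟨i, rfl⟩ := List.mem_iff_get.1 h
        exact ⟨Sum.inl (Sum.inl i), rfl⟩
      · obtain ⟨i, rfl⟩ := List.mem_iff_get.1 h
        exact ⟨Sum.inr (Sum.inl i), rfl⟩
      · obtain ⟨c, hc, rfl⟩ := List.mem_map.1 h
        obtain ⟨i, rfl⟩ := List.mem_iff_get.1 hc
        exact ⟨Sum.inr (Sum.inr (i.cast hlen.symm)), rfl⟩
      · obtain ⟨c, hc, rfl⟩ := List.mem_map.1 h
        obtain ⟨i, rfl⟩ := List.mem_iff_get.1 hc
        exact ⟨Sum.inl (Sum.inr (i.cast hlen.symm)), rfl⟩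
    · have h1 := hperm.length_eq
      have h2 : w.length = Fintype.card (Fin N × Fin n) := by
        rw [← List.toFinset_card_of_nodup hw, Finset.eq_univ_of_forall (s := w.toFinset)
          (by simpa using hmem), Finset.card_univ]
      rw [← h2, ← h1]
      simp
      omega
  let τ : WickTerm n N :=
    { J := J
      r := P.length
      s := Q.length
      c := (C.map Prod.fst).length
      leg := Equiv.ofBijective f hf
      creation := by
        rintro (i | i)
        · exact hcr _ (List.get_mem P i)
        · exact hsnd _ (List.get_mem C _)
      destruction := by
        rintro (i | i)
        · exact hde _ (List.get_mem Q i)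
        · exact hfst _ (List.get_mem C _)
      contraction := fun u => hR _ _ (hrel _ (List.get_mem C _)) }
  refine ⟨τ, rfl, fun V Ψ z => ?_⟩
  have hn' := hn
  simp only [List.append_assoc] at hn'
  have hPQU : (P ++ Q ++ C.map Prod.fst).Nodup := (List.nodup_append.1 hn).1
  obtain ⟨-, hn2, hPd⟩ := List.nodup_append.1 hn'
  obtain ⟨-, hn3, hQd⟩ := List.nodup_append.1 hn2
  have hV0 : Tame (wtOn Finset.univ) fun z : Fin N × Fin n → Mom =>
      V (fun M j => z (M, j)) • wave Ψ := by
    refine (((tameWave_wave Ψ).const (Fin N × Fin n → Mom)).smul (V := fun z =>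
      V fun M j => z (M, j)) (V.continuous.comp (by fun_prop)) (exists_legs_bound V)).mono
      fun z => (mul_one _).le
  have hV1 := hV0.foldr_conL C
  have hperm' : (w.filter fun x => ¬ x.2 ∈ J x.1).Perm (Q ++ C.map Prod.fst) := by
    refine (hperm.filter _).symm.trans (List.Perm.of_eq ?_)
    rw [List.filter_append, List.filter_append, List.filter_append,
      List.filter_eq_nil_iff.2 fun x hx => by simpa using hcr x hx,
      List.filter_eq_self.2 fun x hx => by simpa using hde x hx,
      List.filter_eq_self.2 fun x hx => by
        obtain ⟨c, hc, rfl⟩ := List.mem_map.1 hx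
        simpa using hfst c hc,
      List.filter_eq_nil_iff.2 fun x hx => by
        obtain ⟨c, hc, rfl⟩ := List.mem_map.1 hx
        simpa using hsnd c hc]
    simp
  rw [foldr_intL_perm (hV0.normalWord (P, Q, C) hn (by simp)) hperm' (hw.filter _) ?_,
    List.foldr_append]
  · have e : C.foldr (fun c => conL c.1 c.2)
        (fun z : Fin N × Fin n → Mom => V (fun M j => z (M, j)) • wave Ψ) =
        fun z => V (fun M j => subst C z (M, j)) • wave Ψ :=
      funext fun z => foldr_conL_apply _ C z
    simp only [normalWord]
    rw [e] at hV1 ⊢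
    rw [foldr_intL_normal (V := fun z => V fun M j => subst C z (M, j)) hV1 P Q (C.map Prod.fst)
      hPQU]
    · rw [WickTerm.op, wave_wickOp]
      congr 1
      funext p q
      rw [WickTerm.contract_apply]
      refine integral_congr_ae (.of_forall fun u => ?_)
      refine congrArg V (funext fun M => funext fun j => ?_)
      obtain ⟨a, ha⟩ := τ.leg.surjective (M, j)
      rw [WickTerm.momenta, ← ha, Equiv.symm_apply_apply]
      obtain ⟨hPQ, hU, hPQd⟩ := List.nodup_append.1 hPQU
      obtain ⟨hP, hQ, -⟩ := List.nodup_append.1 hPQ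
      have hu : ∀ i : Fin (C.map Prod.fst).length,
          upd (upd (upd z P p) Q q) (C.map Prod.fst) u (C.get (i.cast hlen)).1 = u i := by
        intro i
        have : (C.get (i.cast hlen)).1 = (C.map Prod.fst).get i := by simp
        rw [this, upd_get _ _ _ hU]
      rcases a with (i | i) | (i | i)
      · change subst C _ (P.get i) = p i
        have hm := List.get_mem P i
        rw [subst_of_notMem C _ fun h => hPd _ hm _ (by simp only [List.mem_append]; tauto) rfl,
          upd_of_notMem _ _ _ fun h => hPd _ hm _ (by simp only [List.mem_append]; tauto) rfl,
          upd_of_notMem _ _ _ fun h => hPd _ hm _ (by simp only [List.mem_append]; tauto) rfl,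
          upd_get _ _ _ hP]
      · change subst C _ (C.get (i.cast hlen)).2 = u i
        rw [subst_snd C _ hn3 _ (List.get_mem C _), hu]
      · change subst C _ (Q.get i) = q i
        have hm := List.get_mem Q i
        rw [subst_of_notMem C _ fun h => hQd _ hm _ (by simp only [List.mem_append]; tauto) rfl,
          upd_of_notMem _ _ _ fun h => hQd _ hm _ (by simp only [List.mem_append]; tauto) rfl,
          upd_get _ _ _ hQ]
      · change subst C _ (C.get (i.cast hlen)).1 = u i
        have hm := List.mem_map_of_mem (f := Prod.fst) (List.get_mem C (i.cast hlen))
        rw [subst_of_notMem C _ fun h => (List.nodup_append.1 hn3).2.2 _ hm _ h rfl, hu]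
    · intro x hx
      simp only [Finset.mem_sdiff, Finset.mem_univ, List.mem_toFinset, true_and]
      exact fun h => (List.nodup_append.1 hn).2.2 x hx x h rfl
  · intro x hx
    have hx2 : x.2 ∉ J x.1 := by simpa using (List.mem_filter.1 hx).2
    simp only [Finset.mem_sdiff, Finset.mem_univ, List.mem_toFinset, true_and]
    refine ⟨fun h => ?_, fun h => hx2 (hcr x h)⟩
    obtain ⟨c, hc, rfl⟩ := List.mem_map.1 h
    exact hx2 (hsnd c hc)

end WickTermOp

/-! ### Products of vertex operators -/

section Vertex

variable {n : ℕ}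

/-- The legs of a vertex, split into the listed creation and destruction legs. -/
theorem exists_sortEquiv (J : Finset (Fin n)) :
    ∃ e : Fin (J.sort (· ≤ ·)).length ⊕ Fin (Jᶜ.sort (· ≤ ·)).length ≃ Fin n,
      (∀ i, e (Sum.inl i) = (J.sort (· ≤ ·)).get i) ∧
        ∀ i, e (Sum.inr i) = (Jᶜ.sort (· ≤ ·)).get i := by
  have hf : Function.Bijective
      (Sum.elim (J.sort (· ≤ ·)).get (Jᶜ.sort (· ≤ ·)).get) := by
    rw [Fintype.bijective_iff_surjective_and_card]
    constructor
    · intro j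
      by_cases hj : j ∈ J
      · obtain ⟨i, hi⟩ := List.mem_iff_get.1 ((Finset.mem_sort (r := (· ≤ ·))).2 hj)
        exact ⟨Sum.inl i, hi⟩
      · obtain ⟨i, hi⟩ := List.mem_iff_get.1
          ((Finset.mem_sort (r := (· ≤ ·))).2 (Finset.mem_compl.2 hj))
        exact ⟨Sum.inr i, hi⟩
    · simp [Finset.length_sort, Finset.card_add_card_compl]
  exact ⟨Equiv.ofBijective _ hf, fun _ => rfl, fun _ => rfl⟩

theorem sort_nodup_append (J : Finset (Fin n)) :
    (J.sort (· ≤ ·) ++ Jᶜ.sort (· ≤ ·)).Nodup :=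
  List.nodup_append.2 ⟨J.sort_nodup _, (Jᶜ).sort_nodup _, fun a ha b hb e => by
    simp only [Finset.mem_sort, Finset.mem_compl] at ha hb
    exact hb (e ▸ ha)⟩

theorem tame_legs (v : 𝓢(Fin n → Mom, ℂ)) (Ψ : SchwartzFock) :
    Tame (wtOn Finset.univ) fun k : Fin n → Mom => v k • wave Ψ := by
  refine (((tameWave_wave Ψ).const (Fin n → Mom)).smul v.continuous
    ((isSchwartz_coe v).exists_le_prod_wt (fun i k => k i) fun i k => norm_le_pi_norm k i)).mono
    fun z => (mul_one _).le

/-- The operator of a single vertex with momentum kernel `v` and creation legs `J`, as a word of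
letters and as a quadratic form. -/
theorem exists_opVertex (J : Finset (Fin n)) (v : 𝓢(Fin n → Mom, ℂ)) :
    ∃ A : Module.End ℂ SchwartzFock,
      (∀ Ψ z, wave (A Ψ) = (Jᶜ.sort (· ≤ ·)).foldr intL ((J.sort (· ≤ ·)).foldr creL
        ((Jᶜ.sort (· ≤ ·)).foldr desL fun k : Fin n → Mom => v k • wave Ψ)) z) ∧
      (∀ Φ Ψ, ⟪toFock Φ, toFock (A Ψ)⟫_ℂ = ∫ k, v k *
        normalForm ((J.sort (· ≤ ·)).map k) ((Jᶜ.sort (· ≤ ·)).map k) Φ Ψ) := by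
  obtain ⟨e, he1, he2⟩ := exists_sortEquiv J
  generalize hP : J.sort (· ≤ ·) = P at *
  generalize hQ : Jᶜ.sort (· ≤ ·) = Q at *
  have hn : (P ++ Q).Nodup := by
    rw [← hP, ← hQ]
    exact sort_nodup_append J
  obtain ⟨hPn, hQn, hd⟩ := List.nodup_append.1 hn
  let L : ((Fin P.length → Mom) × (Fin Q.length → Mom)) →ₗ[ℝ] (Fin n → Mom) :=
    { toFun := fun z j => Sum.elim z.1 z.2 (e.symm j)
      map_add' := fun x y => by
        funext j
        rcases h : e.symm j with i | i <;> simp [h]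
      map_smul' := fun c x => by
        funext j
        rcases h : e.symm j with i | i <;> simp [h] }
  have hL : ∀ z a, L z (e a) = Sum.elim z.1 z.2 a := fun z a => by simp [L]
  have hLi : Function.Injective L := fun x y h => by
    refine Prod.ext (funext fun i => ?_) (funext fun i => ?_)
    · have := congrFun h (e (Sum.inl i))
      rw [hL, hL] at this
      exact this
    · have := congrFun h (e (Sum.inr i))
      rw [hL, hL] at this
      exact this
  obtain ⟨W, hW⟩ := (isSchwartz_coe v).comp_injective L hLi
  refine ⟨wickOp W, fun Ψ z => ?_, fun Φ Ψ => ?_⟩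
  · have h := foldr_intL_normal (tame_legs v Ψ) P Q [] (by simpa using hn) (by simp) z
    rw [List.foldr_nil] at h
    rw [h, wave_wickOp]
    congr 1
    funext p q
    have h1 : L (p, q) = upd (upd z P p) Q q := by
      funext j
      obtain ⟨a, rfl⟩ := e.surjective j
      rw [hL]
      rcases a with i | i
      · rw [he1, upd_of_notMem _ _ _ fun h => hd _ (List.get_mem P i) _ h rfl,
          upd_get _ _ _ hPn]
        rfl
      · rw [he2, upd_get _ _ _ hQn]
        rfl
    rw [hW]
    simp only [h1]
    simp [upd, Measure.real, volume_pi]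
  · have hm : MeasurePreserving ((MeasurableEquiv.arrowCongr' e.symm
        (MeasurableEquiv.refl Mom)).trans (MeasurableEquiv.sumPiEquivProdPi fun _ => Mom)) volume
        volume :=
      (volume_measurePreserving_sumPiEquivProdPi _).comp
        (volume_preserving_arrowCongr' e.symm (MeasurableEquiv.refl Mom) (MeasurePreserving.id _))
    rw [inner_wickOp, wickForm, ← hm.integral_comp']
    refine integral_congr_ae (.of_forall fun k => ?_)
    have h1 : ((MeasurableEquiv.arrowCongr' e.symm
        (MeasurableEquiv.refl Mom)).trans (MeasurableEquiv.sumPiEquivProdPi fun _ => Mom)) k =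
        (fun i => k (e (Sum.inl i)), fun i => k (e (Sum.inr i))) := rfl
    simp only [h1, hW]
    have h2 : L (fun i => k (e (Sum.inl i)), fun i => k (e (Sum.inr i))) = k := by
      funext j
      obtain ⟨a, rfl⟩ := e.surjective j
      rw [hL]
      rcases a with i | i <;> rfl
    have h3 : ∀ (R : List (Fin n)), (List.ofFn fun i => k (R.get i)) = R.map k := fun R => by
      rw [List.ofFn_comp' R.get k, List.ofFn_get]
    rw [h2]
    simp only [he1, he2, h3]

/-- The operator on `D_S` with the quadratic form
`∫ dk v(k) ∏_{j ∈ J} a†(k_j) ∏_{j ∉ J} a(k_j)`. -/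
def opVertex (J : Finset (Fin n)) (v : 𝓢(Fin n → Mom, ℂ)) : Module.End ℂ SchwartzFock :=
  (exists_opVertex J v).choose

theorem wave_opVertex (J : Finset (Fin n)) (v : 𝓢(Fin n → Mom, ℂ)) (Ψ : SchwartzFock)
    (z : Fin n → Mom) :
    wave (opVertex J v Ψ) = (Jᶜ.sort (· ≤ ·)).foldr intL ((J.sort (· ≤ ·)).foldr creL
      ((Jᶜ.sort (· ≤ ·)).foldr desL fun k : Fin n → Mom => v k • wave Ψ)) z :=
  (exists_opVertex J v).choose_spec.1 Ψ z

theorem inner_opVertex (J : Finset (Fin n)) (v : 𝓢(Fin n → Mom, ℂ)) (Φ Ψ : SchwartzFock) :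
    ⟪toFock Φ, toFock (opVertex J v Ψ)⟫_ℂ = ∫ k, v k *
      normalForm ((J.sort (· ≤ ·)).map k) ((Jᶜ.sort (· ≤ ·)).map k) Φ Ψ :=
  (exists_opVertex J v).choose_spec.2 Φ Ψ

variable {N : ℕ} (J : Fin N → Finset (Fin n))

/-- The creation letters of the vertex `M`. -/
def creLegs (M : Fin N) : List (Fin N × Fin n) := ((J M).sort (· ≤ ·)).map (Prod.mk M)

/-- The destruction letters of the vertex `M`. -/
def desLegs (M : Fin N) : List (Fin N × Fin n) := ((J M)ᶜ.sort (· ≤ ·)).map (Prod.mk M)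

/-- The word of letters of the product of the vertices in the list `Ms`. -/
def legWord (Ms : List (Fin N)) : List (Fin N × Fin n) :=
  Ms.flatMap fun M => creLegs J M ++ desLegs J M

theorem mem_creLegs {M : Fin N} {x : Fin N × Fin n} :
    x ∈ creLegs J M ↔ x.1 = M ∧ x.2 ∈ J x.1 := by
  obtain ⟨a, b⟩ := x
  simp only [creLegs, List.mem_map, Finset.mem_sort, Prod.mk.injEq]
  constructor
  · rintro ⟨j, hj, rfl, rfl⟩
    exact ⟨rfl, hj⟩
  · rintro ⟨rfl, h⟩
    exact ⟨b, h, rfl, rfl⟩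

theorem mem_desLegs {M : Fin N} {x : Fin N × Fin n} :
    x ∈ desLegs J M ↔ x.1 = M ∧ x.2 ∉ J x.1 := by
  obtain ⟨a, b⟩ := x
  simp only [desLegs, List.mem_map, Finset.mem_sort, Prod.mk.injEq, Finset.mem_compl]
  constructor
  · rintro ⟨j, hj, rfl, rfl⟩
    exact ⟨rfl, hj⟩
  · rintro ⟨rfl, h⟩
    exact ⟨b, h, rfl, rfl⟩

theorem mem_legWord {Ms : List (Fin N)} {x : Fin N × Fin n} : x ∈ legWord J Ms ↔ x.1 ∈ Ms := by
  simp only [legWord, List.mem_flatMap, List.mem_append, mem_creLegs, mem_desLegs]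
  constructor
  · rintro ⟨M, hM, h | h⟩ <;> exact h.1 ▸ hM
  · intro h
    exact ⟨x.1, h, by tauto⟩

theorem legs_nodup (M : Fin N) : (creLegs J M ++ desLegs J M).Nodup := by
  rw [creLegs, desLegs, ← List.map_append]
  exact (sort_nodup_append (J M)).map (Prod.mk_right_injective M)

theorem legWord_nodup {Ms : List (Fin N)} (h : Ms.Nodup) : (legWord J Ms).Nodup := by
  induction Ms with
  | nil => simp [legWord]
  | cons M Ms ih =>
    rw [List.nodup_cons] at h
    refine List.nodup_append.2 ⟨legs_nodup J M, ih h.2, fun a ha b hb e => ?_⟩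
    subst e
    have hb' := (mem_legWord J).1 hb
    simp only [List.mem_append, mem_creLegs, mem_desLegs] at ha
    rcases ha with ha | ha <;> exact h.1 (ha.1 ▸ hb')

/-- A creation letter to the right of a destruction letter belongs to a later vertex, since every
vertex is normally ordered. -/
theorem legWord_pairwise {Ms : List (Fin N)} (h : Ms.Pairwise (· < ·)) :
    (legWord J Ms).Pairwise fun x y => ¬ x.2 ∈ J x.1 → y.2 ∈ J y.1 → x.1 < y.1 := by
  induction Ms with
  | nil => simp [legWord]
  | cons M Ms ih =>
    rw [List.pairwise_cons] at h
    refine List.pairwise_append.2 ⟨List.pairwise_append.2 ⟨?_, ?_, ?_⟩, ih h.2, ?_⟩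
    · exact List.pairwise_of_forall_mem_list fun x hx y _ hx' =>
        absurd ((mem_creLegs J).1 hx).2 hx'
    · exact List.pairwise_of_forall_mem_list fun x _ y hy _ hy' =>
        absurd hy' ((mem_desLegs J).1 hy).2
    · exact fun x hx y _ hx' => absurd ((mem_creLegs J).1 hx).2 hx'
    · intro x hx y hy _ _
      have hx1 : x.1 = M := by
        simp only [List.mem_append, mem_creLegs, mem_desLegs] at hx
        tauto
      rw [hx1]
      exact h.1 _ ((mem_legWord J).1 hy)

variable (v : Fin N → 𝓢(Fin n → Mom, ℂ))

/-- The product of the kernels of the vertices in the list `Ms`. -/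
def legProd (Ms : List (Fin N)) (z : Fin N × Fin n → Mom) : ℂ :=
  (Ms.map fun M => v M fun j => z (M, j)).prod

theorem continuous_legProd (Ms : List (Fin N)) : Continuous (legProd v Ms) := by
  induction Ms with
  | nil => exact continuous_const
  | cons M Ms ih =>
    have h : Continuous fun z : Fin N × Fin n → Mom => v M fun j => z (M, j) :=
      (v M).continuous.comp (by fun_prop)
    have e : legProd v (M :: Ms) = fun z => v M (fun j => z (M, j)) * legProd v Ms z :=
      funext fun z => by simp only [legProd, List.map_cons, List.prod_cons]
    rw [e]
    exact h.mul ih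

theorem exists_legProd_bound {Ms : List (Fin N)} (h : Ms.Nodup) :
    ∃ C, 0 ≤ C ∧ ∀ z, ‖legProd v Ms z‖ ≤ C * wtOn (Ms.toFinset ×ˢ Finset.univ) z := by
  induction Ms with
  | nil => exact ⟨1, zero_le_one, fun z => by simp [legProd, wtOn]⟩
  | cons M Ms ih =>
    rw [List.nodup_cons] at h
    obtain ⟨C, hC, hb⟩ := ih h.2
    obtain ⟨C', hC', hb'⟩ := (isSchwartz_coe (v M)).exists_le_prod_wt (fun i k => k i)
      fun i k => norm_le_pi_norm k i
    refine ⟨C' * C, mul_nonneg hC' hC, fun z => ?_⟩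
    have e : wtOn ((M :: Ms).toFinset ×ˢ Finset.univ) z =
        (∏ j, wt (z (M, j))) * wtOn (Ms.toFinset ×ˢ Finset.univ) z := by
      rw [wtOn, wtOn, Finset.prod_product, List.toFinset_cons,
        Finset.prod_insert (by simpa using h.1), Finset.prod_product]
    rw [legProd, List.map_cons, List.prod_cons, norm_mul, e]
    refine (mul_le_mul (hb' _) (hb z) (norm_nonneg _)
      (mul_nonneg hC' (prod_wt_nonneg _ _))).trans (le_of_eq (by ring))

theorem tame_legProd {Ms : List (Fin N)} (h : Ms.Nodup) (Ψ : SchwartzFock) :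
    Tame (wtOn (Ms.toFinset ×ˢ Finset.univ)) fun z => legProd v Ms z • wave Ψ :=
  (((tameWave_wave Ψ).const _).smul (continuous_legProd v Ms) (exists_legProd_bound v h)).mono
    fun _ => (mul_one _).le

theorem mem_legs_product {Ms : List (Fin N)} {x : Fin N × Fin n} :
    x ∈ (Ms.toFinset ×ˢ Finset.univ : Finset (Fin N × Fin n)) ↔ x.1 ∈ Ms := by simp

theorem legWord_cons (M : Fin N) (Ms : List (Fin N)) :
    legWord J (M :: Ms) = creLegs J M ++ (desLegs J M ++ legWord J Ms) := by
  simp [legWord, List.flatMap_cons]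

theorem filter_legs (M : Fin N) (w : List (Fin N × Fin n)) :
    ((creLegs J M ++ (desLegs J M ++ w)).filter fun x => ¬ x.2 ∈ J x.1) =
      desLegs J M ++ w.filter fun x => ¬ x.2 ∈ J x.1 := by
  rw [List.filter_append, List.filter_append,
    List.filter_eq_nil_iff.2 fun x hx => by simpa using ((mem_creLegs J).1 hx).2,
    List.filter_eq_self.2 fun x hx => by simpa using ((mem_desLegs J).1 hx).2, List.nil_append]

/-- A product of vertex operators is the word of all its letters, with the destruction momenta
integrated out. -/
theorem wave_prod_opVertex {Ms : List (Fin N)} (h : Ms.Nodup) (Ψ : SchwartzFock) :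
    ∀ z, wave ((Ms.map fun M => opVertex (J M) (v M)).prod Ψ) =
      ((legWord J Ms).filter fun x => ¬ x.2 ∈ J x.1).foldr intL
        (word (fun x => x.2 ∈ J x.1) (legWord J Ms) fun z => legProd v Ms z • wave Ψ) z := by
  induction Ms with
  | nil => intro z; simp [legWord, word, legProd]
  | cons M Ms ih =>
    have hT := tame_legProd v h Ψ
    have hw := legWord_nodup J h
    rw [List.nodup_cons] at h
    have ih := ih h.2
    intro z
    have hwM : ∀ x ∈ legWord J Ms, x.1 ≠ M := fun x hx e => h.1 (e ▸ (mem_legWord J).1 hx)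
    have hgM : ∀ x : Fin N × Fin n, x.1 ≠ M → ∀ (z : Fin N × Fin n → Mom) p,
        v M (fun j => Function.update z x p (M, j)) = v M fun j => z (M, j) := by
      intro x hx z p
      refine congrArg (v M) (funext fun j => Function.update_of_ne (fun e => hx ?_) _ _)
      rw [← e]
    have inj := Prod.mk_right_injective (β := Fin n) M
    rw [List.map_cons, List.prod_cons, Module.End.mul_apply, wave_opVertex _ _ _ fun j => z (M, j)]
    have e1 := fun F => congrFun (foldr_intL_map inj F ((J M)ᶜ.sort (· ≤ ·))) z
    have e2 := fun F => foldr_creL_map inj F ((J M).sort (· ≤ ·))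
    have e3 := fun F => foldr_desL_map (e := Prod.mk M) F ((J M)ᶜ.sort (· ≤ ·))
    have e4 := e1 ((J M).sort (· ≤ ·) |>.foldr creL (((J M)ᶜ.sort (· ≤ ·)).foldr desL
      fun k : Fin n → Mom => v M k • wave ((Ms.map fun M => opVertex (J M) (v M)).prod Ψ)))
    refine Eq.trans e4.symm ?_
    rw [← e2, ← e3]
    have e5 : (fun z : Fin N × Fin n → Mom => v M (z ∘ Prod.mk M) •
        wave ((Ms.map fun M => opVertex (J M) (v M)).prod Ψ)) =
        ((legWord J Ms).filter fun x => ¬ x.2 ∈ J x.1).foldr intL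
          (word (fun x => x.2 ∈ J x.1) (legWord J Ms) fun z => legProd v (M :: Ms) z • wave Ψ) := by
      have e6 : (fun z => legProd v (M :: Ms) z • wave Ψ) =
          fun z => v M (fun j => z (M, j)) • legProd v Ms z • wave Ψ := by
        funext z
        rw [legProd, List.map_cons, List.prod_cons, mul_smul]
        rfl
      rw [e6, ← smul_word (g := fun z => v M fun j => z (M, j)) _ _ _
        fun x hx => hgM x (hwM x hx), ← smul_foldr_intL (g := fun z => v M fun j => z (M, j)) _ _
        fun x hx => hgM x (hwM x (List.mem_of_mem_filter hx))]
      funext z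
      rw [ih z]
      rfl
    rw [e5]
    have hd := legs_nodup J M
    rw [legWord_cons] at hw
    obtain ⟨hP, hQw, hPd⟩ := List.nodup_append.1 hw
    obtain ⟨hQ, hwn, hQd⟩ := List.nodup_append.1 hQw
    have hT' := hT.word (fun x => x.2 ∈ J x.1) (legWord J Ms) hwn fun x hx => by
      rw [mem_legs_product]
      exact List.mem_cons_of_mem _ ((mem_legWord J).1 hx)
    rw [legWord_cons, filter_legs, List.foldr_append, word_append, word_append,
      word_of_creation _ _ fun x hx => ((mem_creLegs J).1 hx).2,
      word_of_destruction _ _ fun x hx => ((mem_desLegs J).1 hx).2,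
      foldr_intL_foldr_creL (hT'.foldr_desL (desLegs J M)), foldr_intL_foldr_desL]
    · rfl
    · intro x hx hx'
      exact hQd x hx' x (List.mem_of_mem_filter hx) rfl
    · refine List.nodup_append.2 ⟨hwn.filter _, hP, fun a ha b hb e => ?_⟩
      exact hPd b hb a (by simp [List.mem_of_mem_filter ha]) e.symm
    · intro x hx
      rw [Finset.mem_sdiff, mem_legs_product]
      rcases List.mem_append.1 hx with hx | hx
      · have := (mem_legWord J).1 (List.mem_of_mem_filter hx)
        have h2 : x.2 ∉ J x.1 := by simpa using (List.mem_filter.1 hx).2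
        exact ⟨by simp [this], by simp [h2]⟩
      · have h2 := (mem_creLegs J).1 hx
        refine ⟨by simp [h2.1], fun h3 => ?_⟩
        exact hwM x (List.mem_of_mem_filter (List.mem_toFinset.1 h3)) h2.1

/-- **Wick's theorem** for a product of vertex operators. -/
theorem exists_wickTerms : ∃ (L : ℕ) (τ : Fin L → WickTerm n N), (∀ i, (τ i).J = J) ∧
    ∀ (v : Fin N → 𝓢(Fin n → Mom, ℂ)) (V : 𝓢(Fin N → Fin n → Mom, ℂ)),
      (∀ k, V k = ∏ M, v M (k M)) →
      (List.ofFn fun M => opVertex (J M) (v M)).prod = ∑ i, (τ i).op V := by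
  have hw : (legWord J (List.finRange N)).Nodup := legWord_nodup J (List.nodup_finRange N)
  have hmem : ∀ x, x ∈ legWord J (List.finRange N) := fun x => (mem_legWord J).2 (by simp)
  have hC := isContraction_of_mem (fun x : Fin N × Fin n => x.2 ∈ J x.1)
    (R := fun x y => x.1 < y.1) _ (legWord_pairwise J (List.pairwise_lt_finRange N))
  have key : ∀ i : Fin (contractions (fun x : Fin N × Fin n => x.2 ∈ J x.1)
      (legWord J (List.finRange N))).length, _ := fun i =>
    exists_wickTerm_eq (R := fun x y => x.1 < y.1) (fun _ _ h => h) J hw hmem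
      (hC _ (List.get_mem _ i))
  choose τ hτJ hτ using key
  refine ⟨_, τ, hτJ, fun v V hV => LinearMap.ext fun Ψ => wave_injective ?_⟩
  have e : (fun z => legProd v (List.finRange N) z • wave Ψ) =
      fun z : Fin N × Fin n → Mom => V (fun M j => z (M, j)) • wave Ψ := by
    funext z
    rw [hV, legProd, ← List.ofFn_eq_map, List.prod_ofFn]
  rw [List.ofFn_eq_map, wave_prod_opVertex J v (List.nodup_finRange N) Ψ fun _ => 0, e,
    word_eq_sum _ _ _ hw,
    foldr_intL_list_sum (A := Finset.univ.filter fun x => ¬ x.2 ∈ J x.1) _ (fun t ht => ?_) _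
      (hw.filter _) (by simp), ← Fin.sum_univ_fun_getElem, Finset.sum_apply, LinearMap.sum_apply]
  · refine Eq.trans ?_ (map_sum (AddMonoidHom.mk' wave wave_add) _ _).symm
    exact Finset.sum_congr rfl fun i _ => hτ i V Ψ _
  · have i := hC t ht
    have hT : Tame (wtOn Finset.univ) fun z : Fin N × Fin n → Mom =>
        V (fun M j => z (M, j)) • wave Ψ :=
      (((tameWave_wave Ψ).const (Fin N × Fin n → Mom)).smul (V := fun z =>
        V fun M j => z (M, j)) (V.continuous.comp (by fun_prop)) (exists_legs_bound V)).mono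
        fun z => (mul_one _).le
    refine (hT.normalWord t (i.nodup _ hw) (by simp)).anti fun x hx => ?_
    have hx2 : x.2 ∉ J x.1 := by simpa using hx
    simp only [Finset.mem_sdiff, Finset.mem_univ, List.mem_toFinset, true_and]
    refine ⟨fun h => ?_, fun h => hx2 (i.creation x h)⟩
    obtain ⟨c, hc, rfl⟩ := List.mem_map.1 h
    exact hx2 (i.pair_snd c hc)

end Vertex

/-! ### Temperate growth of the energies and of oscillatory integrals -/

theorem hasTemperateGrowth_pi {ι : Type} [Fintype ι] {E : Type} [NormedAddCommGroup E]
    [NormedSpace ℝ E] {f : E → ι → ℝ} (h : ∀ i, (fun x => f x i).HasTemperateGrowth) :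
    f.HasTemperateGrowth := by
  classical
  have e : f = fun x => ∑ i, ContinuousLinearMap.single ℝ (fun _ : ι => ℝ) i (f x i) := by
    funext x
    simp only [ContinuousLinearMap.single_apply]
    exact (Finset.univ_sum_single (f x)).symm
  rw [e]
  exact Function.HasTemperateGrowth.sum fun i _ =>
    (ContinuousLinearMap.hasTemperateGrowth _).comp (h i)

theorem hasTemperateGrowth_prod {ι : Type} {E : Type} [NormedAddCommGroup E]
    [NormedSpace ℝ E] {f : ι → E → ℂ} (s : Finset ι) (h : ∀ i, (f i).HasTemperateGrowth) :
    (fun x => ∏ i ∈ s, f i x).HasTemperateGrowth := by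
  classical
  induction s using Finset.induction_on with
  | empty => simp
  | insert a s ha ih =>
    simp only [Finset.prod_insert ha]
    exact (h a).mul ih

variable {m : ℝ}

/-- Powers of the energy as powers of `1 + |k / m|²`. -/
theorem omega_rpow (hm : 0 < m) (r : ℝ) (k : Mom) :
    omega m k ^ r = m ^ r * (1 + ‖m⁻¹ • k‖ ^ 2) ^ (r / 2) := by
  have h1 : ‖k‖ ^ 2 + m ^ 2 = m ^ 2 * (1 + ‖m⁻¹ • k‖ ^ 2) := by
    rw [norm_smul, norm_inv, Real.norm_of_nonneg hm.le]
    field_simp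
    ring
  rw [omega, h1, Real.sqrt_mul (by positivity), Real.sqrt_sq hm.le,
    Real.mul_rpow hm.le (Real.sqrt_nonneg _), Real.sqrt_eq_rpow, ← Real.rpow_mul (by positivity)]
  congr 2
  ring

theorem omega_pos (hm : 0 < m) (k : Mom) : 0 < omega m k :=
  Real.sqrt_pos.2 (by positivity)

/-- Real powers of the energy have temperate growth because the mass is positive. -/
theorem hasTemperateGrowth_omega_rpow (hm : 0 < m) (r : ℝ) :
    (fun k : Mom => omega m k ^ r).HasTemperateGrowth := by
  simp only [omega_rpow hm]
  refine (Function.HasTemperateGrowth.const (m ^ r)).mul ?_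
  exact (Function.hasTemperateGrowth_one_add_norm_sq_rpow (H := Mom) (r / 2)).comp
    (m⁻¹ • ContinuousLinearMap.id ℝ Mom).hasTemperateGrowth

theorem hasTemperateGrowth_omega (hm : 0 < m) : (omega m).HasTemperateGrowth := by
  simpa using hasTemperateGrowth_omega_rpow hm 1

open VectorFourier in
/-- Oscillatory integrals against a measure all of whose moments are finite have temperate
growth. -/
theorem hasTemperateGrowth_oscillatory {ι : Type} [Fintype ι] (μ : Measure (ι → ℝ))
    (f : (ι → ℝ) → ℂ) (hf : ∀ n : ℕ, Integrable (fun t => ‖t‖ ^ n * ‖f t‖) μ)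
    (hm : AEStronglyMeasurable f μ) :
    (fun E : ι → ℝ => ∫ t, f t * Complex.exp (Complex.I * ((∑ i, E i * t i : ℝ) : ℂ)) ∂μ
      ).HasTemperateGrowth := by
  let L : (ι → ℝ) →L[ℝ] (ι → ℝ) →L[ℝ] ℝ := (-(2 * Real.pi)⁻¹ : ℝ) •
    ∑ i, (ContinuousLinearMap.mul ℝ ℝ).bilinearComp (ContinuousLinearMap.proj i)
      (ContinuousLinearMap.proj i)
  have hL : ∀ t E, L t E = -(2 * Real.pi)⁻¹ * ∑ i, t i * E i := fun t E => by
    simp [L]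
  have e : (fun E : ι → ℝ => ∫ t, f t * Complex.exp (Complex.I * ((∑ i, E i * t i : ℝ) : ℂ)) ∂μ)
      = fourierIntegral Real.fourierChar μ L.toLinearMap₁₂ f := by
    funext E
    rw [fourierIntegral]
    refine integral_congr_ae (.of_forall fun t => ?_)
    change _ = Real.fourierChar (-(L t E)) • f t
    rw [hL, Circle.smul_def, Real.fourierChar_apply, smul_eq_mul]
    refine (mul_comm _ _).trans ?_
    congr 2
    have : (Real.pi : ℂ) ≠ 0 := by exact_mod_cast Real.pi_ne_zero
    rw [Finset.sum_congr rfl fun i _ => mul_comm (t i) (E i)]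
    push_cast
    field_simp
  rw [e]
  refine ⟨contDiff_fourierIntegral L fun n _ => hf n, fun n => ⟨0,
    ∫ t, ‖fourierPowSMulRight L f t n‖ ∂μ, fun E => ?_⟩⟩
  rw [iteratedFDeriv_fourierIntegral (N := ⊤) L (fun n _ => hf n) hm (by exact_mod_cast le_top)]
  simpa using norm_fourierIntegral_le_integral_norm Real.fourierChar μ L.toLinearMap₁₂
    (fun t => fourierPowSMulRight L f t n) E

/-- Plane waves in time have temperate growth in the energy. -/
theorem hasTemperateGrowth_exp (t : ℝ) :
    (fun E : ℝ => Complex.exp (Complex.I * ((E * t : ℝ) : ℂ))).HasTemperateGrowth := by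
  have h := hasTemperateGrowth_oscillatory (ι := Unit) (Measure.dirac fun _ => t) (fun _ => 1)
    (fun n => integrable_dirac (by simp)) aestronglyMeasurable_const
  have h2 := h.comp (f := fun E : ℝ => fun _ : Unit => E) (hasTemperateGrowth_pi fun _ => .id)
  simpa [Function.comp_def] using h2

/-- The time-ordered oscillatory integral of the cutoff in time. -/
def orderedFourier (lamT : 𝓢(ℝ, ℂ)) {N : ℕ} (E : Fin N → ℝ) : ℂ :=
  ∫ t in ordered N, (∏ M, lamT (t M)) * Complex.exp (Complex.I * ((∑ M, E M * t M : ℝ) : ℂ))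

theorem isSchwartz_prod_lamT (lamT : 𝓢(ℝ, ℂ)) (N : ℕ) :
    IsSchwartz fun t : Fin N → ℝ => ∏ M, lamT (t M) :=
  IsSchwartz.pi_prod fun _ => isSchwartz_coe lamT

theorem integrable_prod_lamT (lamT : 𝓢(ℝ, ℂ)) (N : ℕ) :
    Integrable fun t : Fin N → ℝ => ∏ M, lamT (t M) :=
  Integrable.fintype_prod fun _ => lamT.integrable

theorem hasTemperateGrowth_orderedFourier (lamT : 𝓢(ℝ, ℂ)) (N : ℕ) :
    (orderedFourier lamT (N := N)).HasTemperateGrowth := by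
  obtain ⟨F, hF⟩ := isSchwartz_prod_lamT lamT N
  have hm : AEStronglyMeasurable (fun t : Fin N → ℝ => ∏ M, lamT (t M))
      (volume.restrict (ordered N)) := (integrable_prod_lamT lamT N).aestronglyMeasurable.restrict
  refine hasTemperateGrowth_oscillatory (volume.restrict (ordered N)) _ (fun n => ?_) hm
  have h1 : (volume : Measure (Fin N → ℝ)).HasTemperateGrowth :=
    Measure.IsAddHaarMeasure.instHasTemperateGrowth (h := inferInstance)
  have h := (F.integrable_pow_mul volume n).restrict (s := ordered N)
  simpa only [hF] using h

theorem norm_orderedFourier_le (lamT : 𝓢(ℝ, ℂ)) (N : ℕ) :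
    ∃ C, 0 ≤ C ∧ ∀ E : Fin N → ℝ, ‖orderedFourier lamT E‖ ≤ C := by
  refine ⟨∫ t in ordered N, ‖∏ M, lamT (t M)‖, integral_nonneg fun _ => norm_nonneg _,
    fun E => (norm_integral_le_integral_norm _).trans (le_of_eq ?_)⟩
  congr 1
  funext t
  rw [norm_mul, mul_comm Complex.I, Complex.norm_exp_ofReal_mul_I, mul_one]

/-- The Fourier transform of the cutoff in space. -/
def spaceFourier (lamX : 𝓢(Mom, ℂ)) (P : Mom) : ℂ :=
  ∫ x, lamX x * Complex.exp (-(Complex.I * ((⟪P, x⟫_ℝ : ℝ) : ℂ)))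

open FourierTransform in
theorem isSchwartz_spaceFourier (lamX : 𝓢(Mom, ℂ)) : IsSchwartz (spaceFourier lamX) := by
  have h := (isSchwartz_coe (𝓕 lamX)).comp_injective
    (((2 * Real.pi)⁻¹ : ℝ) • (LinearMap.id : Mom →ₗ[ℝ] Mom))
    (smul_right_injective Mom (by positivity : ((2 * Real.pi)⁻¹ : ℝ) ≠ 0))
  refine h.congr fun P => ?_
  rw [SchwartzMap.fourier_coe, Real.fourier_eq, spaceFourier]
  refine integral_congr_ae (.of_forall fun x => ?_)
  simp only [LinearMap.smul_apply, LinearMap.id_apply]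
  rw [Circle.smul_def, Real.fourierChar_apply, smul_eq_mul, mul_comm]
  congr 2
  rw [inner_smul_right, real_inner_comm]
  have : (Real.pi : ℂ) ≠ 0 := by exact_mod_cast Real.pi_ne_zero
  push_cast
  field_simp

/-! ### The momentum kernel of a vertex -/

section VertexKernel

variable {n : ℕ} {m : ℝ}

theorem sum_norm_sub_mean {H : Type} [NormedAddCommGroup H] [InnerProductSpace ℝ H] (hn : 1 ≤ n)
    (v : Fin n → H) : ∑ j, ‖v j - (1 / (n : ℝ)) • ∑ l, v l‖ ^ 2 =
      ∑ j, ‖v j‖ ^ 2 - (1 / (n : ℝ)) * ∑ j, ∑ l, ⟪v j, v l⟫_ℝ := by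
  have hn' : (n : ℝ) ≠ 0 := by exact_mod_cast (by omega : n ≠ 0)
  have h1 : ∑ j, ∑ l, ⟪v j, v l⟫_ℝ = ‖∑ l, v l‖ ^ 2 := by
    rw [← real_inner_self_eq_norm_sq, sum_inner]
    simp only [inner_sum]
  have h2 : ∑ j, ⟪v j, ∑ l, v l⟫_ℝ = ‖∑ l, v l‖ ^ 2 := by
    rw [← real_inner_self_eq_norm_sq, sum_inner]
  simp only [norm_sub_sq_real, Finset.sum_add_distrib, Finset.sum_sub_distrib, inner_smul_right,
    ← Finset.mul_sum, h1, h2, norm_smul, mul_pow, Finset.sum_const, Finset.card_univ,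
    Fintype.card_fin, nsmul_eq_mul]
  rw [Real.norm_eq_abs, sq_abs]
  field_simp
  ring

/-- The kernel `r_n` in terms of the deviations of the momenta from their mean. -/
theorem rKer_eq (hn : 1 ≤ n) (κ : Fin n → ℝ × Mom) :
    rKer κ = Real.exp (-(1 / 2) * ∑ j, ‖(κ j).2 - (1 / (n : ℝ)) • ∑ l, (κ l).2‖ ^ 2) *
      Real.exp (-(1 / 2) * ∑ j, ((κ j).1 - (1 / (n : ℝ)) * ∑ l, (κ l).1) ^ 2) := by
  have h1 := sum_norm_sub_mean hn fun j => (κ j).2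
  have h2 := sum_norm_sub_mean hn fun j => (κ j).1
  simp only [Real.norm_eq_abs, sq_abs, smul_eq_mul] at h2
  rw [h1, h2, ← Real.exp_add, rKer]
  congr 1
  simp only [Finset.sum_add_distrib]
  have h3 : ∀ a b : ℝ, ⟪a, b⟫_ℝ = a * b := fun a b => by simp [mul_comm]
  simp only [h3]
  ring

/-- The total signed energy of the legs of a vertex. -/
def vertexEnergy (m : ℝ) (J : Finset (Fin n)) (k : Fin n → Mom) : ℝ :=
  ∑ j, sgn J j * omega m (k j)

/-- The total signed momentum of the legs of a vertex. -/
def vertexMom (J : Finset (Fin n)) (k : Fin n → Mom) : Mom := ∑ j, sgn J j • k j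

theorem hasTemperateGrowth_leg_energy (hm : 0 < m) (J : Finset (Fin n)) (j : Fin n) :
    (fun k : Fin n → Mom => sgn J j * omega m (k j)).HasTemperateGrowth :=
  (Function.HasTemperateGrowth.const (sgn J j)).mul ((hasTemperateGrowth_omega hm).comp
    (ContinuousLinearMap.proj (R := ℝ) (φ := fun _ : Fin n => Mom) j).hasTemperateGrowth)

theorem hasTemperateGrowth_vertexEnergy (hm : 0 < m) (J : Finset (Fin n)) :
    (vertexEnergy m J).HasTemperateGrowth :=
  Function.HasTemperateGrowth.sum fun j _ => hasTemperateGrowth_leg_energy hm J j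

/-- The factor of `r_n` from the energies has temperate growth: it is a Gaussian of functions of
temperate growth. -/
theorem hasTemperateGrowth_energyFactor (hm : 0 < m) (J : Finset (Fin n)) :
    (fun k : Fin n → Mom => (Real.exp (-(1 / 2) * ∑ j, ((shell m J k j).1 -
      (1 / (n : ℝ)) * ∑ l, (shell m J k l).1) ^ 2) : ℂ)).HasTemperateGrowth := by
  obtain ⟨G, hG⟩ := isSchwartz_gaussian (H := EuclideanSpace ℝ (Fin n))
  have h1 : (fun k : Fin n → Mom => fun j => (shell m J k j).1 -
      (1 / (n : ℝ)) * ∑ l, (shell m J k l).1).HasTemperateGrowth :=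
    hasTemperateGrowth_pi fun j => (hasTemperateGrowth_leg_energy hm J j).sub
      ((Function.HasTemperateGrowth.const _).mul (hasTemperateGrowth_vertexEnergy hm J))
  have h2 := G.hasTemperateGrowth.comp
    ((EuclideanSpace.equiv (Fin n) ℝ).symm.toContinuousLinearMap.hasTemperateGrowth.comp h1)
  convert h2 using 2 with k
  simp only [Function.comp_apply]
  rw [hG]
  beta_reduce
  rw [EuclideanSpace.norm_sq_eq]
  simp

/-- The spatial part of `r_n` and the Fourier transform of the spatial cutoff together are a
Schwartz function: the deviations from the mean and the total momentum determine all momenta. -/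
theorem isSchwartz_spaceFactor (J : Finset (Fin n)) (lamX : 𝓢(Mom, ℂ)) :
    IsSchwartz fun k : Fin n → Mom => (Real.exp (-(1 / 2) * ∑ j, ‖(shell m J k j).2 -
      (1 / (n : ℝ)) • ∑ l, (shell m J k l).2‖ ^ 2) : ℂ) * spaceFourier lamX (vertexMom J k) := by
  let D : (Fin n → Mom) →ₗ[ℝ] (Fin n → Mom) :=
    { toFun := fun k j => sgn J j • k j - (1 / (n : ℝ)) • ∑ l, sgn J l • k l
      map_add' := fun x y => by
        funext j
        simp only [Pi.add_apply, smul_add, Finset.sum_add_distrib]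
        abel
      map_smul' := fun c x => by
        funext j
        simp only [Pi.smul_apply, RingHom.id_apply, smul_sub, Finset.smul_sum, smul_smul]
        congr 1
        · rw [mul_comm]
        · exact Finset.sum_congr rfl fun l _ => by congr 1; ring }
  let P : (Fin n → Mom) →ₗ[ℝ] Mom :=
    { toFun := fun k => ∑ l, sgn J l • k l
      map_add' := fun x y => by simp [Finset.sum_add_distrib]
      map_smul' := fun c x => by simp [Finset.smul_sum, smul_smul, mul_comm] }
  let L : (Fin n → Mom) →ₗ[ℝ] PiLp 2 (fun _ : Fin n => Mom) × Mom :=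
    ((WithLp.linearEquiv 2 ℝ (Fin n → Mom)).symm.toLinearMap ∘ₗ D).prod P
  have hs : ∀ j, sgn J j ≠ 0 := fun j => by unfold sgn; split_ifs <;> norm_num
  have hL : Function.Injective L := fun x y h => by
    have h1 : D x = D y := (WithLp.linearEquiv 2 ℝ (Fin n → Mom)).symm.injective
      (congrArg Prod.fst h)
    have h2 : P x = P y := congrArg Prod.snd h
    funext j
    have h3 : sgn J j • x j - (1 / (n : ℝ)) • P x = sgn J j • y j - (1 / (n : ℝ)) • P y :=
      congrFun h1 j
    rw [h2] at h3
    exact smul_right_injective Mom (hs j) (sub_left_injective h3)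
  refine ((isSchwartz_gaussian (H := PiLp 2 fun _ : Fin n => Mom)).tensor
    (isSchwartz_spaceFourier lamX)).comp_injective L hL |>.congr fun k => ?_
  congr 2
  rw [PiLp.norm_sq_eq_of_L2]
  rfl

/-- The kernel of a vertex without time dependence, energy denominators and constants. -/
theorem isSchwartz_vertexFactor (hn : 1 ≤ n) (hm : 0 < m) (J : Finset (Fin n))
    (lamX : 𝓢(Mom, ℂ)) : IsSchwartz fun k : Fin n → Mom =>
      (rKer (shell m J k) : ℂ) * spaceFourier lamX (vertexMom J k) := by
  refine ((isSchwartz_spaceFactor (m := m) J lamX).temperate_mul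
    (hasTemperateGrowth_energyFactor hm J)).congr fun k => ?_
  rw [rKer_eq hn]
  push_cast
  ring

/-- The normalization constant of the free field, without the energy. -/
def legConst : ℂ := ((1 / ((2 * Real.pi) ^ (3 / 2 : ℝ) * Real.sqrt 2) : ℝ) : ℂ)

theorem exists_vertexBase (hn : 1 ≤ n) (hm : 0 < m) (J : Finset (Fin n)) (lamX : 𝓢(Mom, ℂ)) :
    ∃ v : 𝓢(Fin n → Mom, ℂ), ∀ k, v k = legConst ^ n * (rKer (shell m J k) : ℂ) *
      spaceFourier lamX (vertexMom J k) / ((∏ j, Real.sqrt (omega m (k j)) : ℝ) : ℂ) := by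
  have h1 : ∀ j, (fun k : Fin n → Mom => ((omega m (k j) ^ (-(1 / 2) : ℝ) : ℝ) : ℂ)
      ).HasTemperateGrowth := fun j =>
    Complex.ofRealCLM.hasTemperateGrowth.comp ((hasTemperateGrowth_omega_rpow hm (-(1 / 2))).comp
      (ContinuousLinearMap.proj (R := ℝ) (φ := fun _ : Fin n => Mom) j).hasTemperateGrowth)
  obtain ⟨v, hv⟩ := ((isSchwartz_vertexFactor hn hm J lamX).temperate_mul
    (hasTemperateGrowth_prod Finset.univ h1)).const_mul (legConst ^ n)
  refine ⟨v, fun k => ?_⟩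
  have h2 : ((∏ j, Real.sqrt (omega m (k j)) : ℝ) : ℂ)⁻¹ =
      ∏ j, ((omega m (k j) ^ (-(1 / 2) : ℝ) : ℝ) : ℂ) := by
    push_cast
    rw [← Finset.prod_inv_distrib]
    refine Finset.prod_congr rfl fun j _ => ?_
    rw [Real.rpow_neg (omega_pos hm _).le, ← Real.sqrt_eq_rpow]
    push_cast
    rfl
  rw [hv]
  beta_reduce
  rw [div_eq_mul_inv (legConst ^ n * _ * _), h2]
  ring

theorem exists_vertexKer (hm : 0 < m) (J : Finset (Fin n)) (v : 𝓢(Fin n → Mom, ℂ))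
    (lamT : 𝓢(ℝ, ℂ)) (t : ℝ) : ∃ w : 𝓢(Fin n → Mom, ℂ), ∀ k, w k =
      lamT t * Complex.exp (Complex.I * ((vertexEnergy m J k * t : ℝ) : ℂ)) * v k := by
  obtain ⟨w, hw⟩ := ((isSchwartz_coe v).temperate_mul ((hasTemperateGrowth_exp t).comp
    (hasTemperateGrowth_vertexEnergy hm J))).const_mul (lamT t)
  exact ⟨w, fun k => by rw [hw]; simp only [Function.comp_apply]; ring⟩

theorem planeWave_shell (J : Finset (Fin n)) (k : Fin n → Mom) (t : ℝ) (x : Mom) :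
    planeWave (shell m J k) t x = Complex.exp (Complex.I * ((vertexEnergy m J k * t : ℝ) : ℂ)) *
      Complex.exp (-(Complex.I * ((⟪vertexMom J k, x⟫_ℝ : ℝ) : ℂ))) := by
  rw [planeWave, ← Complex.exp_add]
  congr 1
  simp only [shell, vertexEnergy, vertexMom, Finset.sum_sub_distrib, sum_inner, ← Finset.sum_mul]
  push_cast
  ring

end VertexKernel

/-! ### The momentum kernels of the Dyson series -/

section DysonKernel

variable {n N : ℕ} {m : ℝ}

/-- The integrals over space are Fourier transforms of the cutoff, one for each vertex; the integral
over the ordered times does not factorize. -/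
theorem dysonKernel_eq (lamT : 𝓢(ℝ, ℂ)) (lamX : 𝓢(Mom, ℂ)) (J : Fin N → Finset (Fin n))
    (k : Fin N → Fin n → Mom) : dysonKernel n m lamT lamX J k =
      legConst ^ (n * N) * (∏ M, (rKer (shell m (J M) (k M)) : ℂ) *
        spaceFourier lamX (vertexMom (J M) (k M))) *
        orderedFourier lamT fun M => vertexEnergy m (J M) (k M) := by
  rw [dysonKernel, mul_assoc]
  congr 1
  have h : ∀ t : Fin N → ℝ, (∫ x : Fin N → Mom, ∏ M, (lamT (t M) * lamX (x M) *
      (rKer (shell m (J M) (k M)) : ℂ) * planeWave (shell m (J M) (k M)) (t M) (x M))) =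
      (∏ M, (rKer (shell m (J M) (k M)) : ℂ) * spaceFourier lamX (vertexMom (J M) (k M))) *
        ((∏ M, lamT (t M)) * Complex.exp (Complex.I *
          ((∑ M, vertexEnergy m (J M) (k M) * t M : ℝ) : ℂ))) := by
    intro t
    rw [integral_fintype_prod_volume_eq_prod fun M x => lamT (t M) * lamX x *
      (rKer (shell m (J M) (k M)) : ℂ) * planeWave (shell m (J M) (k M)) (t M) x]
    have h1 : ∀ M, (∫ x, lamT (t M) * lamX x * (rKer (shell m (J M) (k M)) : ℂ) *
        planeWave (shell m (J M) (k M)) (t M) x) =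
        (rKer (shell m (J M) (k M)) : ℂ) * spaceFourier lamX (vertexMom (J M) (k M)) *
        (lamT (t M) * Complex.exp (Complex.I * ((vertexEnergy m (J M) (k M) * t M : ℝ) : ℂ))) := by
      intro M
      rw [spaceFourier, mul_assoc, mul_comm (∫ x, _), ← mul_assoc, ← integral_const_mul]
      refine integral_congr_ae (.of_forall fun x => ?_)
      simp only [planeWave_shell]
      ring
    simp only [h1, Finset.prod_mul_distrib]
    congr 2
    rw [← Complex.exp_sum]
    congr 1
    push_cast
    rw [Finset.mul_sum]
  simp only [h]
  rw [integral_const_mul, orderedFourier]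

theorem hasTemperateGrowth_orderedFourier_energy (hm : 0 < m) (lamT : 𝓢(ℝ, ℂ))
    (J : Fin N → Finset (Fin n)) : (fun k : Fin N → Fin n → Mom =>
      orderedFourier lamT fun M => vertexEnergy m (J M) (k M)).HasTemperateGrowth :=
  (hasTemperateGrowth_orderedFourier lamT N).comp (hasTemperateGrowth_pi fun M =>
    (hasTemperateGrowth_vertexEnergy hm (J M)).comp
      (ContinuousLinearMap.proj (R := ℝ) (φ := fun _ : Fin N => Fin n → Mom) M).hasTemperateGrowth)

/-- The time-ordered integral has temperate growth in the momenta, the other factors form a Schwartz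
function. -/
theorem isSchwartz_dysonKernel (hn : 1 ≤ n) (hm : 0 < m) (lamT : 𝓢(ℝ, ℂ)) (lamX : 𝓢(Mom, ℂ))
    (J : Fin N → Finset (Fin n)) : IsSchwartz (dysonKernel n m lamT lamX J) := by
  refine (((IsSchwartz.pi_prod fun M => isSchwartz_vertexFactor hn hm (J M) lamX).temperate_mul
    (hasTemperateGrowth_orderedFourier_energy hm lamT J)).const_mul
      (legConst ^ (n * N))).congr fun k => ?_
  rw [dysonKernel_eq]
  ring

/-- The time-ordered integral is bounded, the Fourier transforms of the spatial cutoff absorb any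
power of the total momenta, and the kernels `r_n` give the Gaussian. -/
theorem dysonKernel_gaussian_bound (hn : 1 ≤ n) (lamT : 𝓢(ℝ, ℂ)) (lamX : 𝓢(Mom, ℂ))
    (J : Fin N → Finset (Fin n)) (d : ℕ) : ∃ C : ℝ, ∀ k : Fin N → Fin n → Mom,
      ‖dysonKernel n m lamT lamX J k‖ * ∏ M, (1 + ‖vertexSum J k M‖) ^ d ≤
        C * Real.exp (-(1 / 2) * vertexSpread m J k) := by
  obtain ⟨C, hC, hF⟩ := norm_orderedFourier_le lamT N
  obtain ⟨Λ, hΛ⟩ := isSchwartz_spaceFourier lamX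
  have hd := fun P => SchwartzMap.one_add_le_sup_seminorm_apply (𝕜 := ℝ)
    (m := (d, 0)) (k := d) (n := 0) le_rfl le_rfl Λ P
  simp only [norm_iteratedFDeriv_zero, hΛ] at hd
  set B := (2 : ℝ) ^ (d, 0).1 * (Finset.Iic (d, 0)).sup (fun m => SchwartzMap.seminorm ℝ m.1 m.2) Λ
  have hB : 0 ≤ B := le_trans (by positivity) (hd 0)
  refine ⟨‖legConst ^ (n * N)‖ * B ^ N * C, fun k => ?_⟩
  have hr : ∏ M, rKer (shell m (J M) (k M)) = Real.exp (-(1 / 2) * vertexSpread m J k) := by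
    rw [vertexSpread, Finset.mul_sum, Real.exp_sum]
    refine Finset.prod_congr rfl fun M _ => ?_
    rw [rKer_eq hn, ← Real.exp_add, ← mul_add, ← Finset.sum_add_distrib]
    congr 2
    exact Finset.sum_congr rfl fun j _ => add_comm _ _
  rw [dysonKernel_eq, Finset.prod_mul_distrib, norm_mul, norm_mul, norm_mul, ← Complex.ofReal_prod,
    hr, Complex.norm_real, Real.norm_of_nonneg (Real.exp_pos _).le]
  have h1 : ‖∏ M, spaceFourier lamX (vertexMom (J M) (k M))‖ *
      ∏ M, (1 + ‖vertexSum J k M‖) ^ d ≤ B ^ N := by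
    rw [norm_prod, ← Finset.prod_mul_distrib]
    refine (Finset.prod_le_prod (fun M _ => by positivity) fun M _ => ?_).trans
      (b := ∏ _M : Fin N, B) (by simp)
    rw [mul_comm]
    exact hd _
  have h2 := hF fun M => vertexEnergy m (J M) (k M)
  set X := ‖∏ M, spaceFourier lamX (vertexMom (J M) (k M))‖
  set Y := ∏ M, (1 + ‖vertexSum J k M‖) ^ d
  set Z := ‖orderedFourier lamT fun M => vertexEnergy m (J M) (k M)‖
  set R := Real.exp (-(1 / 2) * vertexSpread m J k)
  have hR : 0 < R := Real.exp_pos _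
  calc _ = ‖legConst ^ (n * N)‖ * R * ((X * Y) * Z) := by ring
    _ ≤ ‖legConst ^ (n * N)‖ * R * (B ^ N * C) := by gcongr
    _ = _ := by ring

end DysonKernel

/-! ### The cutoff Hamiltonian -/

section Hamiltonian

variable {n : ℕ} {m : ℝ}

theorem prod_wt_sort (J : Finset (Fin n)) (k : Fin n → Mom) :
    ((J.sort (· ≤ ·)).map fun j => wt (k j)).prod *
      ((Jᶜ.sort (· ≤ ·)).map fun j => wt (k j)).prod = ∏ j, wt (k j) := by
  rw [← List.prod_toFinset _ (J.sort_nodup _), ← List.prod_toFinset _ ((Jᶜ).sort_nodup _),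
    Finset.sort_toFinset, Finset.sort_toFinset, Finset.prod_mul_prod_compl]

theorem continuous_normalForm_legs (J : Finset (Fin n)) (Φ Ψ : SchwartzFock) :
    Continuous fun k : Fin n → Mom =>
      normalForm ((J.sort (· ≤ ·)).map k) ((Jᶜ.sort (· ≤ ·)).map k) Φ Ψ :=
  continuous_normalForm (f := fun (j : Fin n) (k : Fin n → Mom) => k j)
    (fun j => continuous_apply j) _ _ Φ Ψ

theorem exists_normalForm_legs_bound (J : Finset (Fin n)) (Φ Ψ : SchwartzFock) :
    ∃ C, 0 ≤ C ∧ ∀ k : Fin n → Mom,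
      ‖normalForm ((J.sort (· ≤ ·)).map k) ((Jᶜ.sort (· ≤ ·)).map k) Φ Ψ‖ ≤
        C * ∏ j, wt (k j) := by
  obtain ⟨C, hC, h⟩ := exists_normalForm_bound (f := fun (j : Fin n) (k : Fin n → Mom) => k j)
    (fun j => continuous_apply j) (J.sort (· ≤ ·)) (Jᶜ.sort (· ≤ ·)) Φ Ψ
  exact ⟨C, hC, fun k => by simpa only [prod_wt_sort] using h k⟩

theorem rKer_nonneg (κ : Fin n → ℝ × Mom) : 0 ≤ rKer κ := (Real.exp_pos _).le

theorem rKer_le_one (hn : 1 ≤ n) (κ : Fin n → ℝ × Mom) : rKer κ ≤ 1 := by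
  rw [rKer_eq hn, ← Real.exp_add, Real.exp_le_one_iff]
  have h1 : 0 ≤ ∑ j, ‖(κ j).2 - (1 / (n : ℝ)) • ∑ l, (κ l).2‖ ^ 2 := by positivity
  have h2 : 0 ≤ ∑ j, ((κ j).1 - (1 / (n : ℝ)) * ∑ l, (κ l).1) ^ 2 := by positivity
  linarith

theorem continuous_omega : Continuous (omega m) := by
  unfold omega
  fun_prop

theorem continuous_rKer_shell (J : Finset (Fin n)) :
    Continuous fun k : Fin n → Mom => rKer (shell m J k) := by
  have h := continuous_omega (m := m)
  unfold rKer shell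
  fun_prop

/-- The product of the normalization factors of the legs of a vertex. -/
def legFactor (m : ℝ) (k : Fin n → Mom) : ℝ :=
  ∏ j, 1 / ((2 * Real.pi) ^ (3 / 2 : ℝ) * Real.sqrt (2 * omega m (k j)))

theorem legFactor_eq (m : ℝ) (k : Fin n → Mom) : (legFactor m k : ℂ) =
    legConst ^ n / ((∏ j, Real.sqrt (omega m (k j)) : ℝ) : ℂ) := by
  rw [legConst, ← Complex.ofReal_pow, ← Complex.ofReal_div]
  congr 1
  rw [legFactor, ← Fin.prod_const, ← Finset.prod_div_distrib]
  refine Finset.prod_congr rfl fun j _ => ?_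
  rw [Real.sqrt_mul (by norm_num), div_div, mul_assoc]

theorem continuous_legFactor (hm : 0 < m) : Continuous (legFactor (n := n) m) := by
  refine continuous_finsetProd _ fun j _ => Continuous.div continuous_const ?_ fun k => ?_
  · have h := continuous_omega (m := m)
    fun_prop
  · have h1 : 0 < Real.sqrt (2 * omega m (k j)) :=
      Real.sqrt_pos.2 (mul_pos two_pos (omega_pos hm _))
    positivity

theorem exists_legFactor_bound (hm : 0 < m) :
    ∃ C, 0 ≤ C ∧ ∀ k : Fin n → Mom, ‖legFactor m k‖ ≤ C := by
  -- The energy is bounded below by the mass.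
  refine ⟨∏ _j : Fin n, 1 / ((2 * Real.pi) ^ (3 / 2 : ℝ) * Real.sqrt (2 * m)), by positivity,
    fun k => ?_⟩
  rw [legFactor, Real.norm_of_nonneg (by positivity)]
  refine Finset.prod_le_prod (fun j _ => by positivity) fun j _ => ?_
  have h1 : m ≤ omega m (k j) := Real.le_sqrt_of_sq_le (by nlinarith [sq_nonneg ‖k j‖])
  gcongr

theorem norm_planeWave (κ : Fin n → ℝ × Mom) (t : ℝ) (x : Mom) : ‖planeWave κ t x‖ = 1 := by
  rw [planeWave, mul_comm, Complex.norm_exp_ofReal_mul_I]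

theorem continuous_planeWave_shell (J : Finset (Fin n)) (t : ℝ) :
    Continuous fun z : Mom × (Fin n → Mom) => planeWave (shell m J z.2) t z.1 := by
  have h := continuous_omega (m := m)
  unfold planeWave shell
  fun_prop

variable (hn : 1 ≤ n) (hm : 0 < m) (J : Finset (Fin n)) (lamT : 𝓢(ℝ, ℂ)) (lamX : 𝓢(Mom, ℂ))

/-- The momentum kernel of a vertex without its time dependence. -/
def vertexBase : 𝓢(Fin n → Mom, ℂ) := (exists_vertexBase hn hm J lamX).choose

theorem vertexBase_apply (k : Fin n → Mom) : vertexBase hn hm J lamX k =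
    legConst ^ n * (rKer (shell m J k) : ℂ) *
      spaceFourier lamX (vertexMom J k) / ((∏ j, Real.sqrt (omega m (k j)) : ℝ) : ℂ) :=
  (exists_vertexBase hn hm J lamX).choose_spec k

/-- The momentum kernel of the vertex of the cutoff interaction at time `t`. -/
def vertexKer (t : ℝ) : 𝓢(Fin n → Mom, ℂ) :=
  (exists_vertexKer hm J (vertexBase hn hm J lamX) lamT t).choose

theorem vertexKer_apply (t : ℝ) (k : Fin n → Mom) : vertexKer hn hm J lamT lamX t k =
    lamT t * Complex.exp (Complex.I * ((vertexEnergy m J k * t : ℝ) : ℂ)) *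
      vertexBase hn hm J lamX k :=
  (exists_vertexKer hm J (vertexBase hn hm J lamX) lamT t).choose_spec k

/-- Smearing the interaction in space produces the kernel `vertexKer`. -/
theorem vertexKer_eq_integral (t : ℝ) (k : Fin n → Mom) : vertexKer hn hm J lamT lamX t k =
    ∫ x, lamT t * lamX x * ((legFactor m k : ℂ) * (rKer (shell m J k) : ℂ) *
      planeWave (shell m J k) t x) := by
  rw [vertexKer_apply, vertexBase_apply, spaceFourier, legFactor_eq]
  simp only [planeWave_shell]
  set w : ℂ := ((∏ j, Real.sqrt (omega m (k j)) : ℝ) : ℂ)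
  have e : ∀ x, lamT t * lamX x * (legConst ^ n / w * (rKer (shell m J k) : ℂ) *
      (Complex.exp (Complex.I * ((vertexEnergy m J k * t : ℝ) : ℂ)) *
        Complex.exp (-(Complex.I * ((⟪vertexMom J k, x⟫_ℝ : ℝ) : ℂ))))) =
      (lamT t * Complex.exp (Complex.I * ((vertexEnergy m J k * t : ℝ) : ℂ)) *
        (legConst ^ n * (rKer (shell m J k) : ℂ) / w)) *
      (lamX x * Complex.exp (-(Complex.I * ((⟪vertexMom J k, x⟫_ℝ : ℝ) : ℂ)))) := fun x => by
    ring
  simp only [e]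
  rw [integral_const_mul]
  ring

/-- Fubini's theorem for the smeared interaction applies because the quadratic form of the normally
ordered monomial decays in the momenta. -/
theorem integrable_ham (hn : 1 ≤ n) (hm : 0 < m) (t : ℝ) (Φ Ψ : SchwartzFock) :
    Integrable (fun z : Mom × (Fin n → Mom) =>
      lamT t * lamX z.1 * ((legFactor m z.2 : ℂ) * (rKer (shell m J z.2) : ℂ) *
        planeWave (shell m J z.2) t z.1 *
        normalForm ((J.sort (· ≤ ·)).map z.2) ((Jᶜ.sort (· ≤ ·)).map z.2) Φ Ψ))
      (volume.prod volume) := by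
  obtain ⟨C, hC, hb⟩ := exists_normalForm_legs_bound J Φ Ψ
  obtain ⟨C', hC', hb'⟩ := exists_legFactor_bound (n := n) hm
  have hi := (lamX.integrable (μ := volume)).norm.mul_prod (integrable_prod_wt (Fin n))
  refine (hi.const_mul (‖lamT t‖ * (C' * C))).mono' ?_ (.of_forall fun z => ?_)
  · refine Continuous.aestronglyMeasurable ?_
    have h1 := (continuous_normalForm_legs J Φ Ψ).comp (continuous_snd (X := Mom))
    have h2 := (Complex.continuous_ofReal.comp (continuous_legFactor (n := n) hm)).comp
      (continuous_snd (X := Mom))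
    have h3 := (Complex.continuous_ofReal.comp (continuous_rKer_shell (m := m) J)).comp
      (continuous_snd (X := Mom))
    exact (continuous_const.mul (lamX.continuous.comp continuous_fst)).mul
      (((h2.mul h3).mul (continuous_planeWave_shell J t)).mul h1)
  · rw [norm_mul, norm_mul, norm_mul, norm_mul, norm_mul, norm_planeWave, Complex.norm_real,
      Complex.norm_real, Real.norm_of_nonneg (rKer_nonneg _), mul_one]
    have h1 := hb z.2
    have h2 := hb' z.2
    have h3 := rKer_le_one hn (shell m J z.2)
    have h4 := rKer_nonneg (shell m J z.2)
    calc _ ≤ ‖lamT t‖ * ‖lamX z.1‖ * (C' * 1 * (C * ∏ j, wt (z.2 j))) := by gcongr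
      _ = _ := by ring

/-- The cutoff Hamiltonian at time `t`. -/
def ham (t : ℝ) : Module.End ℂ SchwartzFock :=
  ∑ J : Finset (Fin n), opVertex J (vertexKer hn hm J lamT lamX t)

theorem isCutoffHamiltonian_ham :
    IsCutoffHamiltonian n m lamT lamX (ham hn hm lamT lamX) := by
  intro t Φ Ψ
  have hi := fun J : Finset (Fin n) => integrable_ham J lamT lamX hn hm t Φ Ψ
  rw [ham, LinearMap.sum_apply, map_sum, inner_sum, hamForm]
  have h1 : ∀ x, lamT t * lamX x * leffForm n m t x Φ Ψ = ∑ J : Finset (Fin n), ∫ k,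
      lamT t * lamX x * ((legFactor m k : ℂ) * (rKer (shell m J k) : ℂ) *
        planeWave (shell m J k) t x *
        normalForm ((J.sort (· ≤ ·)).map k) ((Jᶜ.sort (· ≤ ·)).map k) Φ Ψ) := fun x => by
    rw [leffForm, Finset.mul_sum]
    exact Finset.sum_congr rfl fun J _ => (integral_const_mul _ _).symm
  simp only [h1]
  rw [integral_finsetSum Finset.univ (f := fun J x => ∫ k,
      lamT t * lamX x * ((legFactor m k : ℂ) * (rKer (shell m J k) : ℂ) *
        planeWave (shell m J k) t x *
        normalForm ((J.sort (· ≤ ·)).map k) ((Jᶜ.sort (· ≤ ·)).map k) Φ Ψ))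
    fun J _ => (hi J).integral_prod_left]
  refine Finset.sum_congr rfl fun J _ => ?_
  rw [inner_opVertex, integral_integral_swap (hi J)]
  refine integral_congr_ae (.of_forall fun k => ?_)
  beta_reduce
  rw [vertexKer_eq_integral, ← integral_mul_const]
  refine integral_congr_ae (.of_forall fun x => ?_)
  ring

theorem IsCutoffHamiltonian.eq {H H' : ℝ → Module.End ℂ SchwartzFock}
    (h : IsCutoffHamiltonian n m lamT lamX H) (h' : IsCutoffHamiltonian n m lamT lamX H') :
    H = H' :=
  funext fun t => LinearMap.ext fun Ψ => ext_inner_toFock fun X => by rw [h, h']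

end Hamiltonian

/-! ### The terms of the Dyson series -/

section Dyson

instance volumeProdProdHasTemperateGrowth (r s c : ℕ) :
    (volume : Measure (((Fin r → Mom) × (Fin s → Mom)) × (Fin c → Mom))).HasTemperateGrowth := by
  have h1 : (volume : Measure ((Fin r → Mom) × (Fin s → Mom))).IsAddHaarMeasure :=
    Measure.prod.instIsAddHaarMeasure _ _
  exact Measure.IsAddHaarMeasure.instHasTemperateGrowth
    (h := Measure.prod.instIsAddHaarMeasure _ _)

instance volumeProdProdSFinite (r s c : ℕ) :
    SFinite (volume : Measure (((Fin r → Mom) × (Fin s → Mom)) × (Fin c → Mom))) := by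
  have h1 : SFinite (volume : Measure ((Fin r → Mom) × (Fin s → Mom))) :=
    Measure.prod.instSFinite (μ := volume) (ν := volume)
  exact Measure.prod.instSFinite (μ := volume) (ν := volume)

variable {n N : ℕ} {m : ℝ}

/-- The quadratic form of a Wick term as an integral over the free and the contracted momenta. -/
theorem WickTerm.inner_op (τ : WickTerm n N) (V : 𝓢(Fin N → Fin n → Mom, ℂ))
    (Φ Ψ : SchwartzFock) : ⟪toFock Φ, toFock (τ.op V Ψ)⟫_ℂ =
      ∫ y : ((Fin τ.r → Mom) × (Fin τ.s → Mom)) × (Fin τ.c → Mom),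
        V (τ.momentaL y) * normalForm (List.ofFn y.1.1) (List.ofFn y.1.2) Φ Ψ := by
  obtain ⟨C, hC, h⟩ := exists_normalForm_ofFn_bound τ.r τ.s Φ Ψ
  obtain ⟨W, hW⟩ := (isSchwartz_coe V).comp_injective τ.momentaL τ.momentaL_injective
  have hi := (W.integrable (μ := volume)).mul_bdd
    ((continuous_normalForm_ofFn Φ Ψ).comp continuous_fst).aestronglyMeasurable
    (.of_forall fun y => h y.1)
  simp only [hW] at hi
  rw [WickTerm.op, inner_wickOp, wickForm]
  refine Eq.trans ?_ (integral_prod (μ := volume) (ν := volume) _ hi).symm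
  refine integral_congr_ae (.of_forall fun z => ?_)
  beta_reduce
  rw [WickTerm.contract_apply, ← integral_mul_const]
  rfl

variable (hn : 1 ≤ n) (hm : 0 < m) (lamT : 𝓢(ℝ, ℂ)) (lamX : 𝓢(Mom, ℂ))

theorem exists_baseProd (J : Fin N → Finset (Fin n)) : ∃ V : 𝓢(Fin N → Fin n → Mom, ℂ),
    ∀ k, V k = ∏ M, vertexBase hn hm (J M) lamX (k M) :=
  IsSchwartz.pi_prod fun M => isSchwartz_coe (vertexBase hn hm (J M) lamX)

/-- The product of the time independent parts of the vertex kernels. -/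
def baseProd (J : Fin N → Finset (Fin n)) : 𝓢(Fin N → Fin n → Mom, ℂ) :=
  (exists_baseProd hn hm lamX J).choose

theorem baseProd_apply (J : Fin N → Finset (Fin n)) (k : Fin N → Fin n → Mom) :
    baseProd hn hm lamX J k = ∏ M, vertexBase hn hm (J M) lamX (k M) :=
  (exists_baseProd hn hm lamX J).choose_spec k

theorem exists_kerProd (J : Fin N → Finset (Fin n)) (t : Fin N → ℝ) :
    ∃ V : 𝓢(Fin N → Fin n → Mom, ℂ), ∀ k, V k = ∏ M, vertexKer hn hm (J M) lamT lamX (t M) (k M) :=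
  IsSchwartz.pi_prod fun M => isSchwartz_coe (vertexKer hn hm (J M) lamT lamX (t M))

/-- The product of the vertex kernels at the times `t`. -/
def kerProd (J : Fin N → Finset (Fin n)) (t : Fin N → ℝ) : 𝓢(Fin N → Fin n → Mom, ℂ) :=
  (exists_kerProd hn hm lamT lamX J t).choose

theorem kerProd_apply (J : Fin N → Finset (Fin n)) (t : Fin N → ℝ) (k : Fin N → Fin n → Mom) :
    kerProd hn hm lamT lamX J t k = ∏ M, vertexKer hn hm (J M) lamT lamX (t M) (k M) :=
  (exists_kerProd hn hm lamT lamX J t).choose_spec k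

theorem kerProd_eq (J : Fin N → Finset (Fin n)) (t : Fin N → ℝ) (k : Fin N → Fin n → Mom) :
    kerProd hn hm lamT lamX J t k = (∏ M, lamT (t M)) *
      Complex.exp (Complex.I * ((∑ M, vertexEnergy m (J M) (k M) * t M : ℝ) : ℂ)) *
        baseProd hn hm lamX J k := by
  rw [kerProd_apply, baseProd_apply]
  simp only [vertexKer_apply, Finset.prod_mul_distrib]
  rw [← Complex.exp_sum, ← Finset.mul_sum, Complex.ofReal_sum]

theorem exists_reducedKernel (J : Fin N → Finset (Fin n)) : ∃ V : 𝓢(Fin N → Fin n → Mom, ℂ),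
    ∀ k, V k = (orderedFourier lamT fun M => vertexEnergy m (J M) (k M)) *
      baseProd hn hm lamX J k :=
  (isSchwartz_coe (baseProd hn hm lamX J)).temperate_mul
    (hasTemperateGrowth_orderedFourier_energy hm lamT J)

/-- The momentum kernel of the time-ordered product, with the energy denominators. -/
def reducedKernel (J : Fin N → Finset (Fin n)) : 𝓢(Fin N → Fin n → Mom, ℂ) :=
  (exists_reducedKernel hn hm lamT lamX J).choose

theorem reducedKernel_apply (J : Fin N → Finset (Fin n)) (k : Fin N → Fin n → Mom) :
    reducedKernel hn hm lamT lamX J k =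
      (orderedFourier lamT fun M => vertexEnergy m (J M) (k M)) * baseProd hn hm lamX J k :=
  (exists_reducedKernel hn hm lamT lamX J).choose_spec k

theorem reducedKernel_eq (J : Fin N → Finset (Fin n)) (k : Fin N → Fin n → Mom) :
    reducedKernel hn hm lamT lamX J k = dysonKernel n m lamT lamX J k /
      ((∏ M, ∏ j, Real.sqrt (omega m (k M j)) : ℝ) : ℂ) := by
  rw [reducedKernel_apply, dysonKernel_eq, baseProd_apply]
  simp only [vertexBase_apply]
  rw [Finset.prod_div_distrib, Complex.ofReal_prod, pow_mul]
  simp only [Finset.prod_mul_distrib, Finset.prod_const, Finset.card_univ, Fintype.card_fin]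
  ring

theorem contract_reducedKernel (τ : WickTerm n N)
    (z : (Fin τ.r → Mom) × (Fin τ.s → Mom)) :
    τ.contract (reducedKernel hn hm lamT lamX τ.J) z = τ.kernel m lamT lamX z.1 z.2 := by
  rw [WickTerm.contract_apply, WickTerm.kernel]
  simp only [reducedKernel_eq]

/-- The integrand of a Wick term is jointly integrable in the times and the momenta. -/
theorem integrable_term_joint (τ : WickTerm n N) (Φ Ψ : SchwartzFock) :
    Integrable (fun w : (Fin N → ℝ) × (((Fin τ.r → Mom) × (Fin τ.s → Mom)) × (Fin τ.c → Mom)) =>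
      kerProd hn hm lamT lamX τ.J w.1 (τ.momentaL w.2) *
        normalForm (List.ofFn w.2.1.1) (List.ofFn w.2.1.2) Φ Ψ) (volume.prod volume) := by
  obtain ⟨C, hC, h⟩ := exists_normalForm_ofFn_bound τ.r τ.s Φ Ψ
  obtain ⟨W, hW⟩ := (isSchwartz_coe (baseProd hn hm lamX τ.J)).comp_injective τ.momentaL
    τ.momentaL_injective
  have hL : Continuous τ.momentaL := τ.momentaL.continuous_of_finiteDimensional
  have hi := (integrable_prod_lamT lamT N).norm.mul_prod (W.integrable (μ := volume)).norm
  simp only [kerProd_eq]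
  refine (hi.mul_const C).mono' ?_ (.of_forall fun w => ?_)
  · refine Continuous.aestronglyMeasurable ?_
    have c1 : Continuous fun w : (Fin N → ℝ) ×
        (((Fin τ.r → Mom) × (Fin τ.s → Mom)) × (Fin τ.c → Mom)) => ∏ M, lamT (w.1 M) :=
      continuous_finsetProd _ fun M _ =>
        lamT.continuous.comp ((continuous_apply M).comp continuous_fst)
    have c2 : Continuous fun w : (Fin N → ℝ) ×
        (((Fin τ.r → Mom) × (Fin τ.s → Mom)) × (Fin τ.c → Mom)) =>
        ∑ M, vertexEnergy m (τ.J M) (τ.momentaL w.2 M) * w.1 M :=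
      continuous_finsetSum _ fun M _ =>
        ((hasTemperateGrowth_vertexEnergy hm (τ.J M)).1.continuous.comp
          ((continuous_apply M).comp (hL.comp continuous_snd))).mul
            ((continuous_apply M).comp continuous_fst)
    have c3 := (baseProd hn hm lamX τ.J).continuous.comp (hL.comp (continuous_snd (X := Fin N → ℝ)))
    have c4 := (continuous_normalForm_ofFn (r := τ.r) (s := τ.s) Φ Ψ).comp
      ((continuous_fst (Y := Fin τ.c → Mom)).comp (continuous_snd (X := Fin N → ℝ)))
    exact ((c1.mul (Complex.continuous_exp.comp (continuous_const.mul
      (Complex.continuous_ofReal.comp c2)))).mul c3).mul c4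
  · rw [norm_mul, norm_mul, norm_mul, mul_comm Complex.I, Complex.norm_exp_ofReal_mul_I, mul_one]
    have hW' : ∀ y, W y = baseProd hn hm lamX τ.J (τ.momentaL y) := hW
    rw [← hW']
    gcongr
    exact h w.2.1

theorem integrable_term (τ : WickTerm n N) (Φ Ψ : SchwartzFock) :
    Integrable fun t => ⟪toFock Φ, toFock (τ.op (kerProd hn hm lamT lamX τ.J t) Ψ)⟫_ℂ := by
  simp only [WickTerm.inner_op]
  exact (integrable_term_joint hn hm lamT lamX τ Φ Ψ).integral_prod_left

/-- Integrating a Wick term over the ordered times amounts to integrating its kernel. -/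
theorem integral_term (τ : WickTerm n N) (Φ Ψ : SchwartzFock) :
    ∫ t in ordered N, ⟪toFock Φ, toFock (τ.op (kerProd hn hm lamT lamX τ.J t) Ψ)⟫_ℂ =
      ⟪toFock Φ, toFock (τ.op (reducedKernel hn hm lamT lamX τ.J) Ψ)⟫_ℂ := by
  have hi := integrable_term_joint hn hm lamT lamX τ Φ Ψ
  have hi' : Integrable (fun w : (Fin N → ℝ) ×
      (((Fin τ.r → Mom) × (Fin τ.s → Mom)) × (Fin τ.c → Mom)) =>
      kerProd hn hm lamT lamX τ.J w.1 (τ.momentaL w.2) *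
        normalForm (List.ofFn w.2.1.1) (List.ofFn w.2.1.2) Φ Ψ)
      ((volume.restrict (ordered N)).prod volume) := by
    refine hi.mono_measure ?_
    exact Measure.prod_mono Measure.restrict_le_self le_rfl
  simp only [WickTerm.inner_op]
  rw [integral_integral_swap hi']
  refine integral_congr_ae (.of_forall fun y => ?_)
  beta_reduce
  simp only [kerProd_eq]
  rw [integral_mul_const, integral_mul_const, reducedKernel_apply, orderedFourier]

/-- The `N`-fold product of cutoff Hamiltonians as a sum of Wick monomials. -/
theorem prod_ham_eq {L : (Fin N → Finset (Fin n)) → ℕ}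
    {τ : ∀ J, Fin (L J) → WickTerm n N} (hJ : ∀ J i, (τ J i).J = J)
    (hτ : ∀ (J : Fin N → Finset (Fin n)) (v : Fin N → 𝓢(Fin n → Mom, ℂ))
      (V : 𝓢(Fin N → Fin n → Mom, ℂ)), (∀ k, V k = ∏ M, v M (k M)) →
      (List.ofFn fun M => opVertex (J M) (v M)).prod = ∑ i, (τ J i).op V) (t : Fin N → ℝ) :
    (List.ofFn fun M => ham hn hm lamT lamX (t M)).prod =
      ∑ J, ∑ i, (τ J i).op (kerProd hn hm lamT lamX (τ J i).J t) := by
  have h := (MultilinearMap.mkPiAlgebraFin ℂ N (Module.End ℂ SchwartzFock)).map_sum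
    fun (M : Fin N) (J : Finset (Fin n)) => opVertex J (vertexKer hn hm J lamT lamX (t M))
  simp only [MultilinearMap.mkPiAlgebraFin_apply] at h
  refine h.trans (Finset.sum_congr rfl fun J _ => ?_)
  rw [hτ J _ (kerProd hn hm lamT lamX J t) (kerProd_apply hn hm lamT lamX J t)]
  simp only [hJ]

/-- The time-ordered integrals of products of Hamiltonians converge absolutely and are sums of Wick
monomials. The integrand is integrable over all times, not only over the ordered ones. -/
theorem exists_dysonTerm (N : ℕ) : ∃ (L : ℕ) (τ : Fin L → WickTerm n N),
    ∀ Φ Ψ, Integrable (orderedProd (ham hn hm lamT lamX) N Φ Ψ) ∧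
      ∫ t in ordered N, orderedProd (ham hn hm lamT lamX) N Φ Ψ t =
        ⟪toFock Φ, toFock ((∑ i, (τ i).op (reducedKernel hn hm lamT lamX (τ i).J)) Ψ)⟫_ℂ := by
  choose L τ hJ hτ using fun J : Fin N → Finset (Fin n) => exists_wickTerms J
  let e := Fintype.equivFin (Σ J : Fin N → Finset (Fin n), Fin (L J))
  refine ⟨_, fun i => τ (e.symm i).1 (e.symm i).2, fun Φ Ψ => ?_⟩
  have h1 : orderedProd (ham hn hm lamT lamX) N Φ Ψ = fun t => ∑ x : Σ J, Fin (L J),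
      ⟪toFock Φ, toFock ((τ x.1 x.2).op (kerProd hn hm lamT lamX (τ x.1 x.2).J t) Ψ)⟫_ℂ := by
    funext t
    rw [orderedProd, prod_ham_eq hn hm lamT lamX hJ hτ, Fintype.sum_sigma]
    simp only [LinearMap.sum_apply, map_sum, inner_sum]
  have hint := fun x : Σ J, Fin (L J) => integrable_term hn hm lamT lamX (τ x.1 x.2) Φ Ψ
  rw [h1]
  refine ⟨integrable_finsetSum _ fun x _ => hint x, ?_⟩
  rw [integral_finsetSum Finset.univ (f := fun (x : Σ J, Fin (L J)) t =>
      ⟪toFock Φ, toFock ((τ x.1 x.2).op (kerProd hn hm lamT lamX (τ x.1 x.2).J t) Ψ)⟫_ℂ)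
    fun x _ => (hint x).integrableOn]
  simp only [integral_term]
  rw [LinearMap.sum_apply, map_sum, inner_sum]
  exact (Equiv.sum_comp e.symm fun x : Σ J, Fin (L J) => ⟪toFock Φ, toFock ((τ x.1 x.2).op
    (reducedKernel hn hm lamT lamX (τ x.1 x.2).J) Ψ)⟫_ℂ).symm

end Dyson

/-! ### Symmetry of the Hamiltonian for a real cutoff -/

section Symmetric

variable {n : ℕ} {m : ℝ}

theorem sgn_compl (J : Finset (Fin n)) (j : Fin n) : sgn Jᶜ j = -sgn J j := by
  simp only [sgn, Finset.mem_compl]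
  split_ifs <;> simp_all

theorem shell_compl (J : Finset (Fin n)) (k : Fin n → Mom) (j : Fin n) :
    shell m Jᶜ k j = -shell m J k j := by
  simp [shell, sgn_compl]

theorem rKer_shell_compl (J : Finset (Fin n)) (k : Fin n → Mom) :
    rKer (shell m Jᶜ k) = rKer (shell m J k) := by
  simp [rKer, shell_compl]

theorem conj_planeWave_shell (J : Finset (Fin n)) (k : Fin n → Mom) (t : ℝ) (x : Mom) :
    conj (planeWave (shell m J k) t x) = planeWave (shell m Jᶜ k) t x := by
  rw [planeWave, planeWave, ← Complex.exp_conj]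
  congr 1
  simp only [map_mul, Complex.conj_I, Complex.conj_ofReal, shell_compl, Prod.fst_neg, Prod.snd_neg,
    inner_neg_left]
  push_cast
  rw [neg_mul, ← mul_neg, ← Finset.sum_neg_distrib]
  congr 1
  refine Finset.sum_congr rfl fun j _ => ?_
  ring

/-- Exchanging creation and destruction legs shows that the interaction is a symmetric form. -/
theorem conj_leffForm (t : ℝ) (x : Mom) (Φ Ψ : SchwartzFock) :
    conj (leffForm n m t x Φ Ψ) = leffForm n m t x Ψ Φ := by
  rw [leffForm, leffForm, map_sum, ← Equiv.sum_comp (Function.Involutive.toPerm _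
    (compl_involutive (α := Finset (Fin n))))]
  refine Finset.sum_congr rfl fun J _ => ?_
  rw [← integral_conj]
  refine integral_congr_ae (.of_forall fun k => ?_)
  simp only [Function.Involutive.coe_toPerm, map_mul, Complex.conj_ofReal, conj_planeWave_shell,
    conj_normalForm, rKer_shell_compl, compl_compl]

/-- For a real cutoff the Hamiltonians are symmetric. -/
theorem isAdjointOn_of_isCutoffHamiltonian {lamT : 𝓢(ℝ, ℂ)} {lamX : 𝓢(Mom, ℂ)}
    (hreal : ∀ (t : ℝ) (x : Mom), conj (lamT t * lamX x) = lamT t * lamX x)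
    {H : ℝ → Module.End ℂ SchwartzFock} (hH : IsCutoffHamiltonian n m lamT lamX H) (t : ℝ) :
    IsAdjointOn (H t) (H t) := by
  intro Φ Ψ
  rw [← inner_conj_symm, hH, hH, hamForm, hamForm, ← integral_conj]
  refine integral_congr_ae (.of_forall fun x => ?_)
  simp only [map_mul, conj_leffForm] at hreal ⊢
  rw [hreal]

theorem isAdjointOn_prod_reverse (L : List (Module.End ℂ SchwartzFock))
    (h : ∀ A ∈ L, IsAdjointOn A A) : IsAdjointOn L.reverse.prod L.prod := by
  induction L with
  | nil => intro Φ Ψ; simp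
  | cons A L ih =>
    intro Φ Ψ
    rw [List.prod_cons, List.reverse_cons, List.prod_append, List.prod_singleton,
      Module.End.mul_apply, Module.End.mul_apply, h A (by simp), ih fun B hB => h B (by simp [hB])]

end Symmetric

/-! ### Formal unitarity -/

/-- Times which increase along the first `a` indices and decrease along the other indices. -/
def upDown (N a b : ℕ) : Set (Fin N → ℝ) :=
  {τ | (∀ i j : Fin N, i < j → (j : ℕ) < a → τ i < τ j) ∧
    ∀ i j : Fin N, i < j → b ≤ (i : ℕ) → τ j < τ i}

theorem measurableSet_upDown (N a b : ℕ) : MeasurableSet (upDown N a b) := by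
  unfold upDown
  simp only [Set.ofPred_and, Set.ofPred_forall]
  refine MeasurableSet.inter ?_ ?_
  all_goals
    refine MeasurableSet.iInter fun i => MeasurableSet.iInter fun j => MeasurableSet.iInter fun _ =>
      MeasurableSet.iInter fun _ => measurableSet_lt (measurable_pi_apply _) (measurable_pi_apply _)

/-- Coincidences of times form a null set, being contained in a hyperplane. -/
theorem ae_ne {N : ℕ} {i j : Fin N} (h : i ≠ j) : ∀ᵐ τ : Fin N → ℝ, τ i ≠ τ j := by
  let f : (Fin N → ℝ) →ₗ[ℝ] ℝ := (LinearMap.proj i : (Fin N → ℝ) →ₗ[ℝ] ℝ) - LinearMap.proj j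
  have h1 : LinearMap.ker f ≠ ⊤ := fun e => by
    have : Pi.single i 1 ∈ LinearMap.ker f := e ▸ Submodule.mem_top
    simp [f, h.symm] at this
  have h2 := Measure.addHaar_submodule volume (LinearMap.ker f) h1
  refine (measure_eq_zero_iff_ae_notMem.1 h2).mono fun τ hτ e => hτ ?_
  simp [f, e]

theorem upDown_zero (N : ℕ) : upDown N 0 0 = upDown N 1 0 := by
  ext τ
  refine and_congr_left fun _ => ⟨fun _ i j hij hj => ?_, fun _ i j _ hj => absurd hj (by omega)⟩
  have : (i : ℕ) < j := hij
  omega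

theorem upDown_last (N : ℕ) : upDown (N + 1) (N + 1) (N + 1) = upDown (N + 1) (N + 1) N := by
  ext τ
  refine and_congr_right fun _ => ⟨fun _ i j hij hj => ?_, fun _ i j _ hj => ?_⟩
  · have : (i : ℕ) < j := hij
    omega
  · omega

/-- At an index between the two monotone pieces, the larger of the two neighbours joins the two
pieces. -/
theorem upDown_succ_ae {N a : ℕ} (ha : a + 1 < N) :
    upDown N (a + 1) (a + 1) =ᵐ[volume]
      (upDown N (a + 1) a ∪ upDown N (a + 2) (a + 1) : Set _) := by
  let i0 : Fin N := ⟨a, by omega⟩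
  let i1 : Fin N := ⟨a + 1, ha⟩
  have h01 : i0 < i1 := Fin.mk_lt_mk.2 (by omega)
  filter_upwards [ae_ne h01.ne] with τ hτ
  refine propext ⟨fun h => ?_, fun h => ?_⟩
  · obtain ⟨hi, hd⟩ := h
    rcases lt_or_gt_of_ne hτ with hlt | hgt
    · refine Or.inr ⟨fun i j hij hj => ?_, hd⟩
      rcases Nat.lt_succ_iff_lt_or_eq.1 hj with hj | hj
      · exact hi i j hij hj
      · obtain rfl : j = i1 := Fin.ext hj
        rcases (Nat.lt_succ_iff_lt_or_eq.1 (show (i : ℕ) < a + 1 from hij)) with h | h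
        · exact (hi i i0 h (Nat.lt_succ_self a)).trans hlt
        · obtain rfl : i = i0 := Fin.ext h
          exact hlt
    · refine Or.inl ⟨hi, fun i j hij hi' => ?_⟩
      rcases Nat.lt_or_eq_of_le hi' with h | h
      · exact hd i j hij h
      · obtain rfl : i = i0 := Fin.ext h.symm
        rcases Nat.lt_or_eq_of_le (show a + 1 ≤ (j : ℕ) from hij) with h | h
        · exact (hd i1 j h le_rfl).trans hgt
        · obtain rfl : j = i1 := Fin.ext h.symm
          exact hgt
  · rcases h with ⟨hi, hd⟩ | ⟨hi, hd⟩
    · exact ⟨hi, fun i j hij h => hd i j hij (by omega)⟩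
    · exact ⟨fun i j hij h => hi i j hij (by omega), hd⟩

theorem disjoint_upDown {N a : ℕ} (ha : a + 1 < N) :
    Disjoint (upDown N (a + 1) a) (upDown N (a + 2) (a + 1)) := by
  rw [Set.disjoint_left]
  intro τ h h'
  have h01 : (⟨a, by omega⟩ : Fin N) < ⟨a + 1, ha⟩ := Fin.mk_lt_mk.2 (by omega)
  exact lt_asymm (h.2 _ _ h01 le_rfl) (h'.1 _ _ h01 (Nat.lt_succ_self (a + 1)))

/-- The alternating sum over the positions of the turning point telescopes. -/
theorem sum_upDown {N : ℕ} {G : (Fin (N + 1) → ℝ) → ℂ} (hG : Integrable G) :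
    ∑ a ∈ Finset.range (N + 2), (-1 : ℂ) ^ a * ∫ τ in upDown (N + 1) a a, G τ = 0 := by
  set q : ℕ → ℂ := fun a => ∫ τ in upDown (N + 1) (a + 1) a, G τ
  have h0 : ∫ τ in upDown (N + 1) 0 0, G τ = q 0 := by rw [upDown_zero]
  have hs : ∀ a, a + 1 < N + 1 → ∫ τ in upDown (N + 1) (a + 1) (a + 1), G τ = q a + q (a + 1) := by
    intro a ha
    rw [setIntegral_congr_set (upDown_succ_ae ha), setIntegral_union (disjoint_upDown ha)
      (measurableSet_upDown _ _ _) hG.integrableOn hG.integrableOn]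
  have hl : ∫ τ in upDown (N + 1) (N + 1) (N + 1), G τ = q N := by rw [upDown_last]
  have key : ∀ M, M < N + 1 → ∑ a ∈ Finset.range (M + 1), (-1 : ℂ) ^ a *
      ∫ τ in upDown (N + 1) a a, G τ = (-1) ^ M * q M := by
    intro M
    induction M with
    | zero => intro _; simp [h0]
    | succ M ih =>
      intro hM
      rw [Finset.sum_range_succ, ih (by omega), hs M hM]
      ring
  rw [Finset.sum_range_succ, key N (by omega), hl]
  ring

section Split

variable (a b : ℕ)

/-- A family of `a + b` times from two families, the first of them reversed. -/
def splitEquiv : (Fin a → ℝ) × (Fin b → ℝ) ≃ᵐ (Fin (a + b) → ℝ) :=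
  (MeasurableEquiv.sumPiEquivProdPi fun _ : Fin a ⊕ Fin b => ℝ).symm.trans
    (MeasurableEquiv.arrowCongr' ((Fin.revPerm.sumCongr (Equiv.refl _)).trans finSumFinEquiv)
      (MeasurableEquiv.refl ℝ))

theorem measurePreserving_splitEquiv : MeasurePreserving (splitEquiv a b)
    (volume.prod volume) volume :=
  (volume_preserving_arrowCongr' _ (MeasurableEquiv.refl ℝ) (MeasurePreserving.id _)).comp
    (volume_measurePreserving_sumPiEquivProdPi_symm _)

theorem splitEquiv_apply (z : (Fin a → ℝ) × (Fin b → ℝ)) :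
    splitEquiv a b z = Fin.append (z.1 ∘ Fin.rev) z.2 := by
  funext i
  refine Fin.addCases (fun i => ?_) (fun i => ?_) i
  · rw [Fin.append_left]
    simp [splitEquiv, MeasurableEquiv.arrowCongr', Equiv.arrowCongr', Equiv.arrowCongr,
      MeasurableEquiv.coe_sumPiEquivProdPi_symm]
  · rw [Fin.append_right]
    simp [splitEquiv, MeasurableEquiv.arrowCongr', Equiv.arrowCongr', Equiv.arrowCongr,
      MeasurableEquiv.coe_sumPiEquivProdPi_symm]

theorem splitEquiv_preimage :
    splitEquiv a b ⁻¹' upDown (a + b) a a = ordered a ×ˢ ordered b := by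
  ext ⟨t, s⟩
  rw [Set.mem_preimage, splitEquiv_apply, Set.mem_prod]
  constructor
  · rintro ⟨h1, h2⟩
    refine ⟨fun i j hij => ?_, fun i j hij => ?_⟩
    · have := h1 (Fin.castAdd b j.rev) (Fin.castAdd b i.rev)
        (Fin.rev_lt_rev.2 hij) i.rev.isLt
      simpa only [Fin.append_left, Function.comp_apply, Fin.rev_rev] using this
    · have := h2 (Fin.natAdd a i) (Fin.natAdd a j) (Nat.add_lt_add_left hij a)
        (Nat.le_add_right a i)
      simpa only [Fin.append_right] using this
  · rintro ⟨h1, h2⟩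
    refine ⟨fun i j hij hj => ?_, fun i j hij hi => ?_⟩
    · have hij' : (i : ℕ) < j := hij
      obtain ⟨i, rfl⟩ : ∃ i', i = Fin.castAdd b i' := ⟨⟨i, by omega⟩, rfl⟩
      obtain ⟨j, rfl⟩ : ∃ j', j = Fin.castAdd b j' := ⟨⟨j, hj⟩, rfl⟩
      rw [Fin.append_left, Fin.append_left]
      exact h1 (Fin.rev_lt_rev.2 hij')
    · have hij' : (i : ℕ) < j := hij
      obtain ⟨i, rfl⟩ : ∃ i', i = Fin.natAdd a i' :=
        ⟨⟨i - a, by omega⟩, Fin.ext (by simp; omega)⟩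
      obtain ⟨j, rfl⟩ : ∃ j', j = Fin.natAdd a j' :=
        ⟨⟨j - a, by omega⟩, Fin.ext (by simp; omega)⟩
      rw [Fin.append_right, Fin.append_right]
      exact h2 (Nat.lt_of_add_lt_add_left hij')

end Split

section Unitary

variable {H : ℝ → Module.End ℂ SchwartzFock} {S : ℕ → Module.End ℂ SchwartzFock}

/-- For symmetric Hamiltonians, the first factors of a product can be moved to the other side of the
scalar product, in reverse order. -/
theorem orderedProd_append (hH : ∀ t, IsAdjointOn (H t) (H t)) {a b : ℕ} (Φ Ψ : SchwartzFock)
    (t : Fin a → ℝ) (s : Fin b → ℝ) :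
    orderedProd H (a + b) Φ Ψ (Fin.append (t ∘ Fin.rev) s) =
      ⟪toFock ((List.ofFn fun M => H (t M)).prod Φ),
        toFock ((List.ofFn fun M => H (s M)).prod Ψ)⟫_ℂ := by
  have h1 : (fun M => H (Fin.append (t ∘ Fin.rev) s M)) =
      Fin.append (fun M => H (t (Fin.rev M))) fun M => H (s M) := by
    funext i
    refine Fin.addCases (fun i => ?_) (fun i => ?_) i
    · simp [Fin.append_left]
    · simp [Fin.append_right]
  have h2 : (List.ofFn fun M => H (t (Fin.rev M))) = (List.ofFn fun M => H (t M)).reverse := by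
    refine List.ext_getElem (by simp) fun i _ _ => ?_
    simp only [List.getElem_ofFn, List.getElem_reverse, List.length_ofFn]
    congr 2
    ext
    simp [Fin.val_rev]
    omega
  have h3 := isAdjointOn_prod_reverse (List.ofFn fun M => H (t M)) fun A hA => by
    obtain ⟨M, rfl⟩ := List.mem_ofFn.1 hA
    exact hH _
  rw [orderedProd, h1, List.ofFn_fin_append, List.prod_append, Module.End.mul_apply, h2]
  exact (h3 _ _).symm

/-- The scalar product of two terms of the series is a single integral, with its times increasing
along the first `a` indices and decreasing along the last `b` indices. -/
theorem inner_dysonTerm (hH : ∀ t, IsAdjointOn (H t) (H t))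
    (hint : ∀ N Φ Ψ, Integrable (orderedProd H N Φ Ψ)) (hS : ∀ N, IsDysonTerm H N (S N))
    (a b : ℕ) (Φ Ψ : SchwartzFock) : ⟪toFock (S a Φ), toFock (S b Ψ)⟫_ℂ =
      ∫ τ in upDown (a + b) a a, orderedProd H (a + b) Φ Ψ τ := by
  have hm := measurePreserving_splitEquiv a b
  have he : MeasurableEmbedding (splitEquiv a b) := MeasurableEquiv.measurableEmbedding _
  rw [← hm.setIntegral_preimage_emb he, splitEquiv_preimage, setIntegral_prod]
  · simp only [splitEquiv_apply, orderedProd_append hH]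
    have h1 : ∀ X : SchwartzFock, ∫ s in ordered b,
        ⟪toFock X, toFock ((List.ofFn fun M => H (s M)).prod Ψ)⟫_ℂ =
          ⟪toFock X, toFock (S b Ψ)⟫_ℂ := fun X => ((hS b X Ψ).2).symm
    simp only [h1]
    rw [← inner_conj_symm, (hS a (S b Ψ) Φ).2, ← integral_conj]
    simp only [orderedProd, inner_conj_symm]
  · exact ((hm.integrable_comp_emb he).2 (hint (a + b) Φ Ψ)).integrableOn

theorem inner_dysonTerm_sub (hH : ∀ t, IsAdjointOn (H t) (H t))
    (hint : ∀ N Φ Ψ, Integrable (orderedProd H N Φ Ψ)) (hS : ∀ N, IsDysonTerm H N (S N))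
    {N j : ℕ} (hj : j ≤ N) (Φ Ψ : SchwartzFock) : ⟪toFock (S j Φ), toFock (S (N - j) Ψ)⟫_ℂ =
      ∫ τ in upDown N j j, orderedProd H N Φ Ψ τ := by
  obtain ⟨b, rfl⟩ := Nat.exists_eq_add_of_le hj
  rw [Nat.add_sub_cancel_left]
  exact inner_dysonTerm hH hint hS j b Φ Ψ

/-- Isometry of the formal series. -/
theorem sum_inner_dysonTerm (hH : ∀ t, IsAdjointOn (H t) (H t))
    (hint : ∀ N Φ Ψ, Integrable (orderedProd H N Φ Ψ)) (hS : ∀ N, IsDysonTerm H N (S N))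
    (hS0 : S 0 = 1) (N : ℕ) (Φ Ψ : SchwartzFock) : (∑ j ∈ Finset.range (N + 1),
      ⟪(-Complex.I) ^ j • toFock (S j Φ), (-Complex.I) ^ (N - j) • toFock (S (N - j) Ψ)⟫_ℂ) =
        if N = 0 then ⟪toFock Φ, toFock Ψ⟫_ℂ else 0 := by
  rcases N with _ | N
  · simp [hS0]
  · rw [if_neg (Nat.succ_ne_zero N)]
    have h := sum_upDown (hint (N + 1) Φ Ψ)
    have h' := (congrArg ((-Complex.I) ^ (N + 1) * ·) h).trans (mul_zero _)
    beta_reduce at h'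
    rw [Finset.mul_sum] at h'
    refine Eq.trans (Finset.sum_congr rfl fun j hj => ?_) h'
    have hj' : j ≤ N + 1 := Nat.lt_succ_iff.1 (Finset.mem_range.1 hj)
    have hp : (-Complex.I) ^ (N + 1) = (-Complex.I) ^ j * (-Complex.I) ^ (N + 1 - j) := by
      rw [← pow_add, Nat.add_sub_cancel' hj']
    have hq : (-(-Complex.I)) ^ j = (-Complex.I) ^ j * (-1) ^ j := by
      rw [← mul_pow]
      simp
    rw [← inner_dysonTerm_sub hH hint hS hj' Φ Ψ, inner_smul_left, inner_smul_right, map_pow,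
      map_neg, Complex.conj_I, hp, hq]
    ring

/-- A left inverse of a formal power series with constant term one is a right inverse. -/
theorem sum_mul_eq_of_sum_mul_eq {A : Type*} [Ring A] (a b : ℕ → A) (h0 : a 0 = 1)
    (h : ∀ N, ∑ j ∈ Finset.range (N + 1), b j * a (N - j) = if N = 0 then 1 else 0) (N : ℕ) :
    ∑ j ∈ Finset.range (N + 1), a j * b (N - j) = if N = 0 then 1 else 0 := by
  have h1 : PowerSeries.mk b * PowerSeries.mk a = 1 := by
    ext1 N
    rw [PowerSeries.coeff_mul, Finset.Nat.sum_antidiagonal_eq_sum_range_succ_mk,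
      PowerSeries.coeff_one, ← h N]
    simp only [PowerSeries.coeff_mk]
  have h2 := PowerSeries.mul_invOfUnit (PowerSeries.mk a) 1 (by simp [h0])
  rw [← left_inv_eq_right_inv h1 h2] at h2
  have h3 := congrArg (PowerSeries.coeff N) h2
  rw [PowerSeries.coeff_mul, Finset.Nat.sum_antidiagonal_eq_sum_range_succ_mk,
    PowerSeries.coeff_one] at h3
  simpa only [PowerSeries.coeff_mk] using h3

theorem inner_smul_toFock {A A' : Module.End ℂ SchwartzFock}
    (h : ∀ Φ X, ⟪toFock (A' Φ), toFock X⟫_ℂ = ⟪toFock Φ, toFock (A X)⟫_ℂ) (c d : ℂ)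
    (B : Module.End ℂ SchwartzFock) (Φ Ψ : SchwartzFock) :
    ⟪c • toFock (A' Φ), d • toFock (B Ψ)⟫_ℂ =
      ⟪toFock Φ, toFock (((conj c • A) * (d • B)) Ψ)⟫_ℂ := by
  rw [← map_smul toFock d, inner_smul_left, h, ← inner_smul_right, ← map_smul toFock]
  rfl

/-- The special case of endomorphisms, with the algebraic structures of `Module.End`. -/
theorem sum_end_mul_eq_of_sum_mul_eq {V : Type*} [AddCommGroup V] [Module ℂ V]
    (a b : ℕ → Module.End ℂ V) (h0 : a 0 = 1)
    (h : ∀ N, ∑ j ∈ Finset.range (N + 1), b j * a (N - j) = if N = 0 then 1 else 0) (N : ℕ) :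
    ∑ j ∈ Finset.range (N + 1), a j * b (N - j) = if N = 0 then 1 else 0 :=
  sum_mul_eq_of_sum_mul_eq a b h0 h N

theorem sum_inner_smul_toFock {A A' : ℕ → Module.End ℂ SchwartzFock}
    (h : ∀ j Φ X, ⟪toFock (A' j Φ), toFock X⟫_ℂ = ⟪toFock Φ, toFock (A j X)⟫_ℂ) (c d : ℕ → ℂ)
    (B : ℕ → Module.End ℂ SchwartzFock) (N : ℕ) (Φ Ψ : SchwartzFock) :
    ∑ j ∈ Finset.range (N + 1), ⟪c j • toFock (A' j Φ), d (N - j) • toFock (B (N - j) Ψ)⟫_ℂ =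
      ⟪toFock Φ, toFock ((∑ j ∈ Finset.range (N + 1),
        (conj (c j) • A j) * (d (N - j) • B (N - j))) Ψ)⟫_ℂ := by
  rw [LinearMap.sum_apply, map_sum, inner_sum]
  exact Finset.sum_congr rfl fun j _ => inner_smul_toFock (h j) (c j) (d (N - j)) _ Φ Ψ

theorem inner_toFock_ite (p : Prop) [Decidable p] (Φ Ψ : SchwartzFock) :
    ⟪toFock Φ, toFock ((if p then (1 : Module.End ℂ SchwartzFock) else 0) Ψ)⟫_ℂ =
      if p then ⟪toFock Φ, toFock Ψ⟫_ℂ else 0 := by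
  split_ifs
  · rfl
  · rw [LinearMap.zero_apply, map_zero, inner_zero_right]

theorem endSchwartzFock_ext {A B : Module.End ℂ SchwartzFock}
    (h : ∀ Φ Ψ, ⟪toFock Φ, toFock (A Ψ)⟫_ℂ = ⟪toFock Φ, toFock (B Ψ)⟫_ℂ) : A = B :=
  LinearMap.ext fun Ψ => ext_inner_toFock fun Φ => h Φ Ψ

/-- A formal series of operators on `D_S` with adjoints which is isometric, with the identity as its
constant term, is unitary. -/
theorem formallyUnitary_of_isometry (hS0 : S 0 = 1) (hadj : ∀ N, ∃ B, IsAdjointOn (S N) B)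
    (hU : ∀ (N : ℕ) (Φ Ψ : SchwartzFock), (∑ j ∈ Finset.range (N + 1),
      ⟪(-Complex.I) ^ j • toFock (S j Φ), (-Complex.I) ^ (N - j) • toFock (S (N - j) Ψ)⟫_ℂ) =
        if N = 0 then ⟪toFock Φ, toFock Ψ⟫_ℂ else 0) : FormallyUnitary S := by
  choose R hR using hadj
  have hR' : ∀ N Φ Ψ, ⟪toFock (S N Φ), toFock Ψ⟫_ℂ = ⟪toFock Φ, toFock (R N Ψ)⟫_ℂ := by
    intro N Φ Ψ
    rw [← inner_conj_symm, ← hR N Ψ Φ, inner_conj_symm]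
  refine ⟨R, hR, hU, fun N Φ Ψ => ?_⟩
  have e1 : ∀ j : ℕ, conj ((-Complex.I) ^ j) = Complex.I ^ j := fun j => by
    rw [map_pow, map_neg, Complex.conj_I, neg_neg]
  have e2 : ∀ j : ℕ, conj (Complex.I ^ j) = (-Complex.I) ^ j := fun j => by
    rw [map_pow, Complex.conj_I]
  obtain ⟨a, ha⟩ : ∃ a : ℕ → Module.End ℂ SchwartzFock, ∀ N, a N = (-Complex.I) ^ N • S N :=
    ⟨_, fun _ => rfl⟩
  obtain ⟨b, hb⟩ : ∃ b : ℕ → Module.End ℂ SchwartzFock, ∀ N, b N = Complex.I ^ N • R N :=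
    ⟨_, fun _ => rfl⟩
  have ha0 : a 0 = 1 := by rw [ha, pow_zero, one_smul, hS0]
  have hba : ∀ N, ∑ j ∈ Finset.range (N + 1), b j * a (N - j) = if N = 0 then 1 else 0 := by
    intro N
    refine endSchwartzFock_ext fun Φ Ψ => ?_
    have h := sum_inner_smul_toFock hR' (fun j => (-Complex.I) ^ j) (fun j => (-Complex.I) ^ j)
      S N Φ Ψ
    rw [hU N Φ Ψ] at h
    simp only [e1, ← ha, ← hb] at h
    rw [← h, inner_toFock_ite]
  have h := sum_inner_smul_toFock hR (fun j => Complex.I ^ j) (fun j => Complex.I ^ j) R N Φ Ψ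
  simp only [e2, ← ha, ← hb] at h
  have h' : ∑ j ∈ Finset.range (N + 1), a j * b (N - j) = if N = 0 then 1 else 0 :=
    sum_end_mul_eq_of_sum_mul_eq a b ha0 hba N
  rw [h'] at h
  exact h.trans (inner_toFock_ite _ Φ Ψ)

end Unitary

end QSTDyson

end

theorem mainTheorem2 (n : ℕ) (hn : 1 ≤ n) (m : ℝ) (hm : 0 < m)
    (lamT : 𝓢(ℝ, ℂ)) (lamX : 𝓢(Mom, ℂ)) :
    (∀ (N : ℕ) (J : Fin N → Finset (Fin n)),
      (∃ K : 𝓢(Fin N → Fin n → Mom, ℂ), ∀ k, K k = dysonKernel n m lamT lamX J k) ∧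
      (∀ d : ℕ, ∃ C : ℝ, ∀ k : Fin N → Fin n → Mom,
        ‖dysonKernel n m lamT lamX J k‖ * ∏ M, (1 + ‖vertexSum J k M‖) ^ d ≤
          C * Real.exp (-(1 / 2) * vertexSpread m J k))) ∧
    (∃! H : ℝ → Module.End ℂ SchwartzFock, IsCutoffHamiltonian n m lamT lamX H) ∧
    (∀ H : ℝ → Module.End ℂ SchwartzFock, IsCutoffHamiltonian n m lamT lamX H →
      ∃ S : ℕ → Module.End ℂ SchwartzFock,
        S 0 = 1 ∧
        (∀ N : ℕ, IsDysonTerm H N (S N)) ∧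
        (∀ N : ℕ, ∃ (L : ℕ) (τ : Fin L → WickTerm n N) (T : Fin L → Module.End ℂ SchwartzFock),
          S N = ∑ i, T i ∧
          ∀ i, IsWickOperator m lamT lamX (τ i) (T i) ∧
            ClosableWithCoreDS (T i) ∧
            ∃ W : 𝓢((Fin (τ i).r → Mom) × (Fin (τ i).s → Mom), ℂ),
              ∀ p q, W (p, q) = (τ i).kernel m lamT lamX p q) ∧
        (∀ N : ℕ, ClosableWithCoreDS (S N)) ∧
        ((∀ (t : ℝ) (x : Mom), conj (lamT t * lamX x) = lamT t * lamX x) →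
          FormallyUnitary S)) := by
  refine ⟨fun N J => ⟨isSchwartz_dysonKernel hn hm lamT lamX J,
      fun d => dysonKernel_gaussian_bound hn lamT lamX J d⟩,
    ⟨ham hn hm lamT lamX, isCutoffHamiltonian_ham hn hm lamT lamX,
      fun H hH => hH.eq lamT lamX (isCutoffHamiltonian_ham hn hm lamT lamX)⟩, fun H hH => ?_⟩
  obtain rfl : H = ham hn hm lamT lamX :=
    hH.eq lamT lamX (isCutoffHamiltonian_ham hn hm lamT lamX)
  choose L τ hτ using exists_dysonTerm hn hm lamT lamX
  obtain ⟨T, hT⟩ : ∃ T : ∀ N, Fin (L N) → Module.End ℂ SchwartzFock,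
      ∀ N i, T N i = (τ N i).op (reducedKernel hn hm lamT lamX (τ N i).J) := ⟨_, fun _ _ => rfl⟩
  have hTadj : ∀ N i, ∃ B, IsAdjointOn (T N i) B := fun N i => by
    rw [hT]
    exact exists_adjoint_wickOp _
  obtain ⟨S, hS⟩ : ∃ S : ℕ → Module.End ℂ SchwartzFock, ∀ N, S N = ∑ i, T N i :=
    ⟨_, fun _ => rfl⟩
  have hSadj : ∀ N, ∃ B, IsAdjointOn (S N) B := fun N => by
    rw [hS]
    exact exists_adjoint_sum _ fun i _ => hTadj N i
  have hint : ∀ N Φ Ψ, Integrable (orderedProd (ham hn hm lamT lamX) N Φ Ψ) :=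
    fun N Φ Ψ => (hτ N Φ Ψ).1
  have hdys : ∀ N, IsDysonTerm (ham hn hm lamT lamX) N (S N) := fun N Φ Ψ => by
    refine ⟨(hint N Φ Ψ).integrableOn, ?_⟩
    rw [(hτ N Φ Ψ).2, hS]
    simp only [hT]
  have hS0 : S 0 = 1 := by
    refine endSchwartzFock_ext fun Φ Ψ => ?_
    have ho : ordered 0 = Set.univ := Set.eq_univ_of_forall fun t i => i.elim0
    rw [(hdys 0 Φ Ψ).2, ho, Measure.restrict_univ, volume_pi, Measure.pi_of_empty,
      integral_dirac]
    rfl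
  refine ⟨S, hS0, hdys, fun N => ⟨L N, τ N, T N, hS N, fun i => ⟨fun Φ Ψ => ?_,
    (hTadj N i).choose_spec.closable, (τ N i).contract (reducedKernel hn hm lamT lamX (τ N i).J),
    fun p q => contract_reducedKernel hn hm lamT lamX (τ N i) (p, q)⟩⟩,
    fun N => (hSadj N).choose_spec.closable, fun hreal => ?_⟩
  · rw [hT]
    refine (inner_wickOp _ Φ Ψ).trans ?_
    simp only [contract_reducedKernel]
  · have hsym := fun t => isAdjointOn_of_isCutoffHamiltonian hreal hH t
    exact formallyUnitary_of_isometry hS0 hSadj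
      (sum_inner_dysonTerm hsym hint hdys hS0)
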